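/- Let $p\ge 1$, $n=2p$, and write points of $\mathbb{R}^{4p}$ as $\underline X=(x_1,y_1,\dots,x_{2p},y_{2p})$, with $z_k=x_k+iy_k$, $z_k^c=x_k-iy_k$, $\partial_{z_k}=\frac12(\partial_{x_k}-i\partial_{y_k})$, $\partial_{z_k^c}=\frac12(\partial_{x_k}+i\partial_{y_k})$. Let $\mathbb{C}_{4p}$ be the complex Clifford algebra with generators $e_1,\dots,e_{4p}$, $e_ie_j+e_je_i=-2\delta_{ij}$, and put $$\mathfrak f_k=-\tfrac12(e_{2k-1}-i\,e_{2k}),\qquad \mathfrak f_k^\dagger=\tfrac12(e_{2k-1}+i\,e_{2k}),\qquad k=1,\dots,2p.$$ Define the vector variables $$\underline z=\sum_{k=1}^{2p} z_k\mathfrak f_k,\quad \underline z^\dagger=\sum_{k=1}^{2p} z_k^c\mathfrak f_k^\dagger,\quad \underline z^J=\sum_{j=1}^p(z_{2j}\mathfrak f_{2j-1}^\dagger-z_{2j-1}\mathfrak f_{2j}^\dagger),\quad \underline z^{\dagger J}=\sum_{j=1}^p(z_{2j}^c\mathfrak f_{2j-1}-z_{2j-1}^c\mathfrak f_{2j}),$$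 the Dirac operators (acting by left multiplication) $$\partial_{\underline z}=\sum_k\mathfrak f_k^\dagger\partial_{z_k},\quad \partial_{\underline z}^\dagger=\sum_k\mathfrak f_k\partial_{z_k^c},\quad \partial_{\underline z}^J=\sum_j(\mathfrak f_{2j-1}\partial_{z_{2j}}-\mathfrak f_{2j}\partial_{z_{2j-1}}),\quad \partial_{\underline z}^{\dagger J}=\sum_j(\mathfrak f_{2j-1}^\dagger\partial_{z_{2j}^c}-\mathfrak f_{2j}^\dagger\partial_{z_{2j-1}^c}),$$ the left multiplication operator $P=\sum_{j=1}^p\mathfrak f_{2j}\mathfrak f_{2j-1}$ and the scalar operator $\mathcal E=\sum_{j=1}^p\left(z_{2j-1}\partial_{z_{2j}^c}-z_{2j}\partial_{z_{2j-1}^c}\right)$. A differentiable function $g$ with values in $\mathbb{C}_{4p}$ (for instance in spinor space, a left ideal of $\mathbb{C}_{4p}$) is $\mathfrak{osp}(4|2)$-monogenic in an open set $\Omega$ if $\partial_{\underline z}g=\partial_{\underline z}^\dagger g=\partial_{\underline z}^Jg=\partial_{\underline z}^{\dagger J}g=Pg=\mathcal E g=0$ in $\Omega$. Let $a_{4p}$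 be the area of the unit sphere of $\mathbb{R}^{4p}$ and $$E(\underline z)=\frac{2}{a_{4p}}\frac{\underline z}{|\underline X|^{4p}},\quad E^\dagger(\underline z)=\frac{2}{a_{4p}}\frac{\underline z^\dagger}{|\underline X|^{4p}},\quad E^J(\underline z)=\frac{2}{a_{4p}}\frac{\underline z^J}{|\underline X|^{4p}},\quad E^{\dagger J}(\underline z)=\frac{2}{a_{4p}}\frac{\underline z^{\dagger J}}{|\underline X|^{4p}}.$$ Let $\widehat{dz_k}$ (resp. $\widehat{dz_k^c}$) be the $(4p-1)$-form obtained from $dz_1\wedge dz_1^c\wedge\dots\wedge dz_{2p}\wedge dz_{2p}^c$ by omitting the factor $dz_k$ (resp. $dz_k^c$), and put $$d\sigma_{\underline z}=\sum_k\mathfrak f_k^\dagger\,\widehat{dz_k},\quad d\sigma_{\underline z^\dagger}=-\sum_k\mathfrak f_k\,\widehat{dz_k^c},\quad d\sigma_{\underline z^J}=\sum_j(\mathfrak f_{2j-1}\widehat{dz_{2j}}-\mathfrak f_{2j}\widehat{dz_{2j-1}}),\quad d\sigma_{\underline z^{\dagger J}}=-\sum_j(\mathfrak f_{2j-1}^\dagger\widehat{dz_{2j}^c}-\mathfrak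 f_{2j}^\dagger\widehat{dz_{2j-1}^c}).$$ Let $D\subset\mathbb{R}^{4p}$ be a bounded domain with smooth boundary $\partial D$, oriented by the outward normal, and let $g$ be $\mathfrak{osp}(4|2)$-monogenic in an open neighbourhood $\Omega$ of $\overline D$. Let $\underline v$ denote the vector variable of the integration point $\underline Y\in\partial D$ and $\underline z$ that of $\underline X$. Then, for every $\underline X\in\overset{\circ}{D}$, the following integrals converge absolutely and $$g(\underline X)=\frac{1}{(-2i)^n}\int_{\partial D}\left(E(\underline v-\underline z)\,d\sigma_{\underline v}+E^\dagger(\underline v-\underline z)\,d\sigma_{\underline v^\dagger}\right)g(\underline Y),$$ $$g(\underline X)=\frac{1}{(-2i)^n}\int_{\partial D}\left(E^J(\underline v-\underline z)\,d\sigma_{\underline v^J}+E^{\dagger J}(\underline v-\underline z)\,d\sigma_{\underline v^{\dagger J}}\right)g(\underline Y),$$ $$0=\int_{\partial D}E^\dagger(\underline v-\underline z)\,d\sigma_{\underline v}\,g(\underline Y),\qquad 0=\int_{\partial D}E^J(\underline v-\underline z)\,d\sigma_{\underline v^{\dagger J}}\,g(\underline Y),$$ $$0=\int_{\partial D}\left(\mathcal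 E E(\underline v-\underline z)\,d\sigma_{\underline v}+\mathcal E E^\dagger(\underline v-\underline z)\,d\sigma_{\underline v^\dagger}\right)g(\underline Y),$$ $$0=\int_{\partial D}\left(\mathcal E E^J(\underline v-\underline z)\,d\sigma_{\underline v^J}+\mathcal E E^{\dagger J}(\underline v-\underline z)\,d\sigma_{\underline v^{\dagger J}}\right)g(\underline Y),$$ where $\mathcal E$ acts on the kernels with respect to the variable $\underline X$. -/

import Mathlib

open scoped MeasureTheory ContDiff Gradient

noncomputable section

namespace OspMonogenic

/-! ### The complex Clifford algebra `ℂ_{4p}` -/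

/-- The complex quadratic form `v ↦ -∑ v_j²` in `4p` variables. -/
def cliffordForm (p : ℕ) : QuadraticForm ℂ (Fin (4 * p) → ℂ) :=
  QuadraticMap.weightedSumSquares ℂ (fun _ : Fin (4 * p) => (-1 : ℂ))

/-- The complex Clifford algebra `ℂ_{4p} = ℂ ⊗ ℝ_{0,4p}`: generators `e_j`, `e_j² = -1`. -/
def Cl (p : ℕ) : Type := CliffordAlgebra (cliffordForm p)

instance (p : ℕ) : Ring (Cl p) := inferInstanceAs (Ring (CliffordAlgebra (cliffordForm p)))

instance (p : ℕ) : Algebra ℂ (Cl p) :=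
  inferInstanceAs (Algebra ℂ (CliffordAlgebra (cliffordForm p)))

theorem finite_exteriorAlgebra (V : Type) [AddCommGroup V] [Module ℂ V] [Module.Finite ℂ V] :
    Module.Finite ℂ (ExteriorAlgebra ℂ V) := by
  have h1 : (⨆ i : ℕ, ⋀[ℂ]^i V) = ⊤ :=
    (DirectSum.Decomposition.isInternal (fun i : ℕ => ⋀[ℂ]^i V)).submodule_iSup_eq_top
  have h2 : (⨆ i ∈ Finset.range (Module.finrank ℂ V + 1), ⋀[ℂ]^i V) = ⊤ := by
    rw [eq_top_iff, ← h1]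
    refine iSup_le fun i => ?_
    by_cases hi : i < Module.finrank ℂ V + 1
    · exact le_iSup₂_of_le i (Finset.mem_range.2 hi) le_rfl
    · have h0 : Module.finrank ℂ (⋀[ℂ]^i V) = 0 := by
        rw [exteriorPower.finrank_eq]
        exact Nat.choose_eq_zero_of_lt (by omega)
      rw [Submodule.finrank_eq_zero.1 h0]
      exact bot_le
  refine Module.finite_def.2 ?_
  rw [← h2]
  exact Submodule.fg_biSup _ _ fun i _ => Module.Finite.iff_fg.1 inferInstance

instance (p : ℕ) : Module.Finite ℂ (Cl p) :=
  haveI : Module.Finite ℂ (ExteriorAlgebra ℂ (Fin (4 * p) → ℂ)) := finite_exteriorAlgebra _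
  haveI : Invertible (2 : ℂ) := invertibleOfNonzero two_ne_zero
  Module.Finite.equiv (CliffordAlgebra.equivExterior (cliffordForm p)).symm

section Norm

attribute [local instance] Matrix.linftyOpNormedRing Matrix.linftyOpNormedAlgebra

/-- A norm on the finite-dimensional algebra `ℂ_{4p}` (an operator norm of left multiplications).
It only serves to make derivatives and integrals available; these do not depend on its choice. -/
instance (p : ℕ) : NormedRing (Cl p) :=
  NormedRing.induced (Cl p) _ (Algebra.leftMulMatrix (Module.finBasis ℂ (Cl p)))
    (Algebra.leftMulMatrix_injective _)

instance (p : ℕ) : NormedAlgebra ℂ (Cl p) :=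
  NormedAlgebra.induced ℂ (Cl p) _ (Algebra.leftMulMatrix (Module.finBasis ℂ (Cl p)))

end Norm

/-! ### Euclidean space `ℝ^{4p}`, indices and coordinates

All indices start at `0`: `(X_0, …, X_{4p-1}) = (x_0, y_0, …, x_{2p-1}, y_{2p-1})`. -/

/-- Euclidean space `ℝ^{4p}`. -/
abbrev Space (p : ℕ) : Type := EuclideanSpace ℝ (Fin (4 * p))

/-- The position of `x_k` among the real coordinates. -/
def xIdx {p : ℕ} (k : Fin (2 * p)) : Fin (4 * p) := ⟨2 * k.1, by omega⟩

/-- The position of `y_k` among the real coordinates. -/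
def yIdx {p : ℕ} (k : Fin (2 * p)) : Fin (4 * p) := ⟨2 * k.1 + 1, by omega⟩

/-- The first complex index of the `j`-th quaternionic pair (`2j-1` when counting from `1`). -/
def fstIdx {p : ℕ} (j : Fin p) : Fin (2 * p) := ⟨2 * j.1, by omega⟩

/-- The second complex index of the `j`-th quaternionic pair (`2j` when counting from `1`). -/
def sndIdx {p : ℕ} (j : Fin p) : Fin (2 * p) := ⟨2 * j.1 + 1, by omega⟩

/-- The real coordinate `X_i`, as a linear form. -/
def coord {p : ℕ} (i : Fin (4 * p)) : Space p →ₗ[ℝ] ℝ := (EuclideanSpace.proj i).toLinearMap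

/-- The complex coordinate `z_k = x_k + i y_k`; being linear, it is also the one-form `dz_k`. -/
def zCoord {p : ℕ} (k : Fin (2 * p)) : Space p →ₗ[ℝ] ℂ :=
  Complex.ofRealCLM.toLinearMap ∘ₗ coord (xIdx k) +
    Complex.I • (Complex.ofRealCLM.toLinearMap ∘ₗ coord (yIdx k))

/-- The conjugate coordinate `z_k^c = x_k - i y_k`, and the one-form `dz_k^c`. -/
def zcCoord {p : ℕ} (k : Fin (2 * p)) : Space p →ₗ[ℝ] ℂ :=
  Complex.ofRealCLM.toLinearMap ∘ₗ coord (xIdx k) -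
    Complex.I • (Complex.ofRealCLM.toLinearMap ∘ₗ coord (yIdx k))

/-! ### Witt basis and vector variables -/

/-- The generators `e_i` of the Clifford algebra. -/
def eGen {p : ℕ} (i : Fin (4 * p)) : Cl p := CliffordAlgebra.ι (cliffordForm p) (Pi.single i 1)

/-- The Witt basis vector `𝔣_k`. -/
def wittF {p : ℕ} (k : Fin (2 * p)) : Cl p :=
  (-(1 / 2) : ℂ) • (eGen (xIdx k) - Complex.I • eGen (yIdx k))

/-- The Witt basis vector `𝔣_k†`. -/
def wittFd {p : ℕ} (k : Fin (2 * p)) : Cl p :=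
  (1 / 2 : ℂ) • (eGen (xIdx k) + Complex.I • eGen (yIdx k))

/-- The hermitian vector variable `z = ∑ z_k 𝔣_k`. -/
def vecZ {p : ℕ} (X : Space p) : Cl p := ∑ k, zCoord k X • wittF k

/-- The hermitian vector variable `z† = ∑ z_k^c 𝔣_k†`. -/
def vecZd {p : ℕ} (X : Space p) : Cl p := ∑ k, zcCoord k X • wittFd k

/-- The rotated vector variable `z^J`. -/
def vecZJ {p : ℕ} (X : Space p) : Cl p :=
  ∑ j : Fin p, (zCoord (sndIdx j) X • wittFd (fstIdx j) - zCoord (fstIdx j) X • wittFd (sndIdx j))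

/-- The rotated vector variable `z^{†J}`. -/
def vecZdJ {p : ℕ} (X : Space p) : Cl p :=
  ∑ j : Fin p, (zcCoord (sndIdx j) X • wittF (fstIdx j) - zcCoord (fstIdx j) X • wittF (sndIdx j))

/-! ### Differential operators -/

/-- The partial derivative with respect to the real coordinate `X_i`. -/
def pd {p : ℕ} (i : Fin (4 * p)) (F : Space p → Cl p) (X : Space p) : Cl p :=
  fderiv ℝ F X (EuclideanSpace.single i 1)

/-- `∂_{z_k} = (∂_{x_k} - i ∂_{y_k}) / 2`. -/
def dzOp {p : ℕ} (k : Fin (2 * p)) (F : Space p → Cl p) (X : Space p) : Cl p :=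
  (1 / 2 : ℂ) • (pd (xIdx k) F X - Complex.I • pd (yIdx k) F X)

/-- `∂_{z_k^c} = (∂_{x_k} + i ∂_{y_k}) / 2`. -/
def dzcOp {p : ℕ} (k : Fin (2 * p)) (F : Space p → Cl p) (X : Space p) : Cl p :=
  (1 / 2 : ℂ) • (pd (xIdx k) F X + Complex.I • pd (yIdx k) F X)

/-- The Dirac operator `∂_z`. -/
def diracZ {p : ℕ} (F : Space p → Cl p) (X : Space p) : Cl p := ∑ k, wittFd k * dzOp k F X

/-- The Dirac operator `∂_z†`. -/
def diracZd {p : ℕ} (F : Space p → Cl p) (X : Space p) : Cl p := ∑ k, wittF k * dzcOp k F X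

/-- The Dirac operator `∂_z^J`. -/
def diracZJ {p : ℕ} (F : Space p → Cl p) (X : Space p) : Cl p :=
  ∑ j : Fin p, (wittF (fstIdx j) * dzOp (sndIdx j) F X - wittF (sndIdx j) * dzOp (fstIdx j) F X)

/-- The Dirac operator `∂_z^{†J}`. -/
def diracZdJ {p : ℕ} (F : Space p → Cl p) (X : Space p) : Cl p :=
  ∑ j : Fin p, (wittFd (fstIdx j) * dzcOp (sndIdx j) F X - wittFd (sndIdx j) * dzcOp (fstIdx j) F X)

/-- The Clifford element `P = 𝔣_2 𝔣_1 + 𝔣_4 𝔣_3 + ⋯ + 𝔣_{2p} 𝔣_{2p-1}` (counting from `1`). -/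
def opP (p : ℕ) : Cl p := ∑ j : Fin p, wittF (sndIdx j) * wittF (fstIdx j)

/-- The Euler-type scalar operator
`𝓔 = ∑ z_{2j-1} ∂_{z_{2j}^c} - z_{2j} ∂_{z_{2j-1}^c}` (counting from `1`). -/
def euler {p : ℕ} (F : Space p → Cl p) (X : Space p) : Cl p :=
  ∑ j : Fin p, (zCoord (fstIdx j) X • dzcOp (sndIdx j) F X - zCoord (sndIdx j) X • dzcOp (fstIdx j) F X)

/-- `osp(4|2)`-monogenic functions in a region `Ω`. The values may be arbitrary in `ℂ_{4p}`; this
covers the functions with values in spinor space, which is a left ideal of `ℂ_{4p}`. -/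
structure IsOspMonogenic {p : ℕ} (g : Space p → Cl p) (Ω : Set (Space p)) : Prop where
  differentiableOn : DifferentiableOn ℝ g Ω
  diracZ_eq_zero : ∀ X ∈ Ω, diracZ g X = 0
  diracZd_eq_zero : ∀ X ∈ Ω, diracZd g X = 0
  diracZJ_eq_zero : ∀ X ∈ Ω, diracZJ g X = 0
  diracZdJ_eq_zero : ∀ X ∈ Ω, diracZdJ g X = 0
  opP_mul_eq_zero : ∀ X ∈ Ω, opP p * g X = 0
  euler_eq_zero : ∀ X ∈ Ω, euler g X = 0

/-! ### Bounded domains with smooth boundary -/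

/-- `ρ` is a smooth defining function of `D` in the neighbourhood `U` of the point `x`. -/
structure IsLocalDefiningFunction {p : ℕ} (D : Set (Space p)) (x : Space p) (U : Set (Space p))
    (ρ : Space p → ℝ) : Prop where
  isOpen : IsOpen U
  mem : x ∈ U
  contDiffOn : ContDiffOn ℝ ∞ ρ U
  gradient_ne_zero : ∇ ρ x ≠ 0
  inter_eq : D ∩ U = {y ∈ U | ρ y < 0}

/-- Bounded domains (open connected sets) of `ℝ^{4p}` with smooth boundary. -/
structure IsSmoothBoundedDomain {p : ℕ} (D : Set (Space p)) : Prop where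
  isOpen : IsOpen D
  isConnected : IsConnected D
  isBounded : Bornology.IsBounded D
  smooth_boundary : ∀ x ∈ frontier D, ∃ U ρ, IsLocalDefiningFunction D x U ρ

/-- `ν` is the outward unit normal of `D` at `x`: the normalized gradient of a local defining
function (which does not depend on the defining function). -/
def IsOutwardUnitNormal {p : ℕ} (D : Set (Space p)) (x ν : Space p) : Prop :=
  ∃ U ρ, IsLocalDefiningFunction D x U ρ ∧ ν = ‖∇ ρ x‖⁻¹ • ∇ ρ x

open Classical in
/-- The outward unit normal of `D` at a boundary point. -/
def outwardNormal {p : ℕ} (D : Set (Space p)) (x : Space p) : Space p :=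
  if h : ∃ ν, IsOutwardUnitNormal D x ν then h.choose else 0

/-! ### Differential forms of degree `4p - 1` and their boundary integrals -/

/-- (Values at a point of) differential forms of degree `4p-1` on `ℝ^{4p}` with values in `V`. -/
abbrev Form (p : ℕ) (V : Type) [AddCommMonoid V] [Module ℝ V] : Type :=
  (Space p) [⋀^Fin (4 * p - 1)]→ₗ[ℝ] V

/-- The increasing enumeration of the indices different from `i`. -/
def omitIdx {p : ℕ} (i : Fin (4 * p)) (a : Fin (4 * p - 1)) : Fin (4 * p) :=
  if a.1 < i.1 then ⟨a.1, by omega⟩ else ⟨a.1 + 1, by omega⟩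

/-- The wedge product `θ_0 ∧ ⋯ ∧ θ_{4p-2}` of complex one-forms:
`(v_0, …, v_{4p-2}) ↦ det (θ_b (v_a))`. -/
def wedge {p : ℕ} (θ : Fin (4 * p - 1) → (Space p →ₗ[ℝ] ℂ)) : Form p ℂ :=
  { toFun := fun v => Matrix.det (Matrix.of fun a b => θ b (v a))
    map_update_add' := by
      intro inst v a x y
      obtain rfl : inst = instDecidableEqFin _ := Subsingleton.elim _ _
      have key : ∀ w : Space p, (Matrix.of fun a' b => θ b (Function.update v a w a')) =
          (Matrix.of fun a' b => θ b (v a')).updateRow a (fun b => θ b w) := by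
        intro w; ext a' b
        by_cases h : a' = a
        · subst h; simp
        · simp [h]
      simp only [key, map_add]
      exact Matrix.det_updateRow_add _ _ _ _
    map_update_smul' := by
      intro inst v a c x
      obtain rfl : inst = instDecidableEqFin _ := Subsingleton.elim _ _
      have key : ∀ w : Space p, (Matrix.of fun a' b => θ b (Function.update v a w a')) =
          (Matrix.of fun a' b => θ b (v a')).updateRow a (fun b => θ b w) := by
        intro w; ext a' b
        by_cases h : a' = a
        · subst h; simp
        · simp [h]
      simp only [key, map_smul]
      exact Matrix.det_updateRow_smul _ _ (c : ℂ) _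
    map_eq_zero_of_eq' := by
      intro v a b hv hab
      exact Matrix.det_zero_of_row_eq hab (by ext c; simp [hv]) }

/-- The complex coframe `dz_0, dz_0^c, dz_1, dz_1^c, …` in this order. -/
def coframe {p : ℕ} (i : Fin (4 * p)) : Space p →ₗ[ℝ] ℂ :=
  if i.1 % 2 = 0 then zCoord ⟨i.1 / 2, by omega⟩ else zcCoord ⟨i.1 / 2, by omega⟩

/-- The form `\widehat{dz_k}`: the wedge product of the coframe with `dz_k` omitted. -/
def hatDz {p : ℕ} (k : Fin (2 * p)) : Form p ℂ := wedge fun a => coframe (omitIdx (xIdx k) a)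

/-- The form `\widehat{dz_k^c}`: the wedge product of the coframe with `dz_k^c` omitted. -/
def hatDzc {p : ℕ} (k : Fin (2 * p)) : Form p ℂ := wedge fun a => coframe (omitIdx (yIdx k) a)

/-- The product `c η` of a Clifford constant `c` and a complex form `η`. -/
def clForm {p : ℕ} (c : Cl p) (η : Form p ℂ) : Form p (Cl p) :=
  (LinearMap.toSpanSingleton ℂ (Cl p) c).restrictScalars ℝ |>.compAlternatingMap η

/-- The form `dσ_z = ∑ 𝔣_k† \widehat{dz_k}`. -/
def dσ {p : ℕ} : Form p (Cl p) := ∑ k, clForm (wittFd k) (hatDz k)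

/-- The form `dσ_{z†} = -∑ 𝔣_k \widehat{dz_k^c}`. -/
def dσd {p : ℕ} : Form p (Cl p) := -∑ k, clForm (wittF k) (hatDzc k)

/-- The form `dσ_{z^J}`. -/
def dσJ {p : ℕ} : Form p (Cl p) :=
  ∑ j : Fin p, (clForm (wittF (fstIdx j)) (hatDz (sndIdx j)) -
    clForm (wittF (sndIdx j)) (hatDz (fstIdx j)))

/-- The form `dσ_{z^{†J}}`. -/
def dσdJ {p : ℕ} : Form p (Cl p) :=
  -∑ j : Fin p, (clForm (wittFd (fstIdx j)) (hatDzc (sndIdx j)) -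
    clForm (wittFd (sndIdx j)) (hatDzc (fstIdx j)))

/-- The product `a η b` of a Clifford-valued form with Clifford numbers on both sides. -/
def mulForm {p : ℕ} (a : Cl p) (η : Form p (Cl p)) (b : Cl p) : Form p (Cl p) :=
  ((LinearMap.mulLeft ℝ a) ∘ₗ (LinearMap.mulRight ℝ b)).compAlternatingMap η

/-- The density of `η` with respect to surface measure on an oriented hypersurface with unit
normal `ν`, i.e. the value of `ν♭ ∧ η` on the standard basis. It equals `η (τ_1, …, τ_{4p-1})` for
every orthonormal basis `τ` of the tangent space such that `(ν, τ_1, …, τ_{4p-1})` is positively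
oriented, which is the boundary orientation when `ν` is the outward normal. -/
def density {p : ℕ} (η : Form p (Cl p)) (ν : Space p) : Cl p :=
  ∑ i : Fin (4 * p), ((-1 : ℝ) ^ i.1 * ν i) • η fun a => EuclideanSpace.single (omitIdx i a) 1

/-- `∫_{∂D} η = c`, the integral being absolutely convergent. The surface measure is the
`(4p-1)`-dimensional Hausdorff measure in its Euclidean normalization. -/
def HasBoundaryIntegral {p : ℕ} (D : Set (Space p)) (η : Space p → Form p (Cl p)) (c : Cl p) :
    Prop :=
  MeasureTheory.IntegrableOn (fun Y => density (η Y) (outwardNormal D Y)) (frontier D)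
      μHE[4 * p - 1] ∧
    ∫ Y in frontier D, density (η Y) (outwardNormal D Y) ∂μHE[4 * p - 1] = c

/-! ### Cauchy kernels -/

/-- The area `a_{4p}` of the unit sphere of `ℝ^{4p}`. -/
def sphereArea (p : ℕ) : ℝ := (μHE[4 * p - 1] (Metric.sphere (0 : Space p) 1)).toReal

/-- The kernel `E(z) = (2 / a_{4p}) z / |z|^{4p}`. -/
def kerE {p : ℕ} (X : Space p) : Cl p := (2 / sphereArea p / ‖X‖ ^ (4 * p)) • vecZ X

/-- The kernel `E†(z) = (2 / a_{4p}) z† / |z|^{4p}`. -/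
def kerEd {p : ℕ} (X : Space p) : Cl p := (2 / sphereArea p / ‖X‖ ^ (4 * p)) • vecZd X

/-- The kernel `E^J(z) = (2 / a_{4p}) z^J / |z|^{4p}`. -/
def kerEJ {p : ℕ} (X : Space p) : Cl p := (2 / sphereArea p / ‖X‖ ^ (4 * p)) • vecZJ X

/-- The kernel `E^{†J}(z) = (2 / a_{4p}) z^{†J} / |z|^{4p}`. -/
def kerEdJ {p : ℕ} (X : Space p) : Cl p := (2 / sphereArea p / ‖X‖ ^ (4 * p)) • vecZdJ X

end OspMonogenic

end

open OspMonogenic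

/-!
The two vector variables of each pair, `z, z†` and `z^J, z^{†J}`, square to zero and have
anticommutator `|X|²`. Hence, if the kernels are regularized to `a(x) / (|x|² + s)^{2p}`, the field
whose flux in the direction `ν` is `∑ a(x) b(ν) g / (|x|² + s)^{2p}`, with `b` the symbols of the
two Dirac operators annihilating `g`, has divergence a constant multiple of
`s g / (|x|² + s)^{2p+1}`. As `s → 0` this is an approximate identity in the volume, while the
boundary integral converges to the one with the singular kernels: this is Cauchy's formula. Its
constant is the area of the unit sphere by the same formula for the constant function `1` on the
unit ball.

The matrix of the coframe `dz_1, dz_1^c, …` has an explicit inverse, so its adjugate identifies the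
value of each form `dσ` on the tangent space with `(-2i)^{2p} / 2` times a vector variable evaluated
at the normal. The identities for a single kernel are the Cauchy formula for a symbol of square
zero, and those for `𝓔` follow by differentiating the Cauchy formula in `X` under the integral.
-/

noncomputable section

namespace OspMonogenic

open MeasureTheory MeasureTheory.Measure Filter Topology Set
open scoped Asymptotics ENNReal NNReal

/-! ### Area formula for injective immersions -/

section AreaFormula

theorem euclideanHausdorffMeasure_image_le_of_edist_le {X Y Z : Type*}
    [EMetricSpace Y] [MeasurableSpace Y] [BorelSpace Y]
    [EMetricSpace Z] [MeasurableSpace Z] [BorelSpace Z] {f : X → Y} {g : X → Z} {A : Set X}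
    {K : ℝ≥0} (h : ∀ x ∈ A, ∀ y ∈ A, edist (f x) (f y) ≤ K * edist (g x) (g y)) (d : ℕ) :
    μHE[d] (f '' A) ≤ (K : ℝ≥0∞) ^ d * μHE[d] (g '' A) := by
  rcases A.eq_empty_or_nonempty with rfl | ⟨x₀, -⟩
  · simp
  have : Nonempty X := ⟨x₀⟩
  set r := Function.invFunOn g A
  have hr : ∀ x ∈ A, r (g x) ∈ A ∧ g (r (g x)) = g x :=
    fun x hx => ⟨Function.invFunOn_mem ⟨x, hx, rfl⟩, Function.invFunOn_eq ⟨x, hx, rfl⟩⟩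
  have hLipschitz : LipschitzOnWith K (f ∘ r) (g '' A) := by
    rintro _ ⟨x, hx, rfl⟩ _ ⟨y, hy, rfl⟩
    simpa only [Function.comp_apply, (hr x hx).2, (hr y hy).2] using h _ (hr x hx).1 _ (hr y hy).1
  have himage : (f ∘ r) '' (g '' A) = f '' A := by
    rw [image_image]
    refine image_congr fun x hx => ?_
    simpa [(hr x hx).2] using h _ (hr x hx).1 _ hx
  have hle := hLipschitz.hausdorffMeasure_image_le (d := d) (by positivity)
  rw [himage, ENNReal.rpow_natCast] at hle
  simp only [euclideanHausdorffMeasure_def, Measure.smul_apply, nnreal_smul_coe_apply]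
  rw [mul_left_comm]
  gcongr

theorem measure_le_of_locally_le {X : Type*} [TopologicalSpace X] [SecondCountableTopology X]
    [MeasurableSpace X] [OpensMeasurableSpace X] {μ ν : Measure X}
    (h : ∀ x, ∃ V ∈ 𝓝 x, ∀ A ⊆ V, MeasurableSet A → μ A ≤ ν A) : μ ≤ ν := by
  choose V hV hle using h
  obtain ⟨s, hs, hcover⟩ :=
    TopologicalSpace.countable_cover_nhds fun x => interior_mem_nhds.2 (hV x)
  rcases isEmpty_or_nonempty X with _ | _
  · exact (Measure.eq_zero_of_isEmpty μ).trans_le (Measure.zero_le ν)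
  obtain ⟨u, rfl⟩ := hs.exists_eq_range <|
    nonempty_iff_ne_empty.2 fun hs' => by simp [hs', empty_ne_univ] at hcover
  rw [biUnion_range] at hcover
  let W : ℕ → Set X := disjointed fun k => interior (V (u k))
  have hWm (k : ℕ) : MeasurableSet (W k) :=
    .disjointed (fun _ => isOpen_interior.measurableSet) k
  have hsplit (ξ : Measure X) {A : Set X} (hA : MeasurableSet A) : ξ A = ∑' k, ξ (A ∩ W k) := by
    rw [← measure_iUnion (fun i j hij => (disjoint_disjointed _ hij).mono inter_subset_right
      inter_subset_right) fun k => hA.inter (hWm k), ← inter_iUnion, iUnion_disjointed,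
      hcover, inter_univ]
  refine Measure.le_iff.2 fun A hA => ?_
  rw [hsplit μ hA, hsplit ν hA]
  exact ENNReal.tsum_le_tsum fun k => hle (u k) _
    (inter_subset_right.trans ((disjointed_subset _ k).trans interior_subset)) (hA.inter (hWm k))

theorem ennreal_le_of_forall_one_lt_le_pow_mul {a b : ℝ≥0∞} (n : ℕ)
    (h : ∀ K : ℝ≥0, 1 < K → a ≤ (K : ℝ≥0∞) ^ n * b) : a ≤ b := by
  have hlim : Tendsto (fun K : ℝ≥0 => (K : ℝ≥0∞) ^ n * b) (𝓝[>] 1) (𝓝 (1 * b)) := by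
    refine ENNReal.Tendsto.mul_const ?_ (Or.inl one_ne_zero)
    have hpow : Tendsto (fun K : ℝ≥0 => K ^ n) (𝓝[>] 1) (𝓝 (1 ^ n)) :=
      ((continuous_pow n).tendsto 1).mono_left nhdsWithin_le_nhds
    simpa using ENNReal.tendsto_coe.2 hpow
  rw [one_mul] at hlim
  exact ge_of_tendsto hlim (eventually_mem_nhdsWithin.mono h)

theorem eventually_norm_le_mul_norm_of_isEquivalent {X E : Type*} [NormedAddCommGroup E]
    {u v : X → E} {l : Filter X} (h : u ~[l] v) {K : ℝ} (hK : 1 < K) :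
    ∀ᶠ x in l, ‖u x‖ ≤ K * ‖v x‖ := by
  filter_upwards [h.isLittleO.def (sub_pos.2 hK)] with x hx
  have := norm_le_insert' (u x) (v x)
  simp only [Pi.sub_apply] at hx
  linarith

theorem isEquivalent_sub_of_hasStrictFDerivAt {U V : Type*} [NormedAddCommGroup U]
    [NormedSpace ℝ U] [FiniteDimensional ℝ U] [NormedAddCommGroup V] [NormedSpace ℝ V]
    {f : U → V} {L : U →L[ℝ] V} {x₀ : U} (hf : HasStrictFDerivAt f L x₀)
    (hL : Function.Injective L) :
    (fun p : U × U => f p.1 - f p.2) ~[𝓝 (x₀, x₀)] fun p => L p.1 - L p.2 := by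
  obtain ⟨C, -, hC⟩ := L.toLinearMap.exists_antilipschitzWith (LinearMap.ker_eq_bot.2 hL)
  have hbound : (fun p : U × U => p.1 - p.2) =O[𝓝 (x₀, x₀)] fun p => L p.1 - L p.2 :=
    .of_bound C <| .of_forall fun p => by simpa [dist_eq_norm] using hC.le_mul_dist p.1 p.2
  refine (hf.isLittleO.trans_isBigO hbound).congr_left fun p => ?_
  simp

section WithDensity

variable {X : Type*} [TopologicalSpace X] [MeasurableSpace X] {μ : Measure X}
  {j : X → ℝ≥0∞} {x₀ : X} {K : ℝ≥0}

theorem exists_nhds_withDensity_le (hj : ContinuousAt j x₀) (h₀ : j x₀ ≠ 0) (htop : j x₀ ≠ ⊤)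
    (hK : 1 < K) :
    ∃ N ∈ 𝓝 x₀, ∀ A ⊆ N, MeasurableSet A → μ.withDensity j A ≤ K * (j x₀ * μ A) := by
  have hlt : j x₀ < K * j x₀ := by
    simpa using ENNReal.mul_lt_mul_left h₀ htop (ENNReal.coe_lt_coe.2 hK)
  refine ⟨_, hj.eventually_lt_const hlt, fun A hA hAm => ?_⟩
  rw [withDensity_apply _ hAm, ← mul_assoc, ← setLIntegral_const]
  exact setLIntegral_mono' hAm fun x hx => (hA hx).le

theorem exists_nhds_le_withDensity (hj : ContinuousAt j x₀) (h₀ : j x₀ ≠ 0) (htop : j x₀ ≠ ⊤)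
    (hK : 1 < K) :
    ∃ N ∈ 𝓝 x₀, ∀ A ⊆ N, MeasurableSet A → j x₀ * μ A ≤ K * μ.withDensity j A := by
  have hlt : j x₀ < K * j x₀ := by
    simpa using ENNReal.mul_lt_mul_left h₀ htop (ENNReal.coe_lt_coe.2 hK)
  have hcont : ContinuousAt (fun x => K * j x) x₀ :=
    ENNReal.Tendsto.const_mul hj (Or.inr ENNReal.coe_ne_top)
  refine ⟨_, hcont.eventually_const_lt hlt, fun A hA hAm => ?_⟩
  rw [withDensity_apply _ hAm, ← lintegral_const_mul' _ _ ENNReal.coe_ne_top, ← setLIntegral_const]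
  exact setLIntegral_mono' hAm fun x hx => (hA hx).le

end WithDensity

variable {U V : Type*} [NormedAddCommGroup U] [InnerProductSpace ℝ U] [FiniteDimensional ℝ U]
  [NormedAddCommGroup V] [InnerProductSpace ℝ V]

theorem continuous_normDet [FiniteDimensional ℝ V] :
    Continuous fun L : U →L[ℝ] V => L.toLinearMap.normDet := by
  have hsqrt (L : U →L[ℝ] V) :
      L.toLinearMap.normDet = √((ContinuousLinearMap.adjoint L ∘L L).det) := by
    rw [← Real.sqrt_sq (LinearMap.normDet_nonneg L.toLinearMap)]
    exact congrArg Real.sqrt L.normDet_sq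
  simp only [hsqrt]
  refine Real.continuous_sqrt.comp (ContinuousLinearMap.continuous_det.comp ?_)
  exact (ContinuousLinearMap.adjoint (𝕜 := ℝ) (E := U) (F := V)).continuous.clm_comp continuous_id

/-- The Jacobian `√det((Df)ᵀ Df)` of a map between Euclidean spaces, as an extended nonnegative
density. -/
def jacobian (f : U → V) (x : U) : ℝ≥0∞ := .ofReal (fderiv ℝ f x).toLinearMap.normDet

theorem continuous_jacobian [FiniteDimensional ℝ V] {f : U → V} (hf : ContDiff ℝ 1 f) :
    Continuous (jacobian f) :=
  ENNReal.continuous_ofReal.comp (continuous_normDet.comp (hf.continuous_fderiv one_ne_zero))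

theorem jacobian_ne_zero {f : U → V} {x : U} (h : Function.Injective (fderiv ℝ f x)) :
    jacobian f x ≠ 0 := by
  have hne := ((fderiv ℝ f x).toLinearMap.normDet_ne_zero_tfae.out 0 4).2 h
  exact (ENNReal.ofReal_pos.2 ((LinearMap.normDet_nonneg _).lt_of_ne' hne)).ne'

variable [MeasurableSpace U] [BorelSpace U] [MeasurableSpace V] [BorelSpace V]

theorem exists_nhds_euclideanHausdorffMeasure_image_comparable {f : U → V} {x₀ : U}
    (hf : ContDiffAt ℝ 1 f x₀) (hinj : Function.Injective (fderiv ℝ f x₀)) {K : ℝ≥0}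
    (hK : 1 < K) :
    ∃ N ∈ 𝓝 x₀, ∀ A ⊆ N,
      μHE[Module.finrank ℝ U] (f '' A) ≤
        (K : ℝ≥0∞) ^ Module.finrank ℝ U * (jacobian f x₀ * volume A) ∧
      jacobian f x₀ * volume A ≤
        (K : ℝ≥0∞) ^ Module.finrank ℝ U * μHE[Module.finrank ℝ U] (f '' A) := by
  set L := fderiv ℝ f x₀
  have hequiv := isEquivalent_sub_of_hasStrictFDerivAt (hf.hasStrictFDerivAt one_ne_zero) hinj
  have hclose := (eventually_norm_le_mul_norm_of_isEquivalent hequiv (K := K) hK).and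
    (eventually_norm_le_mul_norm_of_isEquivalent hequiv.symm (K := K) hK)
  rw [nhds_prod_eq, eventually_prod_self_iff'] at hclose
  obtain ⟨N, hN, hclose⟩ := hclose
  have hvolume (A : Set U) : jacobian f x₀ * volume A = μHE[Module.finrank ℝ U] (L '' A) :=
    (LinearMap.euclideanHausdorffMeasure_image_eq_normDet_mul_volume L.toLinearMap A).symm
  have hedist {a b c d : V} (h : ‖a - b‖ ≤ K * ‖c - d‖) : edist a b ≤ K * edist c d := by
    rw [← dist_eq_norm, ← dist_eq_norm] at h
    rw [edist_nndist, edist_nndist]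
    exact_mod_cast h
  refine ⟨N, hN, fun A hA => ⟨?_, ?_⟩⟩ <;> rw [hvolume]
  · exact euclideanHausdorffMeasure_image_le_of_edist_le
      (fun x hx y hy => hedist (hclose x (hA hx) y (hA hy)).1) _
  · exact euclideanHausdorffMeasure_image_le_of_edist_le
      (fun x hx y hy => hedist (hclose x (hA hx) y (hA hy)).2) _

theorem map_withDensity_jacobian [FiniteDimensional ℝ V] {f : U → V} (hf : ContDiff ℝ 1 f)
    (hinj : Function.Injective f) (himm : ∀ x, Function.Injective (fderiv ℝ f x)) :
    (volume.withDensity (jacobian f)).map f = μHE[Module.finrank ℝ U].restrict (range f) := by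
  have hemb : MeasurableEmbedding f := hf.continuous.measurableEmbedding hinj
  set d := Module.finrank ℝ U
  have hJ (x : U) : ContinuousAt (jacobian f) x := (continuous_jacobian hf).continuousAt
  have hJ₀ (x : U) : jacobian f x ≠ 0 := jacobian_ne_zero (himm x)
  suffices heq : volume.withDensity (jacobian f) = μHE[d].comap f by rw [heq, hemb.map_comap]
  refine le_antisymm ?_ ?_ <;> refine Measure.le_iff.2 fun A _ =>
    ennreal_le_of_forall_one_lt_le_pow_mul (d + 1) fun K hK =>
      measure_le_of_locally_le (ν := (K : ℝ≥0∞) ^ (d + 1) • _) (fun x => ?_) A <;>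
    obtain ⟨N, hN, hfL⟩ :=
      exists_nhds_euclideanHausdorffMeasure_image_comparable hf.contDiffAt (himm x) hK
  · obtain ⟨N', hN', hle⟩ :=
      exists_nhds_withDensity_le (μ := volume) (hJ x) (hJ₀ x) ENNReal.ofReal_ne_top hK
    refine ⟨N ∩ N', inter_mem hN hN', fun A hA hAm => ?_⟩
    rw [Measure.smul_apply, hemb.comap_apply, smul_eq_mul, pow_succ', mul_assoc]
    exact (hle A (hA.trans inter_subset_right) hAm).trans <|
      mul_right_mono (hfL A (hA.trans inter_subset_left)).2
  · obtain ⟨N', hN', hle⟩ :=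
      exists_nhds_le_withDensity (μ := volume) (hJ x) (hJ₀ x) ENNReal.ofReal_ne_top hK
    refine ⟨N ∩ N', inter_mem hN hN', fun A hA hAm => ?_⟩
    rw [Measure.smul_apply, hemb.comap_apply, smul_eq_mul, pow_succ, mul_assoc]
    exact (hfL A (hA.trans inter_subset_left)).1.trans <|
      mul_right_mono (hle A (hA.trans inter_subset_right) hAm)

end AreaFormula

/-! ### The divergence theorem for half-spaces and subgraphs -/

section Divergence

variable {n : ℕ} {V : Type*} [NormedAddCommGroup V] [NormedSpace ℝ V]

theorem exists_lt_forall_tsupport_subset_ball {ι E W : Type*} [Finite ι]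
    [SeminormedAddCommGroup E] [Zero W] {f : ι → E → W} (hs : ∀ j, HasCompactSupport (f j))
    (r : ℝ) : ∃ R, r < R ∧ ∀ j, tsupport (f j) ⊆ Metric.ball 0 R := by
  obtain ⟨R, hR, hsub⟩ :=
    (isCompact_iUnion fun j => hs j).isBounded.subset_ball_lt r (0 : E)
  exact ⟨R, hR, fun j => (subset_iUnion _ j).trans hsub⟩

theorem integral_divergence_halfSpace_pi (i : Fin (n + 1)) (c : ℝ)
    {f : Fin (n + 1) → (Fin (n + 1) → ℝ) → V} (hf : ∀ j, Differentiable ℝ (f j))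
    (hs : ∀ j, HasCompactSupport (f j))
    (hdiv : Continuous fun x => ∑ j, fderiv ℝ (f j) x (Pi.single j 1)) :
    ∫ x in {x | x i ≤ c}, ∑ j, fderiv ℝ (f j) x (Pi.single j 1) =
      ∫ y : Fin n → ℝ, f i (i.insertNth c y) := by
  obtain ⟨R, hcR, hsupp⟩ := exists_lt_forall_tsupport_subset_ball hs |c|
  have hR : 0 < R := (abs_nonneg c).trans_lt hcR
  have hzero (j) {x} (hx : x ∉ Metric.ball 0 R) : f j x = 0 :=
    image_eq_zero_of_notMem_tsupport (notMem_subset (hsupp j) hx)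
  have hface (j) {t : ℝ} (ht : |t| = R) (y : Fin n → ℝ) : f j (j.insertNth t y) = 0 :=
    hzero j fun hy => by
      have := (pi_norm_lt_iff hR).1 (mem_ball_zero_iff.1 hy) j
      simp [ht] at this
  -- The box `Icc a b` is the part of the cube of half-side `R` in the half-space.
  set a : Fin (n + 1) → ℝ := fun _ => -R
  set b : Fin (n + 1) → ℝ := Function.update (fun _ => R) i c
  have hbi : b i = c := Function.update_self ..
  have hbj {j} (hj : j ≠ i) : b j = R := Function.update_of_ne hj ..
  have hab : a ≤ b := le_update_iff.2 ⟨(abs_lt.1 hcR).1.le, fun _ _ => by simp [a, hR.le]⟩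
  have hbox {x : Fin (n + 1) → ℝ} (hx : x ∈ Metric.ball 0 R) (hxi : x i ≤ c) : x ∈ Icc a b := by
    have hx (k) : |x k| < R := (pi_norm_lt_iff hR).1 (mem_ball_zero_iff.1 hx) k
    exact ⟨fun k => (abs_lt.1 (hx k)).1.le,
      le_update_iff.2 ⟨hxi, fun k _ => (abs_lt.1 (hx k)).2.le⟩⟩
  have hhalf : ∫ x in {x | x i ≤ c}, ∑ j, fderiv ℝ (f j) x (Pi.single j 1) =
      ∫ x in Icc a b, ∑ j, fderiv ℝ (f j) x (Pi.single j 1) := by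
    refine setIntegral_eq_of_subset_of_forall_sdiff_eq_zero
      (measurableSet_le (measurable_pi_apply i) measurable_const)
      (fun x hx => (hx.2 i).trans_eq hbi) fun x hx => Finset.sum_eq_zero fun j _ => ?_
    rw [fderiv_of_notMem_tsupport (𝕜 := ℝ) fun h => hx.2 (hbox (hsupp j h) hx.1),
      zero_apply]
  rw [hhalf, integral_divergence_of_hasFDerivAt_off_countable' a b hab f
    (fun j x => fderiv ℝ (f j) x) ∅ countable_empty (fun j => (hf j).continuous.continuousOn)
    (fun x _ j => (hf j x).hasFDerivAt) (hdiv.continuousOn.integrableOn_compact isCompact_Icc)]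
  have hback (j) (y : Fin n → ℝ) : f j (j.insertNth (a j) y) = 0 := hface j (by simp [a, hR.le]) y
  have hfront {j} (hj : j ≠ i) (y : Fin n → ℝ) : f j (j.insertNth (b j) y) = 0 :=
    hface j (by simp [hbj hj, hR.le]) y
  rw [Finset.sum_eq_single i (fun j _ hj => by simp [hback, hfront hj]) (by simp)]
  simp only [hback, integral_zero, sub_zero, hbi]
  refine setIntegral_eq_integral_of_forall_compl_eq_zero fun y hy => hzero i fun h => hy ?_
  exact (Fin.insertNth_mem_Icc.1 (hbox h (by simp))).2

/-- The divergence of a field, given by its components. -/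
def divergence {m : ℕ} (F : Fin m → EuclideanSpace ℝ (Fin m) → V)
    (x : EuclideanSpace ℝ (Fin m)) : V :=
  ∑ j, fderiv ℝ (F j) x (EuclideanSpace.single j 1)

theorem divergence_of_notMem_tsupport {m : ℕ} {F : Fin m → EuclideanSpace ℝ (Fin m) → V}
    {x : EuclideanSpace ℝ (Fin m)} (hx : ∀ j, x ∉ tsupport (F j)) : divergence F x = 0 :=
  Finset.sum_eq_zero fun j _ => by
    rw [fderiv_of_notMem_tsupport (𝕜 := ℝ) (hx j), zero_apply]

theorem hasCompactSupport_divergence {m : ℕ} {F : Fin m → EuclideanSpace ℝ (Fin m) → V}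
    (hs : ∀ j, HasCompactSupport (F j)) : HasCompactSupport (divergence F) :=
  .intro (isCompact_iUnion fun j => hs j) fun _ hx =>
    divergence_of_notMem_tsupport fun j hj => hx (mem_iUnion.2 ⟨j, hj⟩)

/-- The isometric embedding of `ℝⁿ` onto the coordinate hyperplane `{x | x i = 0}` of `ℝⁿ⁺¹`. -/
def hyperplaneEmb (i : Fin (n + 1)) :
    EuclideanSpace ℝ (Fin n) →ₗᵢ[ℝ] EuclideanSpace ℝ (Fin (n + 1)) where
  toFun y := WithLp.toLp 2 (i.insertNth (0 : ℝ) y.ofLp)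
  map_add' x y := by
    ext k
    refine Fin.succAboveCases i ?_ (fun k => ?_) k <;> simp
  map_smul' c y := by
    ext k
    refine Fin.succAboveCases i ?_ (fun k => ?_) k <;> simp
  norm_map' y := by
    simp [EuclideanSpace.norm_eq, Fin.sum_univ_succAbove _ i]

/-- The projection of `ℝⁿ⁺¹` to `ℝⁿ` forgetting the `i`-th coordinate. -/
def dropCoord (i : Fin (n + 1)) :
    EuclideanSpace ℝ (Fin (n + 1)) →L[ℝ] EuclideanSpace ℝ (Fin n) :=
  LinearMap.toContinuousLinearMap
    { toFun := fun x => WithLp.toLp 2 fun k => x (i.succAbove k)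
      map_add' := fun _ _ => rfl
      map_smul' := fun _ _ => rfl }

@[simp]
theorem hyperplaneEmb_apply_self (i : Fin (n + 1)) (y : EuclideanSpace ℝ (Fin n)) :
    hyperplaneEmb i y i = 0 := by
  simp [hyperplaneEmb]

@[simp]
theorem hyperplaneEmb_apply_succAbove (i : Fin (n + 1)) (y : EuclideanSpace ℝ (Fin n))
    (k : Fin n) : hyperplaneEmb i y (i.succAbove k) = y k := by
  simp [hyperplaneEmb]

@[simp]
theorem dropCoord_apply (i : Fin (n + 1)) (x : EuclideanSpace ℝ (Fin (n + 1))) (k : Fin n) :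
    dropCoord i x k = x (i.succAbove k) := rfl

@[simp]
theorem dropCoord_hyperplaneEmb (i : Fin (n + 1)) (y : EuclideanSpace ℝ (Fin n)) :
    dropCoord i (hyperplaneEmb i y) = y := by
  ext k; simp

@[simp]
theorem dropCoord_single_self (i : Fin (n + 1)) (c : ℝ) :
    dropCoord i (EuclideanSpace.single i c) = 0 := by
  ext k; simp [Fin.succAbove_ne]

@[simp]
theorem dropCoord_single_succAbove (i : Fin (n + 1)) (k : Fin n) (c : ℝ) :
    dropCoord i (EuclideanSpace.single (i.succAbove k) c) = EuclideanSpace.single k c := by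
  ext l; simp

theorem hyperplaneEmb_single (i : Fin (n + 1)) (k : Fin n) (c : ℝ) :
    hyperplaneEmb i (EuclideanSpace.single k c) = EuclideanSpace.single (i.succAbove k) c := by
  ext l
  refine Fin.succAboveCases i ?_ (fun l => ?_) l <;> simp

theorem hyperplaneEmb_dropCoord_add_smul_single (i : Fin (n + 1))
    (x : EuclideanSpace ℝ (Fin (n + 1))) :
    hyperplaneEmb i (dropCoord i x) + x i • EuclideanSpace.single i (1 : ℝ) = x := by
  ext l
  refine Fin.succAboveCases i ?_ (fun l => ?_) l <;> simp [Fin.succAbove_ne]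

theorem integral_divergence_halfSpace (i : Fin (n + 1)) (c : ℝ)
    {f : Fin (n + 1) → EuclideanSpace ℝ (Fin (n + 1)) → V} (hf : ∀ j, Differentiable ℝ (f j))
    (hs : ∀ j, HasCompactSupport (f j)) (hdiv : Continuous (divergence f)) :
    ∫ x in {x | x i ≤ c}, divergence f x =
      ∫ y, f i (hyperplaneEmb i y + c • EuclideanSpace.single i 1) := by
  set e : (Fin (n + 1) → ℝ) ≃L[ℝ] EuclideanSpace ℝ (Fin (n + 1)) :=
    (EuclideanSpace.equiv (Fin (n + 1)) ℝ).symm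
  have hdiv_comp :
      (fun x => ∑ j, fderiv ℝ (f j ∘ e) x (Pi.single j 1)) = divergence f ∘ e := by
    funext x
    simp only [e.comp_right_fderiv]
    rfl
  have hpi := integral_divergence_halfSpace_pi i c (f := fun j => f j ∘ e)
    (fun j => (hf j).comp e.differentiable)
    (fun j => (hs j).comp_homeomorph e.toHomeomorph)
    (hdiv_comp ▸ hdiv.comp e.continuous)
  have hvol : MeasurePreserving e := PiLp.volume_preserving_toLp _
  have hvol' : MeasurePreserving (WithLp.toLp 2 : (Fin n → ℝ) → EuclideanSpace ℝ (Fin n)) :=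
    PiLp.volume_preserving_toLp _
  rw [hdiv_comp] at hpi
  rw [← hvol.setIntegral_preimage_emb e.toHomeomorph.measurableEmbedding,
    ← hvol'.integral_comp (MeasurableEquiv.toLp 2 (Fin n → ℝ)).measurableEmbedding]
  refine Eq.trans rfl (hpi.trans (integral_congr_ae (.of_forall fun y => congrArg (f i) ?_)))
  ext l
  refine Fin.succAboveCases i ?_ (fun l => ?_) l <;> simp [e, Fin.succAbove_ne]

theorem integral_divergence_eq_zero
    {f : Fin (n + 1) → EuclideanSpace ℝ (Fin (n + 1)) → V} (hf : ∀ j, Differentiable ℝ (f j))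
    (hs : ∀ j, HasCompactSupport (f j)) (hdiv : Continuous (divergence f)) :
    ∫ x, divergence f x = 0 := by
  obtain ⟨R, -, hsupp⟩ := exists_lt_forall_tsupport_subset_ball hs 0
  have hlt {j x} (hx : x ∈ tsupport (f j)) : x 0 < R :=
    (le_abs_self _).trans_lt ((PiLp.norm_apply_le x 0).trans_lt
      (mem_ball_zero_iff.1 (hsupp j hx)))
  calc ∫ x, divergence f x = ∫ x in {x | x 0 ≤ R}, divergence f x :=
        (setIntegral_eq_integral_of_forall_compl_eq_zero fun x hx =>
          divergence_of_notMem_tsupport fun j hj => hx (hlt hj).le).symm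
    _ = ∫ y, f 0 (hyperplaneEmb 0 y + R • EuclideanSpace.single 0 1) :=
        integral_divergence_halfSpace 0 R hf hs hdiv
    _ = 0 := integral_eq_zero_of_ae <| .of_forall fun y =>
        image_eq_zero_of_notMem_tsupport fun hy => by simpa using hlt hy

/-- The shear `x ↦ x + γ(x') e_i`, where `x'` consists of the coordinates other than `x_i`; it
maps the half-space `{x | x i ≤ 0}` onto the subgraph of `γ`. -/
def shear (i : Fin (n + 1)) {γ : EuclideanSpace ℝ (Fin n) → ℝ} (hγ : Continuous γ) :
    EuclideanSpace ℝ (Fin (n + 1)) ≃ₜ EuclideanSpace ℝ (Fin (n + 1)) where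
  toFun x := x + γ (dropCoord i x) • EuclideanSpace.single i (1 : ℝ)
  invFun x := x - γ (dropCoord i x) • EuclideanSpace.single i (1 : ℝ)
  left_inv x := by simp
  right_inv x := by simp
  continuous_toFun := by fun_prop
  continuous_invFun := by fun_prop

theorem shear_apply (i : Fin (n + 1)) {γ : EuclideanSpace ℝ (Fin n) → ℝ} (hγ : Continuous γ)
    (x : EuclideanSpace ℝ (Fin (n + 1))) :
    shear i hγ x = x + γ (dropCoord i x) • EuclideanSpace.single i (1 : ℝ) := rfl

theorem measurePreserving_shear (i : Fin (n + 1)) {γ : EuclideanSpace ℝ (Fin n) → ℝ}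
    (hγ : Continuous γ) : MeasurePreserving (shear i hγ) := by
  have hskew : MeasurePreserving
      (fun q : (Fin n → ℝ) × ℝ => (q.1, q.2 + γ (WithLp.toLp 2 q.1))) :=
    (MeasurePreserving.id volume).skew_product (g := fun y t => t + γ (WithLp.toLp 2 y))
      (by unfold Function.uncurry; fun_prop) (.of_forall fun _ => map_add_right_eq_self volume _)
  have hsplit := (measurePreserving_swap.comp
    (volume_preserving_piFinSuccAbove (fun _ : Fin (n + 1) => ℝ) i)).comp
    (PiLp.volume_preserving_ofLp (Fin (n + 1)))
  have hjoin := ((PiLp.volume_preserving_toLp (Fin (n + 1))).comp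
    (volume_preserving_piFinSuccAbove (fun _ : Fin (n + 1) => ℝ) i).symm).comp
    measurePreserving_swap
  convert (hjoin.comp hskew).comp hsplit using 1
  funext x
  change _ = WithLp.toLp 2 (i.insertNth (α := fun _ => ℝ) (x i + γ (dropCoord i x))
    fun k => x (i.succAbove k))
  ext l
  refine Fin.succAboveCases i ?_ (fun l => ?_) l <;> simp [shear_apply, Fin.succAbove_ne]

end Divergence

section Subgraph

variable {n : ℕ} {V : Type*} [NormedAddCommGroup V] [NormedSpace ℝ V] (i : Fin (n + 1))
  {γ : EuclideanSpace ℝ (Fin n) → ℝ} {F : Fin (n + 1) → EuclideanSpace ℝ (Fin (n + 1)) → V}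

/-- The pull-back of a field under the shear along `γ`. It has the same divergence as the field
(the shear is volume preserving), and its normal component along `{x | x i = 0}` is the flux
density of the field through the graph of `γ`. -/
def shearPullback (hγ : Continuous γ) (F : Fin (n + 1) → EuclideanSpace ℝ (Fin (n + 1)) → V) :
    Fin (n + 1) → EuclideanSpace ℝ (Fin (n + 1)) → V :=
  i.insertNth (α := fun _ => EuclideanSpace ℝ (Fin (n + 1)) → V)
    (fun x => F i (shear i hγ x) -
      ∑ k, fderiv ℝ γ (dropCoord i x) (EuclideanSpace.single k 1) •
        F (i.succAbove k) (shear i hγ x))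
    (fun k x => F (i.succAbove k) (shear i hγ x))

theorem shearPullback_self (hγ : Continuous γ) :
    shearPullback i hγ F i = fun x => F i (shear i hγ x) -
      ∑ k, fderiv ℝ γ (dropCoord i x) (EuclideanSpace.single k 1) •
        F (i.succAbove k) (shear i hγ x) :=
  Fin.insertNth_apply_same ..

theorem shearPullback_succAbove (hγ : Continuous γ) (k : Fin n) :
    shearPullback i hγ F (i.succAbove k) = fun x => F (i.succAbove k) (shear i hγ x) :=
  Fin.insertNth_apply_succAbove ..

theorem hasFDerivAt_comp_shear (hγ : Differentiable ℝ γ) {f : EuclideanSpace ℝ (Fin (n + 1)) → V}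
    (hf : Differentiable ℝ f) (x : EuclideanSpace ℝ (Fin (n + 1))) :
    HasFDerivAt (fun x => f (shear i hγ.continuous x))
      ((fderiv ℝ f (shear i hγ.continuous x)).comp (ContinuousLinearMap.id ℝ _ +
        ((fderiv ℝ γ (dropCoord i x)).comp (dropCoord i)).smulRight
          (EuclideanSpace.single i (1 : ℝ)))) x :=
  (hf _).hasFDerivAt.comp x <| (hasFDerivAt_id x).add <|
    ((hγ _).hasFDerivAt.comp x (dropCoord i).hasFDerivAt).smul_const _

theorem hasFDerivAt_shearPullback_self (hγ : ContDiff ℝ 2 γ) (hF : ∀ j, Differentiable ℝ (F j))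
    (x : EuclideanSpace ℝ (Fin (n + 1))) :
    HasFDerivAt (shearPullback i hγ.continuous F i)
      (fderiv ℝ (fun x => F i (shear i hγ.continuous x)) x -
        ∑ k, (fderiv ℝ γ (dropCoord i x) (EuclideanSpace.single k 1) •
            fderiv ℝ (fun x => F (i.succAbove k) (shear i hγ.continuous x)) x +
          ((fderiv ℝ (fun y => fderiv ℝ γ y (EuclideanSpace.single k 1))
            (dropCoord i x)).comp (dropCoord i)).smulRight
              (F (i.succAbove k) (shear i hγ.continuous x)))) x := by
  have hdγ (k : Fin n) : HasFDerivAt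
      (fun x => fderiv ℝ γ (dropCoord i x) (EuclideanSpace.single k 1))
      ((fderiv ℝ (fun y => fderiv ℝ γ y (EuclideanSpace.single k 1))
        (dropCoord i x)).comp (dropCoord i)) x :=
    ((((hγ.fderiv_right (m := 1) (by norm_num)).differentiable one_ne_zero).clm_apply
      (differentiable_const _) (dropCoord i x)).hasFDerivAt).comp x (dropCoord i).hasFDerivAt
  have hFs (j) : HasFDerivAt (fun x => F j (shear i hγ.continuous x)) _ x :=
    (hasFDerivAt_comp_shear i (hγ.differentiable two_ne_zero)
      (hF j) x).differentiableAt.hasFDerivAt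
  rw [shearPullback_self]
  exact (hFs i).sub (.fun_sum fun k _ => (hdγ k).smul (hFs (i.succAbove k)))

theorem differentiable_shearPullback (hγ : ContDiff ℝ 2 γ) (hF : ∀ j, Differentiable ℝ (F j))
    (j : Fin (n + 1)) : Differentiable ℝ (shearPullback i hγ.continuous F j) := by
  refine Fin.succAboveCases i (fun x => ?_) (fun k x => ?_) j
  · exact (hasFDerivAt_shearPullback_self i hγ hF x).differentiableAt
  · rw [shearPullback_succAbove]
    exact (hasFDerivAt_comp_shear i (hγ.differentiable two_ne_zero) (hF _) x).differentiableAt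

theorem hasCompactSupport_shearPullback (hγ : Continuous γ) (hs : ∀ j, HasCompactSupport (F j))
    (j : Fin (n + 1)) : HasCompactSupport (shearPullback i hγ F j) := by
  have hs' (j) : HasCompactSupport (F j ∘ shear i hγ) := (hs j).comp_homeomorph _
  refine Fin.succAboveCases i ?_ (fun k => ?_) j
  · refine .intro (isCompact_iUnion hs') fun x hx => ?_
    have h₀ (j) : F j (shear i hγ x) = 0 :=
      image_eq_zero_of_notMem_tsupport (f := F j ∘ shear i hγ) fun h => hx (mem_iUnion.2 ⟨j, h⟩)
    simp [shearPullback_self, h₀]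
  · rw [shearPullback_succAbove]
    exact hs' _

theorem divergence_shearPullback (hγ : ContDiff ℝ 2 γ) (hF : ∀ j, Differentiable ℝ (F j)) :
    divergence (shearPullback i hγ.continuous F) = divergence F ∘ shear i hγ.continuous := by
  funext x
  have hFs (j) := (hasFDerivAt_comp_shear i (hγ.differentiable two_ne_zero) (hF j) x).fderiv
  simp only [divergence, Function.comp_apply, Fin.sum_univ_succAbove _ i, shearPullback_succAbove,
    (hasFDerivAt_shearPullback_self i hγ hF x).fderiv, hFs]
  simp [Finset.sum_add_distrib]

/-- The parametrization of the graph `{x | x i = γ(x')}`. -/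
def graphMap (γ : EuclideanSpace ℝ (Fin n) → ℝ) (y : EuclideanSpace ℝ (Fin n)) :
    EuclideanSpace ℝ (Fin (n + 1)) :=
  hyperplaneEmb i y + γ y • EuclideanSpace.single i 1

/-- The flux density of a field through the graph of `γ`, with respect to the parametrization
`graphMap i γ` and the upward normal `e_i - ∑ k, ∂ₖγ e_k`. -/
def graphFlux (γ : EuclideanSpace ℝ (Fin n) → ℝ)
    (F : Fin (n + 1) → EuclideanSpace ℝ (Fin (n + 1)) → V) (y : EuclideanSpace ℝ (Fin n)) : V :=
  F i (graphMap i γ y) - ∑ k, fderiv ℝ γ y (EuclideanSpace.single k 1) •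
    F (i.succAbove k) (graphMap i γ y)

theorem shearPullback_hyperplaneEmb (hγ : Continuous γ) (y : EuclideanSpace ℝ (Fin n)) :
    shearPullback i hγ F i (hyperplaneEmb i y) = graphFlux i γ F y := by
  simp [shearPullback_self, shear_apply, graphFlux, graphMap]

theorem integral_divergence_subgraph_le (hγ : ContDiff ℝ 2 γ) (hF : ∀ j, Differentiable ℝ (F j))
    (hs : ∀ j, HasCompactSupport (F j)) (hdiv : Continuous (divergence F)) :
    ∫ x in {x | x i ≤ γ (dropCoord i x)}, divergence F x = ∫ y, graphFlux i γ F y := by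
  set Φ := shear i hγ.continuous
  have hpre : {x : EuclideanSpace ℝ (Fin (n + 1)) | x i ≤ 0} =
      Φ ⁻¹' {x | x i ≤ γ (dropCoord i x)} := by
    ext x
    simp [Φ, shear_apply]
  have hhalf := integral_divergence_halfSpace i 0 (differentiable_shearPullback i hγ hF)
    (hasCompactSupport_shearPullback i hγ.continuous hs)
    (divergence_shearPullback i hγ hF ▸ hdiv.comp Φ.continuous)
  simp only [divergence_shearPullback i hγ hF, zero_smul, add_zero, shearPullback_hyperplaneEmb,
    hpre] at hhalf
  rw [← hhalf]
  exact ((measurePreserving_shear i hγ.continuous).setIntegral_preimage_emb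
    Φ.measurableEmbedding _ _).symm

theorem volume_graph_eq_zero (hγ : Continuous γ) :
    volume {x : EuclideanSpace ℝ (Fin (n + 1)) | x i = γ (dropCoord i x)} = 0 := by
  rw [← (measurePreserving_shear i hγ).measure_preimage_emb (shear i hγ).measurableEmbedding,
    ← (PiLp.volume_preserving_toLp (Fin (n + 1))).measure_preimage_emb
      (MeasurableEquiv.toLp 2 (Fin (n + 1) → ℝ)).measurableEmbedding]
  have hpre : (WithLp.toLp 2 ⁻¹' (shear i hγ ⁻¹' {x | x.ofLp i = γ (dropCoord i x)}) :
      Set (Fin (n + 1) → ℝ)) = {f | f i = 0} := by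
    ext x
    simp [shear_apply]
  rw [hpre]
  exact Measure.pi_hyperplane (fun _ : Fin (n + 1) => (volume : Measure ℝ)) i 0

theorem measurableSet_subgraph (hγ : Continuous γ) :
    MeasurableSet {x : EuclideanSpace ℝ (Fin (n + 1)) | x i ≤ γ (dropCoord i x)} :=
  (isClosed_le (by fun_prop) (by fun_prop)).measurableSet

theorem integral_divergence_subgraph_lt (hγ : ContDiff ℝ 2 γ) (hF : ∀ j, Differentiable ℝ (F j))
    (hs : ∀ j, HasCompactSupport (F j)) (hdiv : Continuous (divergence F)) :
    ∫ x in {x | x i < γ (dropCoord i x)}, divergence F x = ∫ y, graphFlux i γ F y := by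
  rw [← integral_divergence_subgraph_le i hγ hF hs hdiv]
  refine setIntegral_congr_set (eventuallyEq_set.2 ?_)
  filter_upwards [measure_eq_zero_iff_ae_notMem.1 (volume_graph_eq_zero i hγ.continuous)] with x hx
  exact ⟨le_of_lt, fun h => lt_of_le_of_ne h hx⟩

theorem integral_divergence_supergraph (hγ : ContDiff ℝ 2 γ)
    (hF : ∀ j, Differentiable ℝ (F j)) (hs : ∀ j, HasCompactSupport (F j))
    (hdiv : Continuous (divergence F)) :
    ∫ x in {x | γ (dropCoord i x) < x i}, divergence F x = -∫ y, graphFlux i γ F y := by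
  have h := integral_add_compl (measurableSet_subgraph i hγ.continuous)
    (hdiv.integrable_of_hasCompactSupport (μ := volume) (hasCompactSupport_divergence hs))
  rw [integral_divergence_eq_zero hF hs hdiv,
    integral_divergence_subgraph_le i hγ hF hs hdiv] at h
  simpa only [compl_ofPred, not_le] using eq_neg_of_add_eq_zero_right h

theorem normDet_hyperplaneEmb_add_smulRight (a : EuclideanSpace ℝ (Fin n) →L[ℝ] ℝ) :
    ((hyperplaneEmb i).toContinuousLinearMap +
      a.smulRight (EuclideanSpace.single i (1 : ℝ))).toLinearMap.normDet =
      √(1 + ∑ k, a (EuclideanSpace.single k 1) ^ 2) := by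
  set L := (hyperplaneEmb i).toContinuousLinearMap +
    a.smulRight (EuclideanSpace.single i (1 : ℝ)) with hL
  set u : Fin n → ℝ := fun k => a (EuclideanSpace.single k 1) with hu
  have hLu (k) : L.toLinearMap (EuclideanSpace.basisFun (Fin n) ℝ k) =
      EuclideanSpace.single (i.succAbove k) (1 : ℝ) + u k • EuclideanSpace.single i 1 := by
    simp [hL, hu, hyperplaneEmb_single]
  have hgram : Matrix.gram ℝ (fun k => L.toLinearMap (EuclideanSpace.basisFun (Fin n) ℝ k)) =
      1 + Matrix.replicateCol Unit u * Matrix.replicateRow Unit u := by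
    ext k l
    rw [Matrix.gram_apply, hLu, hLu]
    simp [inner_add_left, inner_add_right, inner_smul_left, inner_smul_right,
      Matrix.one_apply, Matrix.mul_apply, EuclideanSpace.inner_single_left,
      Fin.succAbove_ne, (Fin.succAbove_ne i _).symm, mul_comm]
  have hsq := L.toLinearMap.normDet_sq_eq_det_gram (EuclideanSpace.basisFun (Fin n) ℝ)
  rw [hgram, Matrix.det_one_add_replicateCol_mul_replicateRow] at hsq
  simp only [RCLike.ofReal_real_eq_id, id_eq] at hsq
  rw [← Real.sqrt_sq (LinearMap.normDet_nonneg L.toLinearMap), hsq]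
  simp [dotProduct, hu, sq]

theorem hasFDerivAt_graphMap {y : EuclideanSpace ℝ (Fin n)} (hγ : DifferentiableAt ℝ γ y) :
    HasFDerivAt (graphMap i γ) ((hyperplaneEmb i).toContinuousLinearMap +
      (fderiv ℝ γ y).smulRight (EuclideanSpace.single i (1 : ℝ))) y :=
  (hyperplaneEmb i).toContinuousLinearMap.hasFDerivAt.add (hγ.hasFDerivAt.smul_const _)

theorem dropCoord_graphMap (γ : EuclideanSpace ℝ (Fin n) → ℝ) (y : EuclideanSpace ℝ (Fin n)) :
    dropCoord i (graphMap i γ y) = y := by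
  simp [graphMap]

theorem graphMap_apply_self (γ : EuclideanSpace ℝ (Fin n) → ℝ) (y : EuclideanSpace ℝ (Fin n)) :
    graphMap i γ y i = γ y := by
  simp [graphMap]

theorem sub_graphMap_dropCoord (γ : EuclideanSpace ℝ (Fin n) → ℝ)
    (x : EuclideanSpace ℝ (Fin (n + 1))) :
    x - graphMap i γ (dropCoord i x) =
      (x i - γ (dropCoord i x)) • EuclideanSpace.single i (1 : ℝ) := by
  rw [graphMap, sub_smul, ← sub_sub, sub_left_inj, sub_eq_iff_eq_add',
    hyperplaneEmb_dropCoord_add_smul_single]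

theorem continuous_graphMap (hγ : Continuous γ) : Continuous (graphMap i γ) :=
  (hyperplaneEmb i).continuous.add (hγ.smul continuous_const)

theorem range_graphMap (γ : EuclideanSpace ℝ (Fin n) → ℝ) :
    range (graphMap i γ) = {x | x i = γ (dropCoord i x)} := by
  refine Subset.antisymm ?_ fun x (hx : x i = γ (dropCoord i x)) => ⟨dropCoord i x, ?_⟩
  · rintro _ ⟨y, rfl⟩
    simp [graphMap_apply_self, dropCoord_graphMap]
  · rw [graphMap, ← hx, hyperplaneEmb_dropCoord_add_smul_single]

/-- The area density of the parametrization `graphMap i γ` of the graph of `γ`. -/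
def graphDensity (γ : EuclideanSpace ℝ (Fin n) → ℝ) (y : EuclideanSpace ℝ (Fin n)) : ℝ :=
  √(1 + ∑ k, fderiv ℝ γ y (EuclideanSpace.single k 1) ^ 2)

theorem graphDensity_pos (γ : EuclideanSpace ℝ (Fin n) → ℝ) (y : EuclideanSpace ℝ (Fin n)) :
    0 < graphDensity γ y := by
  unfold graphDensity
  positivity

theorem continuous_graphDensity (hγ : ContDiff ℝ 1 γ) : Continuous (graphDensity γ) := by
  have (k : Fin n) : Continuous fun y => fderiv ℝ γ y (EuclideanSpace.single k 1) :=
    (hγ.continuous_fderiv one_ne_zero).clm_apply continuous_const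
  unfold graphDensity
  fun_prop

theorem map_graphMap (hγ : ContDiff ℝ 1 γ) :
    (volume.withDensity fun y => ENNReal.ofReal (graphDensity γ y)).map (graphMap i γ) =
      μHE[n].restrict {x | x i = γ (dropCoord i x)} := by
  have hderiv (y) : fderiv ℝ (graphMap i γ) y = (hyperplaneEmb i).toContinuousLinearMap +
      (fderiv ℝ γ y).smulRight (EuclideanSpace.single i (1 : ℝ)) :=
    (hasFDerivAt_graphMap i (hγ.differentiable one_ne_zero y)).fderiv
  have himm (y) : Function.Injective (fderiv ℝ (graphMap i γ) y) := by
    rw [hderiv]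
    exact Function.LeftInverse.injective (g := dropCoord i) fun v => by simp
  have hsmooth : ContDiff ℝ 1 (graphMap i γ) :=
    (hyperplaneEmb i).contDiff.add (hγ.smul contDiff_const)
  have harea := map_withDensity_jacobian hsmooth
    (Function.LeftInverse.injective (dropCoord_graphMap i γ)) himm
  have hjac : jacobian (graphMap i γ) = fun y => ENNReal.ofReal (graphDensity γ y) :=
    funext fun y => by
      rw [jacobian, hderiv, normDet_hyperplaneEmb_add_smulRight, graphDensity]
  rwa [range_graphMap, finrank_euclideanSpace_fin, hjac] at harea

theorem measurableEmbedding_graphMap (hγ : Continuous γ) : MeasurableEmbedding (graphMap i γ) :=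
  (continuous_graphMap i hγ).measurableEmbedding
    (Function.LeftInverse.injective (dropCoord_graphMap i γ))

theorem integrableOn_graph_iff (hγ : ContDiff ℝ 1 γ) {f : EuclideanSpace ℝ (Fin (n + 1)) → V} :
    IntegrableOn f {x | x i = γ (dropCoord i x)} μHE[n] ↔
      Integrable fun y => graphDensity γ y • f (graphMap i γ y) := by
  rw [IntegrableOn, ← map_graphMap i hγ,
    (measurableEmbedding_graphMap i hγ.continuous).integrable_map_iff,
    integrable_withDensity_iff_integrable_smul'
      (continuous_graphDensity hγ).measurable.ennreal_ofReal (by simp)]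
  simp only [ENNReal.toReal_ofReal (graphDensity_pos γ _).le, Function.comp_apply]

theorem setIntegral_graph (hγ : ContDiff ℝ 1 γ) (f : EuclideanSpace ℝ (Fin (n + 1)) → V) :
    ∫ x in {x | x i = γ (dropCoord i x)}, f x ∂μHE[n] =
      ∫ y, graphDensity γ y • f (graphMap i γ y) := by
  rw [← map_graphMap i hγ, (measurableEmbedding_graphMap i hγ.continuous).integral_map,
    integral_withDensity_eq_integral_toReal_smul
      (continuous_graphDensity hγ).measurable.ennreal_ofReal (by simp)]
  simp only [ENNReal.toReal_ofReal (graphDensity_pos γ _).le]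

theorem continuous_graphFlux (hγ : ContDiff ℝ 1 γ) (hF : ∀ j, Continuous (F j)) :
    Continuous (graphFlux i γ F) := by
  have hdγ (k : Fin n) : Continuous fun y => fderiv ℝ γ y (EuclideanSpace.single k 1) :=
    (hγ.continuous_fderiv one_ne_zero).clm_apply continuous_const
  have hFγ (j) : Continuous fun y => F j (graphMap i γ y) :=
    (hF j).comp (continuous_graphMap i hγ.continuous)
  exact (hFγ i).sub (continuous_finsetSum _ fun k _ => (hdγ k).smul (hFγ _))

theorem hasCompactSupport_graphFlux (hs : ∀ j, HasCompactSupport (F j)) :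
    HasCompactSupport (graphFlux i γ F) := by
  refine .intro ((isCompact_iUnion fun j => hs j).image (dropCoord i).continuous) fun y hy => ?_
  have h₀ (j) : F j (graphMap i γ y) = 0 := image_eq_zero_of_notMem_tsupport fun hj =>
    hy ⟨_, mem_iUnion.2 ⟨j, hj⟩, dropCoord_graphMap i γ y⟩
  simp [graphFlux, h₀]

end Subgraph

/-! ### Defining functions and local graph representations -/

/-- `ρ` is a defining function of class `C²` of `D` in the neighbourhood `U` of the point `x`. -/
structure IsDefiningFunctionAt {m : ℕ} (D : Set (EuclideanSpace ℝ (Fin m)))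
    (x : EuclideanSpace ℝ (Fin m)) (U : Set (EuclideanSpace ℝ (Fin m)))
    (ρ : EuclideanSpace ℝ (Fin m) → ℝ) : Prop where
  isOpen : IsOpen U
  mem : x ∈ U
  contDiffOn : ContDiffOn ℝ 2 ρ U
  gradient_ne_zero : ∇ ρ x ≠ 0
  inter_eq : D ∩ U = {y ∈ U | ρ y < 0}

namespace IsDefiningFunctionAt

variable {m : ℕ} {D U U' : Set (EuclideanSpace ℝ (Fin m))} {x : EuclideanSpace ℝ (Fin m)}
  {ρ ρ' : EuclideanSpace ℝ (Fin m) → ℝ}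

theorem mem_iff (h : IsDefiningFunctionAt D x U ρ) {y : EuclideanSpace ℝ (Fin m)} (hy : y ∈ U) :
    y ∈ D ↔ ρ y < 0 := by
  simpa [hy] using Set.ext_iff.1 h.inter_eq y

theorem contDiffAt (h : IsDefiningFunctionAt D x U ρ) {y : EuclideanSpace ℝ (Fin m)}
    (hy : y ∈ U) : ContDiffAt ℝ 2 ρ y :=
  h.contDiffOn.contDiffAt (h.isOpen.mem_nhds hy)

theorem apply_eq_zero (h : IsDefiningFunctionAt D x U ρ) (hD : IsOpen D) (hx : x ∈ frontier D) :
    ρ x = 0 := by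
  have hxD : x ∉ D := fun hxD => hx.2 (hD.interior_eq.symm ▸ hxD)
  refine le_antisymm (not_lt.1 fun hpos => ?_) (not_lt.1 fun hneg => hxD ((h.mem_iff h.mem).2 hneg))
  have hpos_near : ∀ᶠ y in 𝓝 x, 0 < ρ y :=
    (h.contDiffAt h.mem).continuousAt.eventually (lt_mem_nhds hpos)
  obtain ⟨y, ⟨hy, hyU⟩, hyD⟩ :=
    mem_closure_iff_nhds.1 hx.1 _ (hpos_near.and (h.isOpen.mem_nhds h.mem))
  exact lt_asymm hy ((h.mem_iff hyU).1 hyD)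

theorem hasDerivAt_line (h : IsDefiningFunctionAt D x U ρ) (w : EuclideanSpace ℝ (Fin m)) :
    HasDerivAt (fun t : ℝ => ρ (x + t • w)) (inner ℝ (∇ ρ x) w) 0 := by
  have hρ : HasFDerivAt ρ (fderiv ℝ ρ x) (x + (0 : ℝ) • w) := by
    simpa using ((h.contDiffAt h.mem).differentiableAt two_ne_zero).hasFDerivAt
  have hline : HasDerivAt (fun t : ℝ => x + t • w) w 0 := by
    simpa using ((hasDerivAt_id (0 : ℝ)).smul_const w).const_add x
  have hcomp := hρ.comp_hasDerivAt 0 hline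
  rwa [inner_gradient_left]

theorem eventually_line_mem (h : IsDefiningFunctionAt D x U ρ) (w : EuclideanSpace ℝ (Fin m)) :
    ∀ᶠ t : ℝ in 𝓝[>] 0, x + t • w ∈ U := by
  have hline : ContinuousAt (fun t : ℝ => x + t • w) 0 := by fun_prop
  exact nhdsWithin_le_nhds (hline.eventually (by simpa using h.isOpen.mem_nhds h.mem))

theorem eventually_line_notMem (h : IsDefiningFunctionAt D x U ρ) (hD : IsOpen D)
    (hx : x ∈ frontier D) {w : EuclideanSpace ℝ (Fin m)} (hw : 0 < inner ℝ (∇ ρ x) w) :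
    ∀ᶠ t : ℝ in 𝓝[>] 0, x + t • w ∉ D := by
  have hsign := eventually_nhdsWithin_sign_eq_of_deriv_pos ((h.hasDerivAt_line w).deriv ▸ hw)
    (by simpa using h.apply_eq_zero hD hx)
  filter_upwards [nhdsWithin_le_nhds hsign, h.eventually_line_mem w, self_mem_nhdsWithin]
    with t ht htU (htpos : 0 < t)
  rw [sub_zero, sign_pos htpos, sign_eq_one_iff] at ht
  exact fun hmem => ht.not_gt ((h.mem_iff htU).1 hmem)

theorem eventually_line_mem_domain (h : IsDefiningFunctionAt D x U ρ) (hD : IsOpen D)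
    (hx : x ∈ frontier D) {w : EuclideanSpace ℝ (Fin m)} (hw : inner ℝ (∇ ρ x) w < 0) :
    ∀ᶠ t : ℝ in 𝓝[>] 0, x + t • w ∈ D := by
  have hsign := eventually_nhdsWithin_sign_eq_of_deriv_neg ((h.hasDerivAt_line w).deriv ▸ hw)
    (by simpa using h.apply_eq_zero hD hx)
  filter_upwards [nhdsWithin_le_nhds hsign, h.eventually_line_mem w, self_mem_nhdsWithin]
    with t ht htU (htpos : 0 < t)
  rw [zero_sub, sign_neg (neg_neg_of_pos htpos), sign_eq_neg_one_iff] at ht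
  exact (h.mem_iff htU).2 ht

theorem normalize_gradient_eq (h : IsDefiningFunctionAt D x U ρ)
    (h' : IsDefiningFunctionAt D x U' ρ') (hD : IsOpen D) (hx : x ∈ frontier D) :
    ‖∇ ρ x‖⁻¹ • ∇ ρ x = ‖∇ ρ' x‖⁻¹ • ∇ ρ' x := by
  set ν := ‖∇ ρ x‖⁻¹ • ∇ ρ x with hν
  set ν' := ‖∇ ρ' x‖⁻¹ • ∇ ρ' x with hν'
  have hpos : 0 < ‖∇ ρ x‖ := norm_pos_iff.2 h.gradient_ne_zero
  have hpos' : 0 < ‖∇ ρ' x‖ := norm_pos_iff.2 h'.gradient_ne_zero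
  have hnorm : ‖ν‖ = 1 := by simp [hν, norm_smul, hpos.ne']
  have hnorm' : ‖ν'‖ = 1 := by simp [hν', norm_smul, hpos'.ne']
  have hgrad : ∇ ρ x = ‖∇ ρ x‖ • ν := by simp [hν, smul_smul, hpos.ne']
  have hgrad' : ∇ ρ' x = ‖∇ ρ' x‖ • ν' := by simp [hν', smul_smul, hpos'.ne']
  by_contra hne
  have hlt : inner ℝ ν ν' < 1 := (inner_lt_one_iff_real_of_norm_eq_one hnorm hnorm').2 hne
  -- If the normals differ, then `ν' - ν` points into `D` for `ρ` and out of `D` for `ρ'`.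
  have hinward : inner ℝ (∇ ρ x) (ν' - ν) < 0 := by
    rw [hgrad, real_inner_smul_left, inner_sub_right, real_inner_self_eq_norm_sq, hnorm]
    exact mul_neg_of_pos_of_neg hpos (by linarith)
  have houtward : 0 < inner ℝ (∇ ρ' x) (ν' - ν) := by
    rw [hgrad', real_inner_smul_left, inner_sub_right, real_inner_self_eq_norm_sq, hnorm',
      real_inner_comm]
    exact mul_pos hpos' (by linarith)
  obtain ⟨t, ht, ht'⟩ := ((h.eventually_line_mem_domain hD hx hinward).and
    (h'.eventually_line_notMem hD hx houtward)).exists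
  exact ht' ht

end IsDefiningFunctionAt

theorem exists_contDiff_eventuallyEq {E F : Type*} [NormedAddCommGroup E] [InnerProductSpace ℝ E]
    [FiniteDimensional ℝ E] [NormedAddCommGroup F] [NormedSpace ℝ F] {k : ℕ} {ψ : E → F} {x : E}
    (h : ContDiffAt ℝ k ψ x) : ∃ γ : E → F, ContDiff ℝ k γ ∧ γ =ᶠ[𝓝 x] ψ := by
  obtain ⟨r, hr, hball⟩ := Metric.eventually_nhds_iff_ball.1 (h.eventually (by simp))
  let f : ContDiffBump x := ⟨r / 4, r / 2, by positivity, by linarith⟩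
  have hsupp : tsupport f ⊆ Metric.ball x r :=
    f.tsupport_eq.trans_subset (Metric.closedBall_subset_ball (half_lt_self hr))
  refine ⟨fun y => f y • ψ y, contDiff_iff_contDiffAt.2 fun y => ?_, ?_⟩
  · by_cases hy : y ∈ tsupport f
    · exact f.contDiffAt.smul (hball y (hsupp hy))
    · refine contDiffAt_const (c := (0 : F)).congr_of_eventuallyEq ?_
      filter_upwards [notMem_tsupport_iff_eventuallyEq.1 hy] with z hz
      rw [hz, Pi.zero_apply, zero_smul]
  · filter_upwards [f.eventuallyEq_one] with y hy
    rw [hy, Pi.one_apply, one_smul]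

theorem fderiv_apply_single {m : ℕ} (ρ : EuclideanSpace ℝ (Fin m) → ℝ)
    (x : EuclideanSpace ℝ (Fin m)) (i : Fin m) :
    fderiv ℝ ρ x (EuclideanSpace.single i 1) = ∇ ρ x i := by
  rw [← inner_gradient_left, EuclideanSpace.inner_single_right]
  simp

theorem exists_contDiff_graphMap_eq {n k : ℕ} (hk : k ≠ 0) (i : Fin (n + 1))
    {x : EuclideanSpace ℝ (Fin (n + 1))} {ρ : EuclideanSpace ℝ (Fin (n + 1)) → ℝ}
    (hρ : ContDiffAt ℝ k ρ x) (hi : fderiv ℝ ρ x (EuclideanSpace.single i 1) ≠ 0) :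
    ∃ γ : EuclideanSpace ℝ (Fin n) → ℝ, ContDiff ℝ k γ ∧ γ (dropCoord i x) = x i ∧
      ∀ᶠ y in 𝓝 (dropCoord i x), ρ (graphMap i γ y) = ρ x := by
  set T : EuclideanSpace ℝ (Fin n) × ℝ →L[ℝ] EuclideanSpace ℝ (Fin (n + 1)) :=
    (hyperplaneEmb i).toContinuousLinearMap.coprod
      ((ContinuousLinearMap.id ℝ ℝ).smulRight (EuclideanSpace.single i 1)) with hT
  set u : EuclideanSpace ℝ (Fin n) × ℝ := (dropCoord i x, x i)
  have hTu : T u = x := by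
    simpa [hT] using hyperplaneEmb_dropCoord_add_smul_single i x
  have hk' : (k : WithTop ℕ∞) ≠ 0 := mod_cast hk
  have hρT : ContDiffAt ℝ k (ρ ∘ T) u := .comp u (hTu ▸ hρ) T.contDiff.contDiffAt
  have hfderiv : fderiv ℝ (ρ ∘ T) u = (fderiv ℝ ρ x).comp T := by
    rw [fderiv_comp u (hTu ▸ hρ.differentiableAt hk') T.differentiableAt, hTu, T.fderiv]
  have hinv : (fderiv ℝ (ρ ∘ T) u ∘L .inr ℝ (EuclideanSpace ℝ (Fin n)) ℝ).IsInvertible := by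
    refine ⟨ContinuousLinearEquiv.unitsEquivAut ℝ (Units.mk0 _ hi), ?_⟩
    ext
    rw [hfderiv]
    simp [hT]
  obtain ⟨γ, hγ, hγψ⟩ := exists_contDiff_eventuallyEq
    (hρT.contDiffAt_implicitFunction hk' hinv)
  refine ⟨γ, hγ, ?_, ?_⟩
  · exact hγψ.self_of_nhds.trans (hρT.implicitFunction_apply_self hk' hinv)
  · filter_upwards [hγψ, hρT.eventually_apply_implicitFunction hk' hinv] with y hγy hy
    rw [Function.comp_apply, Function.comp_apply, hTu, ← hγy] at hy
    rw [← hy]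
    simp [hT, graphMap]

theorem apply_neg_iff_of_fderiv_sign {E : Type*} [NormedAddCommGroup E] [NormedSpace ℝ E]
    {f : E → ℝ} {s : Set E} (hs : Convex ℝ s) (hf : ∀ z ∈ s, DifferentiableAt ℝ f z) {σ τ : ℝ}
    {e a b : E} (hσ : ∀ z ∈ s, 0 < σ * fderiv ℝ f z e) (ha : a ∈ s) (hb : b ∈ s)
    (hfa : f a = 0) (hab : b - a = τ • e) : f b < 0 ↔ σ * τ < 0 := by
  obtain ⟨z, hz, hzeq⟩ := domain_mvt (fun z hz => (hf z hz).hasFDerivAt.hasFDerivWithinAt) hs ha hb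
  rw [hab, hfa, sub_zero, map_smul, smul_eq_mul] at hzeq
  rw [hzeq]
  rcases mul_pos_iff.1 (hσ z (hs.segment_subset ha hb hz)) with ⟨hσ, hc⟩ | ⟨hσ, hc⟩ <;>
    simp [mul_neg_iff, hσ, hc, hσ.not_gt, hc.not_gt]

/-- The signed height of a point above the graph of `γ` in the `i`-th coordinate direction. -/
def signedHeight {n : ℕ} (i : Fin (n + 1)) (σ : ℝ) (γ : EuclideanSpace ℝ (Fin n) → ℝ)
    (y : EuclideanSpace ℝ (Fin (n + 1))) : ℝ :=
  σ * (y i - γ (dropCoord i y))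

/-- In the open set `W`, the set `D` is the strict subgraph (`σ = 1`) or the strict supergraph
(`σ = -1`) of `γ` with respect to the `i`-th coordinate. -/
structure IsLocalSubgraph {n : ℕ} (D W : Set (EuclideanSpace ℝ (Fin (n + 1)))) (i : Fin (n + 1))
    (σ : ℝ) (γ : EuclideanSpace ℝ (Fin n) → ℝ) : Prop where
  isOpen : IsOpen W
  contDiff : ContDiff ℝ 2 γ
  sign : σ = 1 ∨ σ = -1
  mem_iff : ∀ y ∈ W, y ∈ D ↔ signedHeight i σ γ y < 0

theorem IsDefiningFunctionAt.exists_isLocalSubgraph {n : ℕ}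
    {D U : Set (EuclideanSpace ℝ (Fin (n + 1)))} {x : EuclideanSpace ℝ (Fin (n + 1))}
    {ρ : EuclideanSpace ℝ (Fin (n + 1)) → ℝ} (h : IsDefiningFunctionAt D x U ρ) (hD : IsOpen D)
    (hx : x ∈ frontier D) : ∃ W i σ γ, x ∈ W ∧ IsLocalSubgraph D W i σ γ := by
  obtain ⟨i, hi⟩ : ∃ i, fderiv ℝ ρ x (EuclideanSpace.single i 1) ≠ 0 := by
    by_contra! h₀
    exact h.gradient_ne_zero (by ext i; simpa [fderiv_apply_single] using h₀ i)
  obtain ⟨σ, hσ, hσpos⟩ : ∃ σ : ℝ, (σ = 1 ∨ σ = -1) ∧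
      0 < σ * fderiv ℝ ρ x (EuclideanSpace.single i 1) := by
    rcases lt_or_gt_of_ne hi with hneg | hpos
    · exact ⟨-1, .inr rfl, by linarith⟩
    · exact ⟨1, .inl rfl, by linarith⟩
  have hσcont : ContinuousAt (fun y => σ * fderiv ℝ ρ y (EuclideanSpace.single i 1)) x :=
    continuousAt_const.mul <| ((h.contDiffAt h.mem).fderiv_right (m := 1)
      (by norm_num)).continuousAt.clm_apply continuousAt_const
  obtain ⟨r, hr, hball⟩ := Metric.eventually_nhds_iff_ball.1
    ((hσcont.eventually (lt_mem_nhds hσpos)).and (h.isOpen.mem_nhds h.mem))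
  obtain ⟨γ, hγ, hγx, hzero⟩ :=
    exists_contDiff_graphMap_eq (k := 2) two_ne_zero i (mod_cast h.contDiffAt h.mem) hi
  have hx₀ : graphMap i γ (dropCoord i x) = x := by
    rw [graphMap, hγx, hyperplaneEmb_dropCoord_add_smul_single]
  have hcont : ContinuousAt (fun y => graphMap i γ (dropCoord i y)) x :=
    ((continuous_graphMap i hγ.continuous).comp (dropCoord i).continuous).continuousAt
  obtain ⟨W, hW, hWo, hxW⟩ := eventually_nhds_iff.1 <|
    (Metric.isOpen_ball.eventually_mem (Metric.mem_ball_self hr)).and <|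
    (hcont.eventually_mem (s := Metric.ball x r)
      (by rw [hx₀]; exact Metric.ball_mem_nhds x hr)).and <|
    (dropCoord i).continuous.continuousAt.eventually hzero
  refine ⟨W, i, σ, γ, hxW, hWo, mod_cast hγ, hσ, fun y hy => ?_⟩
  obtain ⟨hyB, hgraph, hG₀⟩ := hW y hy
  rw [h.mem_iff (hball y hyB).2]
  exact apply_neg_iff_of_fderiv_sign (convex_ball x r)
    (fun z hz => (h.contDiffAt (hball z hz).2).differentiableAt two_ne_zero)
    (fun z hz => (hball z hz).1) hgraph hyB
    (hG₀.trans (h.apply_eq_zero hD hx)) (sub_graphMap_dropCoord i γ y)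

/-! ### The divergence theorem for domains with `C²` boundary -/

section SignedHeight

variable {n : ℕ} (i : Fin (n + 1)) (σ : ℝ) {γ : EuclideanSpace ℝ (Fin n) → ℝ}
  {y : EuclideanSpace ℝ (Fin (n + 1))}

theorem hasFDerivAt_signedHeight (hγ : DifferentiableAt ℝ γ (dropCoord i y)) :
    HasFDerivAt (signedHeight i σ γ)
      (σ • (EuclideanSpace.proj i - (fderiv ℝ γ (dropCoord i y)).comp (dropCoord i))) y :=
  ((EuclideanSpace.proj (𝕜 := ℝ) (i := i)).hasFDerivAt.sub
    (hγ.hasFDerivAt.comp y (dropCoord i).hasFDerivAt)).const_mul σ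

theorem gradient_signedHeight_apply_self (hγ : DifferentiableAt ℝ γ (dropCoord i y)) :
    ∇ (signedHeight i σ γ) y i = σ := by
  rw [← fderiv_apply_single, (hasFDerivAt_signedHeight i σ hγ).fderiv]
  simp

theorem gradient_signedHeight_apply_succAbove (hγ : DifferentiableAt ℝ γ (dropCoord i y))
    (k : Fin n) :
    ∇ (signedHeight i σ γ) y (i.succAbove k) =
      -σ * fderiv ℝ γ (dropCoord i y) (EuclideanSpace.single k 1) := by
  rw [← fderiv_apply_single, (hasFDerivAt_signedHeight i σ hγ).fderiv]
  simp

theorem norm_gradient_signedHeight (hγ : DifferentiableAt ℝ γ (dropCoord i y)) :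
    ‖∇ (signedHeight i σ γ) y‖ = |σ| * graphDensity γ (dropCoord i y) := by
  rw [EuclideanSpace.norm_eq, Fin.sum_univ_succAbove _ i, graphDensity, ← Real.sqrt_sq_eq_abs,
    ← Real.sqrt_mul (sq_nonneg σ)]
  simp only [gradient_signedHeight_apply_self i σ hγ, gradient_signedHeight_apply_succAbove i σ hγ,
    Real.norm_eq_abs, sq_abs, mul_pow, neg_sq, mul_add, mul_one, Finset.mul_sum]

theorem contDiff_signedHeight {k : WithTop ℕ∞} (hγ : ContDiff ℝ k γ) :
    ContDiff ℝ k (signedHeight i σ γ) := by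
  unfold signedHeight
  fun_prop

end SignedHeight

/-- `N` is the outward unit normal of `D` at all boundary points that have a defining function. -/
def IsOutwardNormalField {m : ℕ} (D : Set (EuclideanSpace ℝ (Fin m)))
    (N : EuclideanSpace ℝ (Fin m) → EuclideanSpace ℝ (Fin m)) : Prop :=
  ∀ x ∈ frontier D, ∀ U ρ, IsDefiningFunctionAt D x U ρ → N x = ‖∇ ρ x‖⁻¹ • ∇ ρ x

/-- The outward flux of the field `F` through the boundary of `D`, with respect to the normal
field `N`, is the integral of the divergence of `F` over `D`. -/
structure FluxEqIntegralDivergence {n : ℕ} {V : Type*} [NormedAddCommGroup V] [NormedSpace ℝ V]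
    (D : Set (EuclideanSpace ℝ (Fin (n + 1))))
    (N : EuclideanSpace ℝ (Fin (n + 1)) → EuclideanSpace ℝ (Fin (n + 1)))
    (F : Fin (n + 1) → EuclideanSpace ℝ (Fin (n + 1)) → V) : Prop where
  integrableOn : IntegrableOn (fun y => ∑ j, N y j • F j y) (frontier D) μHE[n]
  integral_eq : ∫ y in frontier D, ∑ j, N y j • F j y ∂μHE[n] = ∫ x in D, divergence F x

theorem setIntegral_congr_of_inter_eq {α V : Type*} [MeasurableSpace α] [NormedAddCommGroup V]
    [NormedSpace ℝ V] {μ : Measure α} {s t W : Set α} {f : α → V} (hs : MeasurableSet s)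
    (ht : MeasurableSet t) (hst : s ∩ W = t ∩ W) (hf : ∀ x ∉ W, f x = 0) :
    ∫ x in s, f x ∂μ = ∫ x in t, f x ∂μ := by
  have hinter {r : Set α} (hr : MeasurableSet r) : ∫ x in r, f x ∂μ = ∫ x in r ∩ W, f x ∂μ :=
    setIntegral_eq_of_subset_of_forall_sdiff_eq_zero hr inter_subset_left
      fun x hx => hf x fun hxW => hx.2 ⟨hx.1, hxW⟩
  rw [hinter hs, hinter ht, hst]

theorem integrableOn_congr_of_inter_eq {α V : Type*} [MeasurableSpace α] [NormedAddCommGroup V]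
    {μ : Measure α} {s t W : Set α} {f : α → V} (h : IntegrableOn f s μ) (ht : MeasurableSet t)
    (hst : s ∩ W = t ∩ W) (hf : ∀ x ∉ W, f x = 0) : IntegrableOn f t μ :=
  (hst ▸ h.mono_set inter_subset_left : IntegrableOn f (t ∩ W) μ).of_forall_sdiff_eq_zero ht
    fun x hx => hf x fun hxW => hx.2 ⟨hx.1, hxW⟩

section LocalFlux

variable {n : ℕ} {V : Type*} [NormedAddCommGroup V] [NormedSpace ℝ V]

/-- The flux density, with respect to the area measure, through the graph of `γ` in the direction
of the unit normal with orientation `σ`, extended to the whole space. -/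
def extendedFlux (i : Fin (n + 1)) (σ : ℝ) (γ : EuclideanSpace ℝ (Fin n) → ℝ)
    (F : Fin (n + 1) → EuclideanSpace ℝ (Fin (n + 1)) → V)
    (x : EuclideanSpace ℝ (Fin (n + 1))) : V :=
  (σ / graphDensity γ (dropCoord i x)) •
    (F i x - ∑ k, fderiv ℝ γ (dropCoord i x) (EuclideanSpace.single k 1) • F (i.succAbove k) x)

theorem graphDensity_smul_extendedFlux (i : Fin (n + 1)) (σ : ℝ)
    (γ : EuclideanSpace ℝ (Fin n) → ℝ) (F : Fin (n + 1) → EuclideanSpace ℝ (Fin (n + 1)) → V)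
    (y : EuclideanSpace ℝ (Fin n)) :
    graphDensity γ y • extendedFlux i σ γ F (graphMap i γ y) = σ • graphFlux i γ F y := by
  rw [extendedFlux, dropCoord_graphMap, smul_smul, mul_div_cancel₀ _ (graphDensity_pos γ y).ne',
    graphFlux]

namespace IsLocalSubgraph

variable {D W : Set (EuclideanSpace ℝ (Fin (n + 1)))} {i : Fin (n + 1)} {σ : ℝ}
  {γ : EuclideanSpace ℝ (Fin n) → ℝ}
  {N : EuclideanSpace ℝ (Fin (n + 1)) → EuclideanSpace ℝ (Fin (n + 1))}
  {F : Fin (n + 1) → EuclideanSpace ℝ (Fin (n + 1)) → V} {y : EuclideanSpace ℝ (Fin (n + 1))}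

theorem mono (h : IsLocalSubgraph D W i σ γ) {W' : Set (EuclideanSpace ℝ (Fin (n + 1)))}
    (hW' : IsOpen W') (hsub : W' ⊆ W) : IsLocalSubgraph D W' i σ γ :=
  ⟨hW', h.contDiff, h.sign, fun y hy => h.mem_iff y (hsub hy)⟩

theorem abs_sign (h : IsLocalSubgraph D W i σ γ) : |σ| = 1 := by
  rcases h.sign with rfl | rfl <;> norm_num

theorem differentiable (h : IsLocalSubgraph D W i σ γ) : Differentiable ℝ γ :=
  h.contDiff.differentiable two_ne_zero

theorem norm_gradient (h : IsLocalSubgraph D W i σ γ) (y : EuclideanSpace ℝ (Fin (n + 1))) :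
    ‖∇ (signedHeight i σ γ) y‖ = graphDensity γ (dropCoord i y) := by
  rw [norm_gradient_signedHeight i σ (h.differentiable _), h.abs_sign, one_mul]

theorem isDefiningFunctionAt (h : IsLocalSubgraph D W i σ γ) (hy : y ∈ W) :
    IsDefiningFunctionAt D y W (signedHeight i σ γ) where
  isOpen := h.isOpen
  mem := hy
  contDiffOn := (contDiff_signedHeight i σ h.contDiff).contDiffOn
  gradient_ne_zero := by
    rw [← norm_pos_iff, h.norm_gradient]
    exact graphDensity_pos _ _
  inter_eq := by
    ext z
    exact ⟨fun hz => ⟨hz.2, (h.mem_iff z hz.2).1 hz.1⟩, fun hz => ⟨(h.mem_iff z hz.1).2 hz.2, hz.1⟩⟩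

theorem mem_frontier_of_apply_eq (h : IsLocalSubgraph D W i σ γ) (hD : IsOpen D) (hy : y ∈ W)
    (hyγ : y i = γ (dropCoord i y)) : y ∈ frontier D := by
  have hheight (t : ℝ) : signedHeight i σ γ (y - (t * σ) • EuclideanSpace.single i (1 : ℝ)) =
      -t := by
    rcases h.sign with rfl | rfl <;> simp [signedHeight, hyγ]
  have hyD : y ∉ D := by
    rw [h.mem_iff y hy]
    simpa using (hheight 0).ge
  refine ⟨?_, by rwa [hD.interior_eq]⟩
  have hline : Tendsto (fun t : ℝ => y - (t * σ) • EuclideanSpace.single i (1 : ℝ)) (𝓝[>] 0)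
      (𝓝 y) := by
    have hcont : Continuous fun t : ℝ => y - (t * σ) • EuclideanSpace.single i (1 : ℝ) := by
      fun_prop
    exact (hcont.tendsto' 0 y (by simp)).mono_left nhdsWithin_le_nhds
  refine mem_closure_of_tendsto hline ?_
  filter_upwards [hline.eventually (h.isOpen.mem_nhds hy), self_mem_nhdsWithin]
    with t htW (ht : 0 < t)
  rw [h.mem_iff _ htW, hheight]
  exact neg_neg_of_pos ht

theorem mem_frontier_iff (h : IsLocalSubgraph D W i σ γ) (hD : IsOpen D) (hy : y ∈ W) :
    y ∈ frontier D ↔ y i = γ (dropCoord i y) := by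
  refine ⟨fun hyD => sub_eq_zero.1 ?_, h.mem_frontier_of_apply_eq hD hy⟩
  refine (mul_eq_zero.1 ((h.isDefiningFunctionAt hy).apply_eq_zero hD hyD)).resolve_left ?_
  exact abs_pos.1 (h.abs_sign ▸ one_pos)

theorem frontier_inter_eq (h : IsLocalSubgraph D W i σ γ) (hD : IsOpen D) :
    frontier D ∩ W = {y | y i = γ (dropCoord i y)} ∩ W := by
  ext y
  simp +contextual only [mem_inter_iff, and_congr_left_iff, h.mem_frontier_iff hD, mem_ofPred_eq,
    implies_true]

theorem sum_normal_smul_eq (h : IsLocalSubgraph D W i σ γ) (hN : IsOutwardNormalField D N)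
    (hy : y ∈ W) (hyD : y ∈ frontier D) : ∑ j, N y j • F j y = extendedFlux i σ γ F y := by
  rw [hN y hyD _ _ (h.isDefiningFunctionAt hy), Fin.sum_univ_succAbove _ i]
  simp only [PiLp.smul_apply, gradient_signedHeight_apply_self i σ (h.differentiable _),
    gradient_signedHeight_apply_succAbove i σ (h.differentiable _), h.norm_gradient, extendedFlux,
    smul_eq_mul]
  rw [smul_sub, Finset.smul_sum, sub_eq_add_neg, ← Finset.sum_neg_distrib]
  congr 1
  · congr 1
    ring
  · refine Finset.sum_congr rfl fun k _ => ?_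
    rw [smul_smul, ← neg_smul]
    congr 1
    ring

theorem flux_eq (h : IsLocalSubgraph D W i σ γ) (hD : IsOpen D) (hN : IsOutwardNormalField D N)
    (hF : ∀ j, Continuous (F j)) (hs : ∀ j, HasCompactSupport (F j))
    (hzero : ∀ y ∉ W, ∀ j, F j y = 0) :
    IntegrableOn (fun y => ∑ j, N y j • F j y) (frontier D) μHE[n] ∧
      ∫ y in frontier D, ∑ j, N y j • F j y ∂μHE[n] = σ • ∫ y, graphFlux i γ F y := by
  have hγ : ContDiff ℝ 1 γ := h.contDiff.of_le one_le_two
  have hγcont := hγ.continuous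
  have hzero' (y) (hy : y ∉ W) : extendedFlux i σ γ F y = 0 := by
    simp [extendedFlux, hzero y hy]
  have heq : EqOn (fun y => ∑ j, N y j • F j y) (extendedFlux i σ γ F) (frontier D) := by
    intro y hyD
    by_cases hy : y ∈ W
    · exact h.sum_normal_smul_eq hN hy hyD
    · simp [hzero y hy, hzero' y hy]
  have hgraph : MeasurableSet {y : EuclideanSpace ℝ (Fin (n + 1)) | y i = γ (dropCoord i y)} :=
    (isClosed_eq (by fun_prop) (by fun_prop)).measurableSet
  have hfrontier : MeasurableSet (frontier D) := isClosed_frontier.measurableSet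
  have hint : IntegrableOn (extendedFlux i σ γ F) {y | y i = γ (dropCoord i y)} μHE[n] := by
    simp only [integrableOn_graph_iff i hγ, graphDensity_smul_extendedFlux]
    exact ((continuous_graphFlux i hγ hF).integrable_of_hasCompactSupport
      (hasCompactSupport_graphFlux i hs)).smul σ
  refine ⟨.congr_fun (integrableOn_congr_of_inter_eq hint hfrontier
    (h.frontier_inter_eq hD).symm hzero') heq.symm hfrontier, ?_⟩
  rw [setIntegral_congr_fun hfrontier heq,
    setIntegral_congr_of_inter_eq hfrontier hgraph (h.frontier_inter_eq hD) hzero',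
    setIntegral_graph i hγ]
  simp only [graphDensity_smul_extendedFlux, integral_smul]

theorem setIntegral_divergence_eq (h : IsLocalSubgraph D W i σ γ) (hD : MeasurableSet D)
    (hF : ∀ j, Differentiable ℝ (F j)) (hs : ∀ j, HasCompactSupport (F j))
    (hW : ∀ j, tsupport (F j) ⊆ W) (hdiv : Continuous (divergence F)) :
    ∫ x in D, divergence F x = σ • ∫ y, graphFlux i γ F y := by
  have hinter : D ∩ W = {y | signedHeight i σ γ y < 0} ∩ W := by
    ext y
    simp +contextual only [mem_inter_iff, and_congr_left_iff, h.mem_iff, mem_ofPred_eq,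
      implies_true]
  have hmeas : MeasurableSet {y | signedHeight i σ γ y < 0} :=
    (isOpen_lt (contDiff_signedHeight i σ h.contDiff).continuous continuous_const).measurableSet
  rw [setIntegral_congr_of_inter_eq hD hmeas hinter fun y hy =>
    divergence_of_notMem_tsupport fun j hj => hy (hW j hj)]
  rcases h.sign with rfl | rfl
  · simpa [signedHeight] using integral_divergence_subgraph_lt i h.contDiff hF hs hdiv
  · simpa [signedHeight] using integral_divergence_supergraph i h.contDiff hF hs hdiv

theorem fluxEqIntegralDivergence (h : IsLocalSubgraph D W i σ γ) (hD : IsOpen D)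
    (hN : IsOutwardNormalField D N) (hF : ∀ j, Differentiable ℝ (F j))
    (hs : ∀ j, HasCompactSupport (F j)) (hW : ∀ j, tsupport (F j) ⊆ W)
    (hdiv : Continuous (divergence F)) : FluxEqIntegralDivergence D N F := by
  obtain ⟨hint, hflux⟩ := h.flux_eq hD hN (fun j => (hF j).continuous) hs fun y hy j =>
    image_eq_zero_of_notMem_tsupport fun hj => hy (hW j hj)
  exact ⟨hint, hflux.trans (h.setIntegral_divergence_eq hD.measurableSet hF hs hW hdiv).symm⟩

end IsLocalSubgraph

theorem FluxEqIntegralDivergence.of_tsupport_subset {D : Set (EuclideanSpace ℝ (Fin (n + 1)))}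
    (hD : IsOpen D) (N : EuclideanSpace ℝ (Fin (n + 1)) → EuclideanSpace ℝ (Fin (n + 1)))
    {F : Fin (n + 1) → EuclideanSpace ℝ (Fin (n + 1)) → V} (hF : ∀ j, Differentiable ℝ (F j))
    (hs : ∀ j, HasCompactSupport (F j)) (hsD : ∀ j, tsupport (F j) ⊆ D)
    (hdiv : Continuous (divergence F)) : FluxEqIntegralDivergence D N F := by
  have hzero : EqOn (fun y => ∑ j, N y j • F j y) 0 (frontier D) := fun y hy => by
    have hyD : y ∉ D := fun hyD => hy.2 (hD.interior_eq.symm ▸ hyD)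
    exact Finset.sum_eq_zero fun j _ => by
      rw [image_eq_zero_of_notMem_tsupport fun hj => hyD (hsD j hj), smul_zero]
  have hfrontier : MeasurableSet (frontier D) := isClosed_frontier.measurableSet
  refine ⟨integrableOn_zero.congr_fun hzero.symm hfrontier, ?_⟩
  rw [setIntegral_congr_fun hfrontier hzero, setIntegral_eq_integral_of_forall_compl_eq_zero
    fun y hy => divergence_of_notMem_tsupport fun j hj => hy (hsD j hj),
    integral_divergence_eq_zero hF hs hdiv]
  exact integral_zero _ _

end LocalFlux

section PartitionOfUnity

variable {E V : Type*} [NormedAddCommGroup E] [NormedSpace ℝ E] [NormedAddCommGroup V]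
  [NormedSpace ℝ V] {φ : E → ℝ}

theorem exists_finite_contDiff_partition [FiniteDimensional ℝ E] {K : Set E} (hK : IsCompact K)
    {W : E → Set E} (hW : ∀ x ∈ K, IsOpen (W x)) (hmem : ∀ x ∈ K, x ∈ W x) :
    ∃ (t : Finset E) (f : t → E → ℝ), (∀ x ∈ t, x ∈ K) ∧ (∀ k, ContDiff ℝ 1 (f k)) ∧
      (∀ k, tsupport (f k) ⊆ W k) ∧ ∀ x ∈ K, ∑ k, f k x = 1 := by
  obtain ⟨t, ht, hcover⟩ := hK.elim_nhds_subcover W fun x hx => (hW x hx).mem_nhds (hmem x hx)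
  obtain ⟨f, hf⟩ := SmoothPartitionOfUnity.exists_isSubordinate (modelWithCornersSelf ℝ E)
    hK.isClosed (fun k : t => W k) (fun k => hW k (ht k k.2)) fun x hx => by
      obtain ⟨k, hk, hxk⟩ := mem_iUnion₂.1 (hcover hx)
      exact mem_iUnion.2 ⟨⟨k, hk⟩, hxk⟩
  refine ⟨t, fun k => f k, ht, fun k => (f k).contMDiff.contDiff.of_le (by norm_cast), hf,
    fun x hx => ?_⟩
  rw [← finsum_eq_sum_of_fintype]
  exact f.sum_eq_one hx

theorem differentiable_smul_of_tsupport_subset {Ω : Set E} (hφ : Differentiable ℝ φ)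
    (hs : tsupport φ ⊆ Ω) {f : E → V} (hf : ∀ x ∈ Ω, DifferentiableAt ℝ f x) :
    Differentiable ℝ fun x => φ x • f x := by
  intro x
  by_cases hx : x ∈ tsupport φ
  · exact (hφ x).smul (hf x (hs hx))
  · refine (differentiableAt_const (0 : V)).congr_of_eventuallyEq ?_
    filter_upwards [notMem_tsupport_iff_eventuallyEq.1 hx] with y hy
    rw [hy, Pi.zero_apply, zero_smul]

end PartitionOfUnity

section DivergenceTheorem

variable {m : ℕ} {V : Type*} [NormedAddCommGroup V] [NormedSpace ℝ V]

theorem divergence_smul {φ : EuclideanSpace ℝ (Fin m) → ℝ}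
    {F : Fin m → EuclideanSpace ℝ (Fin m) → V} {x : EuclideanSpace ℝ (Fin m)}
    (hφ : DifferentiableAt ℝ φ x) (hF : ∀ j, DifferentiableAt ℝ (F j) x) :
    divergence (fun j x => φ x • F j x) x =
      φ x • divergence F x + ∑ j, fderiv ℝ φ x (EuclideanSpace.single j 1) • F j x := by
  simp only [divergence, Finset.smul_sum, ← Finset.sum_add_distrib]
  refine Finset.sum_congr rfl fun j _ => ?_
  rw [fderiv_fun_smul hφ (hF j)]
  simp

theorem continuous_divergence_smul {Ω : Set (EuclideanSpace ℝ (Fin m))}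
    {φ : EuclideanSpace ℝ (Fin m) → ℝ} {F : Fin m → EuclideanSpace ℝ (Fin m) → V}
    (hΩ : IsOpen Ω) (hφ : ContDiff ℝ 1 φ) (hs : tsupport φ ⊆ Ω)
    (hF : ∀ j, ∀ x ∈ Ω, DifferentiableAt ℝ (F j) x) (hdiv : ContinuousOn (divergence F) Ω) :
    Continuous (divergence fun j x => φ x • F j x) := by
  refine continuous_iff_continuousAt.2 fun x => ?_
  by_cases hx : x ∈ tsupport φ
  · have hxΩ := hΩ.mem_nhds (hs hx)
    refine ContinuousAt.congr ?_ (Filter.Eventually.mono hxΩ fun y hy =>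
      (divergence_smul (hφ.differentiable one_ne_zero y) (hF · y hy)).symm)
    refine (hφ.continuous.continuousAt.smul (hdiv.continuousAt hxΩ)).add ?_
    exact tendsto_finsetSum _ fun j _ => .smul
      ((hφ.continuous_fderiv one_ne_zero).clm_apply continuous_const).continuousAt
      (hF j x (hs hx)).continuousAt
  · refine (continuousAt_const (y := (0 : V))).congr ?_
    filter_upwards [(isClosed_tsupport φ).isOpen_compl.mem_nhds hx] with y hy
    exact (divergence_of_notMem_tsupport fun j hj => hy
      (closure_mono (Function.support_smul_subset_left _ _) hj)).symm

theorem divergence_finset_sum {ι : Type*} [Fintype ι]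
    {G : ι → Fin m → EuclideanSpace ℝ (Fin m) → V} {x : EuclideanSpace ℝ (Fin m)}
    (hG : ∀ k j, DifferentiableAt ℝ (G k j) x) :
    divergence (fun j x => ∑ k, G k j x) x = ∑ k, divergence (G k) x := by
  simp only [divergence]
  rw [Finset.sum_comm]
  exact Finset.sum_congr rfl fun j _ => by
    rw [fderiv_fun_sum fun k _ => hG k j, _root_.sum_apply]

variable {n : ℕ} {D Ω : Set (EuclideanSpace ℝ (Fin (n + 1)))}
  {N : EuclideanSpace ℝ (Fin (n + 1)) → EuclideanSpace ℝ (Fin (n + 1))}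

theorem FluxEqIntegralDivergence.of_sum_eq {ι : Type*} [Fintype ι] (hD : IsOpen D)
    {F : Fin (n + 1) → EuclideanSpace ℝ (Fin (n + 1)) → V}
    {G : ι → Fin (n + 1) → EuclideanSpace ℝ (Fin (n + 1)) → V}
    (hG : ∀ k j, Differentiable ℝ (G k j)) (hint : ∀ k, IntegrableOn (divergence (G k)) D)
    (h : ∀ k, FluxEqIntegralDivergence D N (G k))
    (hsum : ∀ x ∈ closure D, ∀ j, ∑ k, G k j x = F j x) : FluxEqIntegralDivergence D N F := by
  have hfrontier : MeasurableSet (frontier D) := isClosed_frontier.measurableSet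
  have hflux : EqOn (fun y => ∑ k, ∑ j, N y j • G k j y) (fun y => ∑ j, N y j • F j y)
      (frontier D) := fun y hy => by
    dsimp only
    rw [Finset.sum_comm]
    exact Finset.sum_congr rfl fun j _ => by rw [← Finset.smul_sum, hsum y hy.1 j]
  have hdiv : EqOn (fun x => ∑ k, divergence (G k) x) (divergence F) D := fun x hx => by
    dsimp only
    rw [← divergence_finset_sum fun k j => hG k j x]
    refine Finset.sum_congr rfl fun j _ => ?_
    have hev : (fun x => ∑ k, G k j x) =ᶠ[𝓝 x] F j :=
      Filter.Eventually.mono (hD.mem_nhds hx) fun y hy => hsum y (subset_closure hy) j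
    rw [hev.fderiv_eq]
  refine ⟨.congr_fun (integrable_finsetSum _ fun k _ => (h k).integrableOn) hflux hfrontier, ?_⟩
  rw [← setIntegral_congr_fun hfrontier hflux, ← setIntegral_congr_fun hD.measurableSet hdiv,
    integral_finsetSum _ fun k _ => (h k).integrableOn, integral_finsetSum _ fun k _ => hint k]
  exact Finset.sum_congr rfl fun k _ => (h k).integral_eq

theorem exists_patch_of_mem_closure (hD : IsOpen D)
    (hdef : ∀ x ∈ frontier D, ∃ U ρ, IsDefiningFunctionAt D x U ρ) (hΩ : IsOpen Ω)
    (hDΩ : closure D ⊆ Ω) {x : EuclideanSpace ℝ (Fin (n + 1))} (hx : x ∈ closure D) :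
    ∃ W, IsOpen W ∧ x ∈ W ∧ W ⊆ Ω ∧ (W = D ∨ ∃ i σ γ, IsLocalSubgraph D W i σ γ) := by
  by_cases hxD : x ∈ D
  · exact ⟨D, hD, hxD, subset_closure.trans hDΩ, .inl rfl⟩
  · have hxF : x ∈ frontier D := ⟨hx, by rwa [hD.interior_eq]⟩
    obtain ⟨U, ρ, hρ⟩ := hdef x hxF
    obtain ⟨W, i, σ, γ, hxW, hW⟩ := hρ.exists_isLocalSubgraph hD hxF
    have hWΩ := hW.isOpen.inter hΩ
    exact ⟨W ∩ Ω, hWΩ, ⟨hxW, hDΩ hx⟩, inter_subset_right,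
      .inr ⟨i, σ, γ, hW.mono hWΩ inter_subset_left⟩⟩

/-- The **divergence theorem**. The field is only assumed differentiable, with continuous
divergence; this is what a function annihilated by a Dirac operator satisfies. -/
theorem divergence_theorem (hD : IsOpen D) (hDb : Bornology.IsBounded D)
    (hdef : ∀ x ∈ frontier D, ∃ U ρ, IsDefiningFunctionAt D x U ρ) (hN : IsOutwardNormalField D N)
    (hΩ : IsOpen Ω) (hDΩ : closure D ⊆ Ω)
    {F : Fin (n + 1) → EuclideanSpace ℝ (Fin (n + 1)) → V}
    (hF : ∀ j, ∀ x ∈ Ω, DifferentiableAt ℝ (F j) x) (hdiv : ContinuousOn (divergence F) Ω) :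
    FluxEqIntegralDivergence D N F := by
  wlog hΩb : Bornology.IsBounded Ω generalizing Ω
  · obtain ⟨R, hR⟩ := hDb.closure.subset_ball 0
    exact this (hΩ.inter Metric.isOpen_ball) (subset_inter hDΩ hR)
      (fun j x hx => hF j x hx.1) (hdiv.mono inter_subset_left)
      (Metric.isBounded_ball.subset inter_subset_right)
  choose! W hWo hxW hWΩ hW using fun x => exists_patch_of_mem_closure (x := x) hD hdef hΩ hDΩ
  obtain ⟨t, f, ht, hf, hfW, hfsum⟩ :=
    exists_finite_contDiff_partition hDb.isCompact_closure hWo hxW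
  have hfΩ (k) : tsupport (f k) ⊆ Ω := (hfW k).trans (hWΩ k (ht k k.2))
  have hfc (k) : HasCompactSupport (f k) :=
    Metric.isCompact_of_isClosed_isBounded (isClosed_tsupport _) (hΩb.subset (hfΩ k))
  have hGd (k j) : Differentiable ℝ fun x => f k x • F j x :=
    differentiable_smul_of_tsupport_subset ((hf k).differentiable one_ne_zero) (hfΩ k) (hF j)
  have hGc (k j) : HasCompactSupport fun x => f k x • F j x := (hfc k).smul_right
  have hGW (k j) : tsupport (fun x => f k x • F j x) ⊆ W k :=
    (closure_mono (Function.support_smul_subset_left _ _)).trans (hfW k)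
  have hGdiv (k) : Continuous (divergence fun j x => f k x • F j x) :=
    continuous_divergence_smul hΩ (hf k) (hfΩ k) hF hdiv
  refine .of_sum_eq hD hGd
    (fun k => ((hGdiv k).integrable_of_hasCompactSupport (μ := volume)
      (hasCompactSupport_divergence (hGc k))).integrableOn)
    (fun k => ?_) fun x hx j => by rw [← Finset.sum_smul, hfsum x hx, one_smul]
  rcases hW k (ht k k.2) with hWD | ⟨i, σ, γ, hsub⟩
  · exact .of_tsupport_subset hD N (hGd k) (hGc k) (fun j => hWD ▸ hGW k j) (hGdiv k)
  · exact hsub.fluxEqIntegralDivergence hD hN (hGd k) (hGc k) (hGW k) (hGdiv k)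

end DivergenceTheorem

/-! ### Regularized Cauchy kernels -/

/-- The function `(|y|² + s)^{-q}`. For `s = 0` it is the radial factor of the Cauchy kernels, and a
positive `s` removes the singularity at the origin. -/
def radialFactor {E : Type*} [Norm E] (q : ℕ) (s : ℝ) (y : E) : ℝ :=
  ((‖y‖ ^ 2 + s) ^ q)⁻¹

/-- The Dirac operator `∑ b(eᵢ) ∂ᵢ` with symbol `b`, as a function of the derivative `g'`. -/
def diracSymbol {m : ℕ} {A : Type*} [NormedRing A] [NormedAlgebra ℝ A]
    (b g' : EuclideanSpace ℝ (Fin m) →L[ℝ] A) : A :=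
  ∑ i, b (EuclideanSpace.single i 1) * g' (EuclideanSpace.single i 1)

section RadialFactor

variable {E : Type*} [NormedAddCommGroup E] {q : ℕ} {s : ℝ} {y : E}

theorem radialFactor_nonneg (hs : 0 ≤ s) (y : E) : 0 ≤ radialFactor q s y := by
  unfold radialFactor
  positivity

theorem radialFactor_pos (hs : 0 < s) (y : E) : 0 < radialFactor q s y := by
  unfold radialFactor
  positivity

theorem radialFactor_smul [NormedSpace ℝ E] {c : ℝ} (hc : c ≠ 0) (y : E) :
    radialFactor q 1 (c • y) = ((c ^ 2) ^ q)⁻¹ * radialFactor q (c ^ 2)⁻¹ y := by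
  have hscale : ‖c • y‖ ^ 2 + 1 = c ^ 2 * (‖y‖ ^ 2 + (c ^ 2)⁻¹) := by
    rw [norm_smul, mul_pow, Real.norm_eq_abs, sq_abs, mul_add, mul_inv_cancel₀ (pow_ne_zero 2 hc)]
  rw [radialFactor, radialFactor, hscale, mul_pow, mul_inv]

theorem continuous_radialFactor (hs : 0 < s) : Continuous (radialFactor (E := E) q s) :=
  Continuous.inv₀ (by fun_prop) fun y => by positivity

variable [InnerProductSpace ℝ E]

theorem hasFDerivAt_radialFactor (hy : ‖y‖ ^ 2 + s ≠ 0) :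
    HasFDerivAt (radialFactor q s) ((-2 * q * ((‖y‖ ^ 2 + s) ^ (q + 1))⁻¹) • innerSL ℝ y) y := by
  have hsq : HasFDerivAt (fun y : E => ‖y‖ ^ 2 + s) (2 • innerSL ℝ y) y :=
    (hasStrictFDerivAt_norm_sq y).hasFDerivAt.add_const s
  have hcomp := (hasDerivAt_zpow (-(q : ℤ)) (‖y‖ ^ 2 + s) (Or.inl hy)).comp_hasFDerivAt y hsq
  have hexponent : -(q : ℤ) - 1 = -((q + 1 : ℕ) : ℤ) := by
    push_cast
    ring
  have hradial : radialFactor q s = (fun t : ℝ => t ^ (-(q : ℤ))) ∘ fun y : E => ‖y‖ ^ 2 + s := by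
    funext y
    simp [radialFactor, zpow_neg]
  rw [hradial]
  refine hcomp.congr_fderiv ?_
  rw [hexponent, zpow_neg, zpow_natCast, ← Nat.cast_smul_eq_nsmul ℝ, smul_smul]
  congr 1
  push_cast
  ring

theorem contDiffOn_radialFactor {k : WithTop ℕ∞} :
    ContDiffOn ℝ k (radialFactor (E := E) q s) {y | ‖y‖ ^ 2 + s ≠ 0} :=
  (((contDiff_norm_sq ℝ).add contDiff_const).pow q).contDiffOn.inv fun _ hy => pow_ne_zero _ hy

end RadialFactor

section Kernel

variable {E A : Type*} [NormedAddCommGroup E] [InnerProductSpace ℝ E] [NormedRing A]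
  [NormedAlgebra ℝ A] {q : ℕ} {s : ℝ} {y : E}

/-- The regularized Cauchy kernel `a(y) (|y|² + s)^{-q}` with the linear symbol `a`. -/
def cauchyKernel (q : ℕ) (s : ℝ) (a : E →L[ℝ] A) (y : E) : A :=
  radialFactor q s y • a y

theorem hasFDerivAt_cauchyKernel (a : E →L[ℝ] A) (hy : ‖y‖ ^ 2 + s ≠ 0) :
    HasFDerivAt (cauchyKernel q s a) (radialFactor q s y • a +
      ((-2 * q * ((‖y‖ ^ 2 + s) ^ (q + 1))⁻¹) • innerSL ℝ y).smulRight (a y)) y :=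
  (hasFDerivAt_radialFactor hy).smul a.hasFDerivAt

theorem contDiffOn_cauchyKernel {k : WithTop ℕ∞} (a : E →L[ℝ] A) :
    ContDiffOn ℝ k (cauchyKernel q s a) {y | ‖y‖ ^ 2 + s ≠ 0} :=
  contDiffOn_radialFactor.smul a.contDiff.contDiffOn

theorem norm_cauchyKernel_le (hs : 0 ≤ s) (a : E →L[ℝ] A) (hy : y ≠ 0) :
    ‖cauchyKernel q s a y‖ ≤ ‖cauchyKernel q 0 a y‖ := by
  have := norm_pos_iff.2 hy
  simp only [cauchyKernel, norm_smul, Real.norm_eq_abs, abs_of_nonneg (radialFactor_nonneg hs y),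
    abs_of_nonneg (radialFactor_nonneg le_rfl y)]
  unfold radialFactor
  gcongr

theorem fderiv_cauchyKernel_mul_apply (a : E →L[ℝ] A) (hs : 0 < s) (X : E) {Y : E} (c : A)
    {g : E → A} (hg : DifferentiableAt ℝ g Y) (v : E) :
    fderiv ℝ (fun Y => cauchyKernel q s a (Y - X) * (c * g Y)) Y v =
      cauchyKernel q s a (Y - X) * (c * fderiv ℝ g Y v) +
        radialFactor q s (Y - X) • (a v * c * g Y) -
        (2 * q * radialFactor (q + 1) s (Y - X) * inner ℝ (Y - X) v) •
          (a (Y - X) * c * g Y) := by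
  have hkernel : HasFDerivAt (cauchyKernel q s a) _ (Y - X) :=
    hasFDerivAt_cauchyKernel a (by positivity)
  have hprod : HasFDerivAt (fun Y => cauchyKernel q s a (Y - X) * (c * g Y)) _ Y :=
    (hkernel.comp Y ((hasFDerivAt_id Y).sub_const X)).mul' (hg.hasFDerivAt.const_mul c)
  rw [hprod.fderiv]
  simp only [_root_.add_apply, _root_.smul_apply, ContinuousLinearMap.smulRight_apply,
    ContinuousLinearMap.comp_apply, ContinuousLinearMap.id_apply, innerSL_apply_apply, smul_eq_mul,
    op_smul_eq_mul, add_mul, smul_mul_assoc, mul_assoc, sub_eq_add_neg (_ + _), ← neg_smul]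
  rw [add_assoc]
  congr 3
  rw [radialFactor]
  ring

end Kernel

section KernelDivergence

variable {m q : ℕ} {A : Type*} [NormedRing A] [NormedAlgebra ℝ A] {ι : Type*} [Fintype ι]

theorem sum_smul_single (y : EuclideanSpace ℝ (Fin m)) :
    ∑ i, y i • EuclideanSpace.single i (1 : ℝ) = y := by
  simpa using (EuclideanSpace.basisFun (Fin m) ℝ).sum_repr y

theorem divergence_cauchyKernel_mul {a b : EuclideanSpace ℝ (Fin m) →L[ℝ] A} (hs : 0 < s)
    {g : EuclideanSpace ℝ (Fin m) → A} (X : EuclideanSpace ℝ (Fin m))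
    {Y : EuclideanSpace ℝ (Fin m)} (hg : DifferentiableAt ℝ g Y)
    (hdirac : diracSymbol b (fderiv ℝ g Y) = 0) :
    divergence (fun i Y => cauchyKernel q s a (Y - X) *
      (b (EuclideanSpace.single i 1) * g Y)) Y =
      radialFactor q s (Y - X) •
        ((∑ i, a (EuclideanSpace.single i 1) * b (EuclideanSpace.single i 1)) * g Y) -
        (2 * q * radialFactor (q + 1) s (Y - X)) • (a (Y - X) * b (Y - X) * g Y) := by
  simp only [divergence, fderiv_cauchyKernel_mul_apply a hs X _ hg, Finset.sum_add_distrib,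
    Finset.sum_sub_distrib, ← Finset.mul_sum]
  rw [← diracSymbol, hdirac, mul_zero, zero_add, ← Finset.smul_sum, ← Finset.sum_mul]
  congr 1
  have hb : b (Y - X) = ∑ i, (Y - X) i • b (EuclideanSpace.single i 1) := by
    simp only [← map_smul, ← _root_.map_sum, sum_smul_single]
  simp only [hb, EuclideanSpace.inner_single_right, conj_trivial, one_mul, Finset.mul_sum,
    Finset.sum_mul, Finset.smul_sum, mul_smul_comm, smul_mul_assoc, smul_smul]

theorem divergence_sum_cauchyKernel_mul (hm : m = 2 * q)
    {a b : ι → EuclideanSpace ℝ (Fin m) →L[ℝ] A} {κ : ℝ}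
    (hab : ∀ x, ∑ l, a l x * b l x = (κ * ‖x‖ ^ 2) • (1 : A)) (hs : 0 < s)
    {g : EuclideanSpace ℝ (Fin m) → A} (X : EuclideanSpace ℝ (Fin m))
    {Y : EuclideanSpace ℝ (Fin m)} (hg : DifferentiableAt ℝ g Y)
    (hdirac : ∀ l, diracSymbol (b l) (fderiv ℝ g Y) = 0) :
    divergence (fun i Y => ∑ l, cauchyKernel q s (a l) (Y - X) *
      (b l (EuclideanSpace.single i 1) * g Y)) Y =
      (κ * (m * s * radialFactor (q + 1) s (Y - X))) • g Y := by
  have hkernel (l) : DifferentiableAt ℝ (fun Y => cauchyKernel q s (a l) (Y - X)) Y := by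
    have : HasFDerivAt (cauchyKernel q s (a l)) _ (Y - X) :=
      hasFDerivAt_cauchyKernel (a l) (by positivity)
    exact (this.comp Y ((hasFDerivAt_id Y).sub_const X)).differentiableAt
  have hbasis : ∑ l, ∑ i, a l (EuclideanSpace.single i 1) * b l (EuclideanSpace.single i 1) =
      (κ * m) • (1 : A) := by
    rw [Finset.sum_comm]
    simp [hab, ← Nat.cast_smul_eq_nsmul ℝ, smul_smul, mul_comm]
  rw [divergence_finset_sum fun l i => (hkernel l).fun_mul (hg.const_mul _)]
  simp only [divergence_cauchyKernel_mul hs X hg (hdirac _), Finset.sum_sub_distrib,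
    ← Finset.smul_sum, ← Finset.sum_mul, hbasis, hab, smul_mul_assoc, one_mul, smul_smul,
    ← sub_smul]
  have : 0 < ‖Y - X‖ ^ 2 + s := by positivity
  have hm' : (m : ℝ) = 2 * q := by exact_mod_cast hm
  congr 1
  rw [radialFactor, radialFactor, hm']
  field_simp
  ring

end KernelDivergence

/-! ### The approximate identity -/

section ApproximateIdentity

variable {m q : ℕ}

/-- The total mass of the approximate identity given by the divergence of the regularized Cauchy
kernels. -/
def kernelMass (m q : ℕ) : ℝ :=
  ∫ u : EuclideanSpace ℝ (Fin m), m * radialFactor (q + 1) 1 u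

theorem integrable_radialFactor (hm : m = 2 * q) :
    Integrable (radialFactor (E := EuclideanSpace ℝ (Fin m)) (q + 1) 1) := by
  have h := integrable_rpow_neg_one_add_norm_sq (E := EuclideanSpace ℝ (Fin m)) (μ := volume)
    (r := 2 * q + 2) (by rw [finrank_euclideanSpace, Fintype.card_fin, hm]; push_cast; linarith)
  refine h.congr (Eventually.of_forall fun x => ?_)
  have hexponent : -(2 * (q : ℝ) + 2) / 2 = -((q + 1 : ℕ) : ℝ) := by
    push_cast
    ring
  simp only [radialFactor, hexponent]
  rw [Real.rpow_neg (by positivity), Real.rpow_natCast, add_comm]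

theorem kernelMass_pos (hm : m = 2 * q) (hq : 0 < q) : 0 < kernelMass m q := by
  have hpos (u : EuclideanSpace ℝ (Fin m)) : 0 < m * radialFactor (q + 1) 1 u :=
    mul_pos (Nat.cast_pos.2 (by omega)) (radialFactor_pos one_pos u)
  rw [kernelMass, integral_pos_iff_support_of_nonneg (fun u => (hpos u).le)
    ((integrable_radialFactor hm).const_mul _),
    Function.support_eq_univ (f := fun u : EuclideanSpace ℝ (Fin m) => _) fun u => (hpos u).ne']
  exact Measure.measure_univ_pos.2 (NeZero.ne _)

theorem tendsto_norm_pow_mul_radialFactor {E : Type*} [NormedAddCommGroup E] (q : ℕ) :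
    Tendsto (fun x : E => ‖x‖ ^ (2 * q) * radialFactor (q + 1) 1 x) (Bornology.cobounded E)
      (𝓝 0) := by
  have hinv : Tendsto (fun x : E => (‖x‖ ^ 2 + 1)⁻¹) (Bornology.cobounded E) (𝓝 0) :=
    tendsto_inv_atTop_zero.comp (tendsto_atTop_add_const_right _ _
      ((tendsto_pow_atTop two_ne_zero).comp tendsto_norm_cobounded_atTop))
  refine squeeze_zero (fun x => mul_nonneg (by positivity) (radialFactor_nonneg zero_le_one x))
    (fun x => ?_) hinv
  have hratio : (‖x‖ ^ 2) ^ q * ((‖x‖ ^ 2 + 1) ^ q)⁻¹ ≤ 1 := by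
    rw [← div_eq_mul_inv, div_le_one (by positivity)]
    gcongr
    linarith
  calc ‖x‖ ^ (2 * q) * radialFactor (q + 1) 1 x
      = (‖x‖ ^ 2) ^ q * ((‖x‖ ^ 2 + 1) ^ q)⁻¹ * (‖x‖ ^ 2 + 1)⁻¹ := by
        rw [radialFactor, pow_succ (‖x‖ ^ 2 + 1) q, mul_inv, pow_mul, mul_assoc]
    _ ≤ (‖x‖ ^ 2 + 1)⁻¹ := mul_le_of_le_one_left (by positivity) hratio

theorem tendsto_setIntegral_radialFactor_smul (hm : m = 2 * q) (hq : 0 < q)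
    {D : Set (EuclideanSpace ℝ (Fin m))} (hD : IsOpen D) {V : Type*} [NormedAddCommGroup V]
    [NormedSpace ℝ V] [CompleteSpace V] {g : EuclideanSpace ℝ (Fin m) → V}
    {X : EuclideanSpace ℝ (Fin m)} (hX : X ∈ D) (hg : IntegrableOn g D) (hgX : ContinuousAt g X) :
    Tendsto (fun c : ℝ => ∫ Y in D, (m * (c ^ 2)⁻¹ * radialFactor (q + 1) (c ^ 2)⁻¹ (Y - X)) • g Y)
      atTop (𝓝 (kernelMass m q • g X)) := by
  set M := kernelMass m q
  have hMpos : 0 < M := kernelMass_pos hm hq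
  have hfin : Module.finrank ℝ (EuclideanSpace ℝ (Fin m)) = 2 * q := by simp [hm]
  have hdecay : Tendsto (fun x : EuclideanSpace ℝ (Fin m) =>
      ‖x‖ ^ Module.finrank ℝ (EuclideanSpace ℝ (Fin m)) * (M⁻¹ * (m * radialFactor (q + 1) 1 x)))
      (Bornology.cobounded _) (𝓝 0) := by
    have hlim := (tendsto_norm_pow_mul_radialFactor (E := EuclideanSpace ℝ (Fin m)) q).const_mul
      (M⁻¹ * m)
    rw [mul_zero] at hlim
    refine hlim.congr fun x => ?_
    rw [hfin]
    ring
  have hlim := tendsto_integral_comp_smul_smul_of_integrable'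
    (μ := (volume : Measure (EuclideanSpace ℝ (Fin m))))
    (φ := fun x => M⁻¹ * (m * radialFactor (q + 1) 1 x))
    (fun x => mul_nonneg (inv_nonneg.2 hMpos.le)
      (mul_nonneg m.cast_nonneg (radialFactor_nonneg zero_le_one x)))
    (by rw [integral_const_mul]; exact inv_mul_cancel₀ hMpos.ne') hdecay
    (g := D.indicator g) (x₀ := X) (by rwa [integrable_indicator_iff hD.measurableSet])
    (hgX.congr (eventuallyEq_of_mem (hD.mem_nhds hX) (eqOn_indicator (s := D)).symm))
  rw [indicator_of_mem hX] at hlim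
  refine (hlim.const_smul M).congr' ?_
  filter_upwards [eventually_gt_atTop 0] with c hc
  rw [← integral_smul, ← integral_indicator hD.measurableSet]
  refine integral_congr_ae (Eventually.of_forall fun Y => ?_)
  by_cases hY : Y ∈ D
  · simp only [indicator_of_mem hY, smul_smul, radialFactor_smul hc.ne', hfin]
    congr 1
    rw [← neg_sub Y X, radialFactor, radialFactor, norm_neg]
    field_simp
    ring
  · simp only [indicator_of_notMem hY, smul_zero]

end ApproximateIdentity

/-! ### Cauchy formulae -/

/-- `D` is a bounded open set with boundary of class `C²` and outward unit normal `N`. -/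
structure IsC2Domain {m : ℕ} (D : Set (EuclideanSpace ℝ (Fin m)))
    (N : EuclideanSpace ℝ (Fin m) → EuclideanSpace ℝ (Fin m)) : Prop where
  isOpen : IsOpen D
  isBounded : Bornology.IsBounded D
  exists_defining : ∀ x ∈ frontier D, ∃ U ρ, IsDefiningFunctionAt D x U ρ
  normal : IsOutwardNormalField D N

/-- `g` is differentiable on `Ω` and annihilated there by the Dirac operators with symbols `b l`. -/
structure IsMonogenicOn {m : ℕ} {A : Type*} [NormedRing A] [NormedAlgebra ℝ A] {ι : Type*}
    (b : ι → EuclideanSpace ℝ (Fin m) →L[ℝ] A) (g : EuclideanSpace ℝ (Fin m) → A)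
    (Ω : Set (EuclideanSpace ℝ (Fin m))) : Prop where
  differentiableAt : ∀ x ∈ Ω, DifferentiableAt ℝ g x
  diracSymbol_eq_zero : ∀ l, ∀ x ∈ Ω, diracSymbol (b l) (fderiv ℝ g x) = 0

theorem IsMonogenicOn.comp {m : ℕ} {A : Type*} [NormedRing A] [NormedAlgebra ℝ A] {ι ι' : Type*}
    {b : ι → EuclideanSpace ℝ (Fin m) →L[ℝ] A} {g : EuclideanSpace ℝ (Fin m) → A}
    {Ω : Set (EuclideanSpace ℝ (Fin m))} (hg : IsMonogenicOn b g Ω) (e : ι' → ι) :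
    IsMonogenicOn (fun l => b (e l)) g Ω :=
  ⟨hg.differentiableAt, fun l => hg.diracSymbol_eq_zero (e l)⟩

/-- The symbols `a l` and `b l` satisfy `∑ a(x) b(x) = κ |x|²`, so that the Cauchy kernels with
symbols `a l` are, up to a factor, a fundamental solution of the Dirac operators with symbols
`b l`. -/
def IsDiracFactorization {m : ℕ} {A : Type*} [NormedRing A] [NormedAlgebra ℝ A] {ι : Type*}
    [Fintype ι] (κ : ℝ) (a b : ι → EuclideanSpace ℝ (Fin m) →L[ℝ] A) : Prop :=
  ∀ x, ∑ l, a l x * b l x = (κ * ‖x‖ ^ 2) • (1 : A)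

section SymbolMul

variable {m : ℕ} {A : Type*} [NormedRing A] [NormedAlgebra ℝ A]

theorem sum_smul_symbol_mul (c : EuclideanSpace ℝ (Fin m) →L[ℝ] A) (ν : EuclideanSpace ℝ (Fin m))
    (t : A) : ∑ i, ν i • (c (EuclideanSpace.single i 1) * t) = c ν * t := by
  conv_rhs => rw [← sum_smul_single ν]
  simp only [_root_.map_sum, map_smul, Finset.sum_mul, smul_mul_assoc]

theorem divergence_symbol_mul {c : EuclideanSpace ℝ (Fin m) →L[ℝ] A}
    {g : EuclideanSpace ℝ (Fin m) → A} {Y : EuclideanSpace ℝ (Fin m)}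
    (hg : DifferentiableAt ℝ g Y) :
    divergence (fun i Y => c (EuclideanSpace.single i 1) * g Y) Y =
      diracSymbol c (fderiv ℝ g Y) := by
  refine Finset.sum_congr rfl fun i _ => ?_
  rw [(hg.hasFDerivAt.const_mul (c (EuclideanSpace.single i 1))).fderiv, _root_.smul_apply,
    smul_eq_mul]

end SymbolMul

section KernelOnCompact

variable {m q : ℕ} {A : Type*} [NormedRing A] [NormedAlgebra ℝ A] {s : ℝ}
  {K : Set (EuclideanSpace ℝ (Fin m))} {X : EuclideanSpace ℝ (Fin m)}
  {μ : Measure (EuclideanSpace ℝ (Fin m))}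

theorem continuousOn_cauchyKernel_sub (hs : 0 ≤ s) (c : EuclideanSpace ℝ (Fin m) →L[ℝ] A)
    (hX : X ∉ K) : ContinuousOn (fun Y => cauchyKernel q s c (Y - X)) K := by
  refine (contDiffOn_cauchyKernel (k := 0) c).continuousOn.comp (by fun_prop) fun Y hY => ?_
  have hpos : 0 < ‖Y - X‖ := norm_pos_iff.2 (sub_ne_zero.2 (ne_of_mem_of_not_mem hY hX))
  exact (show 0 < ‖Y - X‖ ^ 2 + s by positivity).ne'

theorem integrableOn_cauchyKernel_mul (hK : IsCompact K) (hs : 0 ≤ s)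
    (c : EuclideanSpace ℝ (Fin m) →L[ℝ] A) (hX : X ∉ K) {T : EuclideanSpace ℝ (Fin m) → A}
    (hT : IntegrableOn T K μ) :
    IntegrableOn (fun Y => cauchyKernel q s c (Y - X) * T Y) K μ :=
  hT.continuousOn_mul (continuousOn_cauchyKernel_sub hs c hX) hK

theorem tendsto_cauchyKernel_nhdsGT (a : EuclideanSpace ℝ (Fin m) →L[ℝ] A)
    {y : EuclideanSpace ℝ (Fin m)} (hy : y ≠ 0) :
    Tendsto (fun s => cauchyKernel q s a y) (𝓝[>] 0) (𝓝 (cauchyKernel q 0 a y)) := by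
  have hcont : ContinuousAt (fun s => radialFactor q s y) 0 :=
    ContinuousAt.inv₀ (by fun_prop) (by simpa using fun h => absurd h hy)
  exact (hcont.tendsto.mono_left nhdsWithin_le_nhds).smul_const (a y)

theorem tendsto_setIntegral_sum_cauchyKernel_mul {ι : Type*} [Fintype ι] (hK : IsCompact K)
    (a : ι → EuclideanSpace ℝ (Fin m) →L[ℝ] A) (hX : X ∉ K)
    {T : ι → EuclideanSpace ℝ (Fin m) → A} (hT : ∀ l, IntegrableOn (T l) K μ) :
    Tendsto (fun s => ∫ Y in K, ∑ l, cauchyKernel q s (a l) (Y - X) * T l Y ∂μ) (𝓝[>] 0)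
      (𝓝 (∫ Y in K, ∑ l, cauchyKernel q 0 (a l) (Y - X) * T l Y ∂μ)) := by
  have hne (Y) (hY : Y ∈ K) : Y - X ≠ 0 := sub_ne_zero.2 (ne_of_mem_of_not_mem hY hX)
  refine tendsto_integral_filter_of_dominated_convergence
    (fun Y => ∑ l, ‖cauchyKernel q 0 (a l) (Y - X)‖ * ‖T l Y‖) ?_ ?_ ?_ ?_
  · filter_upwards [self_mem_nhdsWithin] with s (hs : 0 < s)
    exact (integrable_finsetSum _ fun l _ =>
      integrableOn_cauchyKernel_mul hK hs.le (a l) hX (hT l)).aestronglyMeasurable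
  · filter_upwards [self_mem_nhdsWithin] with s (hs : 0 < s)
    filter_upwards [ae_restrict_mem hK.measurableSet] with Y hY
    refine norm_sum_le_of_le _ fun l _ => (norm_mul_le _ _).trans ?_
    gcongr
    exact norm_cauchyKernel_le hs.le _ (hne Y hY)
  · exact integrable_finsetSum _ fun l _ => IntegrableOn.continuousOn_mul
      (continuousOn_cauchyKernel_sub le_rfl (a l) hX).norm (hT l).norm hK
  · filter_upwards [ae_restrict_mem hK.measurableSet] with Y hY
    exact tendsto_finsetSum _ fun l _ =>
      (tendsto_cauchyKernel_nhdsGT (a l) (hne Y hY)).mul_const _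

end KernelOnCompact

namespace IsC2Domain

variable {m q : ℕ} {D Ω : Set (EuclideanSpace ℝ (Fin m))}
  {N : EuclideanSpace ℝ (Fin m) → EuclideanSpace ℝ (Fin m)} {X : EuclideanSpace ℝ (Fin m)}

theorem integral_divergence (hD : IsC2Domain D N) (hm : 0 < m) {V : Type*}
    [NormedAddCommGroup V] [NormedSpace ℝ V] (hΩ : IsOpen Ω) (hDΩ : closure D ⊆ Ω)
    {F : Fin m → EuclideanSpace ℝ (Fin m) → V}
    (hF : ∀ j, ∀ x ∈ Ω, DifferentiableAt ℝ (F j) x) (hdiv : ContinuousOn (divergence F) Ω) :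
    IntegrableOn (fun y => ∑ j, N y j • F j y) (frontier D) μHE[m - 1] ∧
      ∫ y in frontier D, ∑ j, N y j • F j y ∂μHE[m - 1] = ∫ x in D, divergence F x := by
  obtain ⟨n, rfl⟩ := Nat.exists_eq_succ_of_ne_zero hm.ne'
  have h := divergence_theorem hD.isOpen hD.isBounded hD.exists_defining hD.normal hΩ hDΩ hF hdiv
  exact ⟨h.integrableOn, h.integral_eq⟩

theorem isCompact_frontier (hD : IsC2Domain D N) : IsCompact (frontier D) :=
  hD.isBounded.isCompact_closure.of_isClosed_subset isClosed_frontier frontier_subset_closure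

theorem notMem_frontier (hD : IsC2Domain D N) (hX : X ∈ D) : X ∉ frontier D :=
  (disjoint_frontier_iff_isOpen.2 hD.isOpen).notMem_of_mem_right hX

variable {A : Type*} [NormedRing A] [NormedAlgebra ℝ A] {ι : Type*}
  {a b : ι → EuclideanSpace ℝ (Fin m) →L[ℝ] A} {g : EuclideanSpace ℝ (Fin m) → A} {κ : ℝ}

theorem integrableOn_normal_mul (hD : IsC2Domain D N) (hm : 0 < m) (hΩ : IsOpen Ω)
    (hDΩ : closure D ⊆ Ω) (hg : IsMonogenicOn b g Ω) (l : ι) :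
    IntegrableOn (fun Y => b l (N Y) * g Y) (frontier D) μHE[m - 1] := by
  have hdiv : ContinuousOn (divergence fun i Y => b l (EuclideanSpace.single i 1) * g Y) Ω :=
    (continuousOn_const (c := (0 : A))).congr fun x hx => by
      rw [divergence_symbol_mul (hg.differentiableAt x hx), hg.diracSymbol_eq_zero l x hx]
  have h := (hD.integral_divergence hm hΩ hDΩ
    (fun _ x hx => (hg.differentiableAt x hx).const_mul _) hdiv).1
  simpa only [sum_smul_symbol_mul] using h

variable [Fintype ι]

theorem regularized_cauchy_formula (hD : IsC2Domain D N) (hm : m = 2 * q) (hq : 0 < q)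
    (hΩ : IsOpen Ω) (hDΩ : closure D ⊆ Ω) (hab : IsDiracFactorization κ a b)
    (hg : IsMonogenicOn b g Ω) {s : ℝ} (hs : 0 < s) (X : EuclideanSpace ℝ (Fin m)) :
    ∫ Y in frontier D, ∑ l, cauchyKernel q s (a l) (Y - X) * (b l (N Y) * g Y) ∂μHE[m - 1] =
      κ • ∫ Y in D, (m * s * radialFactor (q + 1) s (Y - X)) • g Y := by
  set F : Fin m → EuclideanSpace ℝ (Fin m) → A := fun i Y =>
    ∑ l, cauchyKernel q s (a l) (Y - X) * (b l (EuclideanSpace.single i 1) * g Y) with hF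
  have hkernel (l Y) : DifferentiableAt ℝ (fun Y => cauchyKernel q s (a l) (Y - X)) Y := by
    have := (hasFDerivAt_cauchyKernel (q := q) (s := s) (a l) (y := Y - X)
      (by positivity)).differentiableAt
    exact this.comp Y (differentiableAt_id.sub_const X)
  have hdivF (Y) (hY : Y ∈ Ω) :
      divergence F Y = (κ * (m * s * radialFactor (q + 1) s (Y - X))) • g Y :=
    divergence_sum_cauchyKernel_mul hm hab hs X (hg.differentiableAt Y hY) fun l =>
      hg.diracSymbol_eq_zero l Y hY
  have hdivcont : ContinuousOn (divergence F) Ω := by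
    have := continuous_radialFactor (E := EuclideanSpace ℝ (Fin m)) (q := q + 1) hs
    refine ContinuousOn.congr (ContinuousOn.smul (by fun_prop) ?_) hdivF
    exact fun x hx => (hg.differentiableAt x hx).continuousAt.continuousWithinAt
  have hflux (Y) : ∑ i, N Y i • F i Y =
      ∑ l, cauchyKernel q s (a l) (Y - X) * (b l (N Y) * g Y) := by
    simp only [hF, Finset.smul_sum, ← mul_smul_comm]
    rw [Finset.sum_comm]
    simp only [← Finset.mul_sum]
    simp only [mul_smul_comm, sum_smul_symbol_mul]
  have h := (hD.integral_divergence (by omega) hΩ hDΩ (F := F) (fun i x hx => .fun_sum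
    fun l _ => (hkernel l x).fun_mul ((hg.differentiableAt x hx).const_mul _)) hdivcont).2
  rw [setIntegral_congr_fun hD.isOpen.measurableSet
    fun Y hY => hdivF Y (hDΩ (subset_closure hY))] at h
  simpa only [hflux, mul_smul, integral_smul] using h

/-- Let `s → 0` in the regularized formula: the boundary integral converges to the left-hand side
by dominated convergence, while the volume integral is an approximate identity at `X`. -/
theorem cauchy_formula [CompleteSpace A] (hD : IsC2Domain D N) (hm : m = 2 * q)
    (hq : 0 < q) (hΩ : IsOpen Ω) (hDΩ : closure D ⊆ Ω) (hab : IsDiracFactorization κ a b)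
    (hg : IsMonogenicOn b g Ω) (hX : X ∈ D) :
    ∫ Y in frontier D, ∑ l, cauchyKernel q 0 (a l) (Y - X) * (b l (N Y) * g Y) ∂μHE[m - 1] =
      (κ * kernelMass m q) • g X := by
  have hgcont : ContinuousOn g (closure D) := fun x hx =>
    (hg.differentiableAt x (hDΩ hx)).continuousAt.continuousWithinAt
  have hgD : IntegrableOn g D :=
    (hgcont.integrableOn_compact hD.isBounded.isCompact_closure).mono_set subset_closure
  have hs : Tendsto (fun c : ℝ => (c ^ 2)⁻¹) atTop (𝓝[>] 0) :=
    tendsto_inv_atTop_nhdsGT_zero.comp (tendsto_pow_atTop two_ne_zero)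
  have hboundary := (tendsto_setIntegral_sum_cauchyKernel_mul (q := q) hD.isCompact_frontier a
    (hD.notMem_frontier hX)
    (hD.integrableOn_normal_mul (by omega) hΩ hDΩ hg)).comp hs
  have hvolume := (tendsto_setIntegral_radialFactor_smul hm hq hD.isOpen hX hgD
    (hg.differentiableAt X (hDΩ (subset_closure hX))).continuousAt).const_smul κ
  rw [mul_smul]
  refine tendsto_nhds_unique hboundary (hvolume.congr' ?_)
  filter_upwards [eventually_gt_atTop 0] with c hc
  exact (hD.regularized_cauchy_formula hm hq hΩ hDΩ hab hg (by positivity) X).symm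

end IsC2Domain

/-! ### Differentiation of Cauchy's formula -/

section KernelDerivative

variable {m q : ℕ} {A : Type*} [NormedRing A] [NormedAlgebra ℝ A]
  {K : Set (EuclideanSpace ℝ (Fin m))} {X Y : EuclideanSpace ℝ (Fin m)}
  {μ : Measure (EuclideanSpace ℝ (Fin m))} {T : EuclideanSpace ℝ (Fin m) → A}

theorem continuousOn_fderiv_cauchyKernel (c : EuclideanSpace ℝ (Fin m) →L[ℝ] A) :
    ContinuousOn (fderiv ℝ (cauchyKernel q 0 c)) {0}ᶜ := by
  have hcompl : {y : EuclideanSpace ℝ (Fin m) | ‖y‖ ^ 2 + 0 ≠ 0} = {0}ᶜ := by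
    ext y
    simp [mem_ofPred_eq]
  have hK := contDiffOn_cauchyKernel (q := q) (s := 0) (k := 1) c
  rw [hcompl] at hK
  exact hK.continuousOn_fderiv_of_isOpen isOpen_compl_singleton le_rfl

theorem hasFDerivAt_cauchyKernel_sub (c : EuclideanSpace ℝ (Fin m) →L[ℝ] A) (hXY : X ≠ Y) :
    HasFDerivAt (fun X' => cauchyKernel q 0 c (Y - X'))
      (-fderiv ℝ (cauchyKernel q 0 c) (Y - X)) X := by
  have hne : ‖Y - X‖ ^ 2 + 0 ≠ 0 := by simpa [sub_eq_zero] using hXY.symm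
  have hK := (hasFDerivAt_cauchyKernel (q := q) c hne).differentiableAt.hasFDerivAt
  refine (hK.comp X ((hasFDerivAt_id X).const_sub Y)).congr_fderiv ?_
  rw [ContinuousLinearMap.comp_neg, ContinuousLinearMap.comp_id]

theorem norm_flip_mul_comp_le (t : A) (f : EuclideanSpace ℝ (Fin m) →L[ℝ] A) :
    ‖(ContinuousLinearMap.mul ℝ A).flip t ∘L f‖ ≤ ‖t‖ * ‖f‖ :=
  (ContinuousLinearMap.opNorm_comp_le _ _).trans <| by
    gcongr
    exact ContinuousLinearMap.opNorm_le_bound _ (norm_nonneg t) fun v => by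
      simpa [mul_comm] using norm_mul_le v t

theorem exists_bound_fderiv_cauchyKernel_sub (c : EuclideanSpace ℝ (Fin m) →L[ℝ] A)
    (hK : IsCompact K) {B : Set (EuclideanSpace ℝ (Fin m))} (hB : IsCompact B)
    (hBK : Disjoint B K) :
    ∃ C, ∀ X ∈ B, ∀ Y ∈ K, ‖fderiv ℝ (cauchyKernel q 0 c) (Y - X)‖ ≤ C := by
  have hcont : ContinuousOn (fun w : EuclideanSpace ℝ (Fin m) × EuclideanSpace ℝ (Fin m) =>
      fderiv ℝ (cauchyKernel q 0 c) (w.2 - w.1)) (B ×ˢ K) :=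
    (continuousOn_fderiv_cauchyKernel c).comp (by fun_prop) fun w hw =>
      sub_ne_zero.2 (hBK.ne_of_mem hw.1 hw.2).symm
  obtain ⟨C, hC⟩ := (hB.prod hK).exists_bound_of_continuousOn hcont
  exact ⟨C, fun X hX Y hY => hC (X, Y) ⟨hX, hY⟩⟩

theorem aestronglyMeasurable_flip_mul_comp_fderiv_cauchyKernel
    (c : EuclideanSpace ℝ (Fin m) →L[ℝ] A) (hK : IsCompact K) (hX : X ∉ K)
    (hT : IntegrableOn T K μ) :
    AEStronglyMeasurable (fun Y => (ContinuousLinearMap.mul ℝ A).flip (T Y) ∘L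
      (-fderiv ℝ (cauchyKernel q 0 c) (Y - X))) (μ.restrict K) := by
  have hcont : ContinuousOn (fun Y => -fderiv ℝ (cauchyKernel q 0 c) (Y - X)) K :=
    ((continuousOn_fderiv_cauchyKernel c).comp (by fun_prop) fun Y hY =>
      sub_ne_zero.2 (ne_of_mem_of_not_mem hY hX)).neg
  exact (ContinuousLinearMap.compL ℝ _ A A).aestronglyMeasurable_comp₂
    ((ContinuousLinearMap.mul ℝ A).flip.continuous.comp_aestronglyMeasurable
      hT.aestronglyMeasurable) (hcont.aestronglyMeasurable hK.measurableSet)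

theorem integrableOn_flip_mul_comp_fderiv_cauchyKernel (c : EuclideanSpace ℝ (Fin m) →L[ℝ] A)
    (hK : IsCompact K) (hX : X ∉ K) (hT : IntegrableOn T K μ) :
    IntegrableOn (fun Y => (ContinuousLinearMap.mul ℝ A).flip (T Y) ∘L
      (-fderiv ℝ (cauchyKernel q 0 c) (Y - X))) K μ := by
  obtain ⟨C, hC⟩ :=
    exists_bound_fderiv_cauchyKernel_sub (q := q) c hK (isCompact_singleton (x := X))
    (disjoint_singleton_left.2 hX)
  refine Integrable.mono' (hT.norm.mul_const C)
    (aestronglyMeasurable_flip_mul_comp_fderiv_cauchyKernel c hK hX hT) ?_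
  filter_upwards [ae_restrict_mem hK.measurableSet] with Y hY
  refine (norm_flip_mul_comp_le _ _).trans ?_
  rw [norm_neg]
  gcongr
  exact hC X rfl Y hY

theorem hasFDerivAt_setIntegral_cauchyKernel_mul (c : EuclideanSpace ℝ (Fin m) →L[ℝ] A)
    (hK : IsCompact K) (hX : X ∉ K) (hT : IntegrableOn T K μ) :
    HasFDerivAt (fun X' => ∫ Y in K, cauchyKernel q 0 c (Y - X') * T Y ∂μ)
      (∫ Y in K, (ContinuousLinearMap.mul ℝ A).flip (T Y) ∘L
        (-fderiv ℝ (cauchyKernel q 0 c) (Y - X)) ∂μ) X := by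
  have hKX : Kᶜ ∈ 𝓝 X := hK.isClosed.isOpen_compl.mem_nhds hX
  obtain ⟨δ, hδ, hball⟩ := Metric.nhds_basis_closedBall.mem_iff.1 hKX
  obtain ⟨C, hC⟩ := exists_bound_fderiv_cauchyKernel_sub (q := q) c hK (isCompact_closedBall X δ)
    (disjoint_left.2 hball)
  refine hasFDerivAt_integral_of_dominated_of_fderiv_le (𝕜 := ℝ)
    (F' := fun X' Y => (ContinuousLinearMap.mul ℝ A).flip (T Y) ∘L
      (-fderiv ℝ (cauchyKernel q 0 c) (Y - X'))) (bound := fun Y => ‖T Y‖ * C)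
    (Metric.closedBall_mem_nhds X hδ) ?_ (integrableOn_cauchyKernel_mul hK le_rfl c hX hT)
    (aestronglyMeasurable_flip_mul_comp_fderiv_cauchyKernel c hK hX hT) ?_ (hT.norm.mul_const C) ?_
  · filter_upwards [hKX] with X' hX'
    exact (integrableOn_cauchyKernel_mul hK le_rfl c hX' hT).aestronglyMeasurable
  · filter_upwards [ae_restrict_mem hK.measurableSet] with Y hY X' hX'
    refine (norm_flip_mul_comp_le _ _).trans ?_
    rw [norm_neg]
    gcongr
    exact hC X' hX' Y hY
  · filter_upwards [ae_restrict_mem hK.measurableSet] with Y hY X' hX'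
    exact ((ContinuousLinearMap.mul ℝ A).flip (T Y)).hasFDerivAt.comp X'
      (hasFDerivAt_cauchyKernel_sub c (ne_of_mem_of_not_mem hY (hball hX')).symm)

variable {Λ : (EuclideanSpace ℝ (Fin m) →L[ℝ] A) →L[ℝ] A}

theorem apply_flip_mul_comp_fderiv_cauchyKernel (c : EuclideanSpace ℝ (Fin m) →L[ℝ] A)
    (hΛ : ∀ f t, Λ ((ContinuousLinearMap.mul ℝ A).flip t ∘L f) = Λ f * t) (hX : X ∉ K) :
    EqOn (fun Y => Λ ((ContinuousLinearMap.mul ℝ A).flip (T Y) ∘L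
        (-fderiv ℝ (cauchyKernel q 0 c) (Y - X))))
      (fun Y => Λ (fderiv ℝ (fun X' => cauchyKernel q 0 c (Y - X')) X) * T Y) K := fun Y hY => by
  simp only [hΛ, (hasFDerivAt_cauchyKernel_sub c (ne_of_mem_of_not_mem hY hX).symm).fderiv]

theorem integrableOn_apply_fderiv_cauchyKernel_mul (c : EuclideanSpace ℝ (Fin m) →L[ℝ] A)
    (hΛ : ∀ f t, Λ ((ContinuousLinearMap.mul ℝ A).flip t ∘L f) = Λ f * t)
    (hK : IsCompact K) (hX : X ∉ K) (hT : IntegrableOn T K μ) :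
    IntegrableOn (fun Y => Λ (fderiv ℝ (fun X' => cauchyKernel q 0 c (Y - X')) X) * T Y) K μ :=
  IntegrableOn.congr_fun
    (Λ.integrable_comp (integrableOn_flip_mul_comp_fderiv_cauchyKernel c hK hX hT))
    (apply_flip_mul_comp_fderiv_cauchyKernel c hΛ hX) hK.measurableSet

theorem apply_fderiv_setIntegral_cauchyKernel_mul [CompleteSpace A]
    (c : EuclideanSpace ℝ (Fin m) →L[ℝ] A)
    (hΛ : ∀ f t, Λ ((ContinuousLinearMap.mul ℝ A).flip t ∘L f) = Λ f * t)
    (hK : IsCompact K) (hX : X ∉ K) (hT : IntegrableOn T K μ) :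
    Λ (fderiv ℝ (fun X' => ∫ Y in K, cauchyKernel q 0 c (Y - X') * T Y ∂μ) X) =
      ∫ Y in K, Λ (fderiv ℝ (fun X' => cauchyKernel q 0 c (Y - X')) X) * T Y ∂μ := by
  rw [(hasFDerivAt_setIntegral_cauchyKernel_mul c hK hX hT).fderiv,
    ← Λ.integral_comp_comm (integrableOn_flip_mul_comp_fderiv_cauchyKernel c hK hX hT)]
  exact setIntegral_congr_fun hK.measurableSet (apply_flip_mul_comp_fderiv_cauchyKernel c hΛ hX)

end KernelDerivative

section

variable {m q : ℕ} {D Ω : Set (EuclideanSpace ℝ (Fin m))}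
  {N : EuclideanSpace ℝ (Fin m) → EuclideanSpace ℝ (Fin m)}
  {A : Type*} [NormedRing A] [NormedAlgebra ℝ A] {ι : Type*} [Fintype ι]
  {a b : ι → EuclideanSpace ℝ (Fin m) →L[ℝ] A} {g : EuclideanSpace ℝ (Fin m) → A} {κ : ℝ}
  {X : EuclideanSpace ℝ (Fin m)}

/-- The symbol `Λ` stands for a first order operator that commutes with right multiplications, so
that it can be applied to the kernels under the integral sign. -/
theorem IsC2Domain.cauchy_formula_derivation [CompleteSpace A] (hD : IsC2Domain D N)
    (hm : m = 2 * q) (hq : 0 < q) (hΩ : IsOpen Ω) (hDΩ : closure D ⊆ Ω)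
    (hab : IsDiracFactorization κ a b) (hg : IsMonogenicOn b g Ω) (hX : X ∈ D)
    {Λ : (EuclideanSpace ℝ (Fin m) →L[ℝ] A) →L[ℝ] A}
    (hΛ : ∀ f t, Λ ((ContinuousLinearMap.mul ℝ A).flip t ∘L f) = Λ f * t) :
    ∫ Y in frontier D, ∑ l, Λ (fderiv ℝ (fun X' => cauchyKernel q 0 (a l) (Y - X')) X) *
        (b l (N Y) * g Y) ∂μHE[m - 1] = (κ * kernelMass m q) • Λ (fderiv ℝ g X) := by
  have hK := hD.isCompact_frontier
  have hT := hD.integrableOn_normal_mul (by omega) hΩ hDΩ hg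
  have hcauchy : (fun X' => ∑ l, ∫ Y in frontier D, cauchyKernel q 0 (a l) (Y - X') *
      (b l (N Y) * g Y) ∂μHE[m - 1]) =ᶠ[𝓝 X] fun X' => (κ * kernelMass m q) • g X' := by
    filter_upwards [hD.isOpen.mem_nhds hX] with X' hX'
    rw [← hD.cauchy_formula hm hq hΩ hDΩ hab hg hX', integral_finsetSum _ fun l _ =>
      integrableOn_cauchyKernel_mul hK le_rfl (a l) (hD.notMem_frontier hX') (hT l)]
  have hX' := hD.notMem_frontier hX
  rw [integral_finsetSum _ fun l _ =>
    integrableOn_apply_fderiv_cauchyKernel_mul (a l) hΛ hK hX' (hT l)]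
  simp only [← apply_fderiv_setIntegral_cauchyKernel_mul _ hΛ hK hX' (hT _), ← _root_.map_sum]
  rw [← fderiv_fun_sum fun l _ => (hasFDerivAt_setIntegral_cauchyKernel_mul (a l) hK hX'
    (hT l)).differentiableAt, hcauchy.fderiv_eq,
    fderiv_fun_const_smul (hg.differentiableAt X (hDΩ (subset_closure hX))), map_smul]

end

/-! ### The area of the unit sphere -/

section Sphere

variable {m q : ℕ} {x : EuclideanSpace ℝ (Fin m)}

theorem gradient_norm_sq_sub_one :
    ∇ (fun y : EuclideanSpace ℝ (Fin m) => ‖y‖ ^ 2 - 1) x = (2 : ℝ) • x := by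
  refine HasGradientAt.gradient (hasGradientAt_iff_hasFDerivAt.2 ?_)
  refine ((hasStrictFDerivAt_norm_sq x).hasFDerivAt.sub_const 1).congr_fderiv ?_
  ext v
  simp

theorem isDefiningFunctionAt_ball (hx : x ≠ 0) :
    IsDefiningFunctionAt (Metric.ball 0 1) x univ (fun y => ‖y‖ ^ 2 - 1) where
  isOpen := isOpen_univ
  mem := mem_univ x
  contDiffOn := ((contDiff_norm_sq ℝ).sub contDiff_const).contDiffOn
  gradient_ne_zero := by
    rw [gradient_norm_sq_sub_one]
    exact smul_ne_zero two_ne_zero hx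
  inter_eq := by
    ext y
    simp [mem_ofPred_eq, sq_lt_one_iff_abs_lt_one]

theorem isC2Domain_ball : IsC2Domain (Metric.ball (0 : EuclideanSpace ℝ (Fin m)) 1) id := by
  have hnorm {x : EuclideanSpace ℝ (Fin m)} (hx : x ∈ frontier (Metric.ball 0 1)) : ‖x‖ = 1 := by
    rwa [frontier_ball _ one_ne_zero, mem_sphere_zero_iff_norm] at hx
  have hdef {x : EuclideanSpace ℝ (Fin m)} (hx : x ∈ frontier (Metric.ball 0 1)) :=
    isDefiningFunctionAt_ball (norm_ne_zero_iff.1 ((hnorm hx).trans_ne one_ne_zero))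
  refine ⟨Metric.isOpen_ball, Metric.isBounded_ball, fun x hx => ⟨_, _, hdef hx⟩,
    fun x hx U ρ h => ?_⟩
  rw [h.normalize_gradient_eq (hdef hx) Metric.isOpen_ball hx, gradient_norm_sq_sub_one, norm_smul,
    hnorm hx]
  simp

/-- Cauchy's formula for the constant function `1` on the unit ball, with the gradient as Dirac
operator. -/
theorem measureReal_sphere_eq_kernelMass (hm : m = 2 * q) (hq : 0 < q) :
    μHE[m - 1].real (Metric.sphere (0 : EuclideanSpace ℝ (Fin m)) 1) = kernelMass m q := by
  have hfactor : IsDiracFactorization (m := m) (A := ℝ) (ι := Fin m) 1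
      (fun l => EuclideanSpace.proj l) (fun l => EuclideanSpace.proj l) := fun x => by
    simp [EuclideanSpace.norm_sq_eq, ← pow_two]
  have hone : IsMonogenicOn (m := m) (A := ℝ) (ι := Fin m) (fun l => EuclideanSpace.proj l)
      (fun _ => 1) univ :=
    ⟨fun x _ => by fun_prop, fun l x _ => by simp [diracSymbol]⟩
  have h := isC2Domain_ball.cauchy_formula hm hq isOpen_univ (subset_univ _) hfactor hone
    (Metric.mem_ball_self one_pos)
  rw [frontier_ball _ one_ne_zero, setIntegral_congr_fun (g := fun _ => (1 : ℝ))
    Metric.isClosed_sphere.measurableSet] at h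
  · simpa using h
  · intro Y hY
    rw [mem_sphere_zero_iff_norm] at hY
    have hsum : ∑ i, Y i * Y i = 1 := by
      simpa [hY, ← pow_two] using (EuclideanSpace.norm_sq_eq Y).symm
    simpa [cauchyKernel, radialFactor, hY] using hsum

end Sphere

/-! ### Complex coordinates -/

/-- The enumeration `(a, k) ↦ 2k + a` of an even number of indices by pairs. -/
def pairEquiv {n N : ℕ} (h : N = 2 * n) : Fin 2 × Fin n ≃ Fin N :=
  (Equiv.prodComm _ _).trans (finProdFinEquiv.trans (finCongr (by omega)))

theorem sum_pairs {n N : ℕ} (h : N = 2 * n) {M : Type*} [AddCommMonoid M] (F : Fin N → M) :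
    ∑ i, F i = ∑ k, (F (pairEquiv h (0, k)) + F (pairEquiv h (1, k))) := by
  rw [← (pairEquiv h).sum_comp, Fintype.sum_prod_type, Fin.sum_univ_two, Finset.sum_add_distrib]

section Coordinates

variable {p : ℕ}

/-- The enumeration of the real coordinates as `(0, k) ↦ xₖ`, `(1, k) ↦ yₖ`. -/
def coordinateEquiv (p : ℕ) : Fin 2 × Fin (2 * p) ≃ Fin (4 * p) :=
  pairEquiv (by omega)

theorem coordinateEquiv_zero (k : Fin (2 * p)) : coordinateEquiv p (0, k) = xIdx k := by
  ext
  simp [coordinateEquiv, pairEquiv, xIdx]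

theorem coordinateEquiv_one (k : Fin (2 * p)) : coordinateEquiv p (1, k) = yIdx k := by
  ext
  simp [coordinateEquiv, pairEquiv, yIdx, add_comm]

theorem sum_coordinates {M : Type*} [AddCommMonoid M] (F : Fin (4 * p) → M) :
    ∑ i, F i = ∑ k, (F (xIdx k) + F (yIdx k)) := by
  simp only [← coordinateEquiv_zero, ← coordinateEquiv_one]
  exact sum_pairs _ F

theorem sum_quaternionic {M : Type*} [AddCommMonoid M] (F : Fin (2 * p) → M) :
    ∑ k, F k = ∑ j, (F (fstIdx j) + F (sndIdx j)) := by
  rw [sum_pairs rfl F]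
  congr! with j <;> ext <;> simp [pairEquiv, fstIdx, sndIdx, add_comm]

theorem xIdx_injective : Function.Injective (xIdx (p := p)) := fun k l h => by
  simp only [xIdx, Fin.mk.injEq] at h
  omega

theorem yIdx_injective : Function.Injective (yIdx (p := p)) := fun k l h => by
  simp only [yIdx, Fin.mk.injEq] at h
  omega

theorem xIdx_ne_yIdx (k l : Fin (2 * p)) : xIdx k ≠ yIdx l := fun h => by
  simp only [xIdx, yIdx, Fin.mk.injEq] at h
  omega

theorem zCoord_apply (k : Fin (2 * p)) (X : Space p) :
    zCoord k X = X (xIdx k) + Complex.I * X (yIdx k) := rfl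

theorem zcCoord_apply (k : Fin (2 * p)) (X : Space p) :
    zcCoord k X = X (xIdx k) - Complex.I * X (yIdx k) := rfl

theorem conj_zCoord (k : Fin (2 * p)) (X : Space p) :
    (starRingEnd ℂ) (zCoord k X) = zcCoord k X := by
  simp [zCoord_apply, zcCoord_apply, sub_eq_add_neg]

theorem conj_zcCoord (k : Fin (2 * p)) (X : Space p) :
    (starRingEnd ℂ) (zcCoord k X) = zCoord k X := by
  rw [← conj_zCoord, Complex.conj_conj]

theorem sum_zCoord_mul_zcCoord (X : Space p) :
    ∑ k, zCoord k X * zcCoord k X = ((‖X‖ ^ 2 : ℝ) : ℂ) := by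
  rw [EuclideanSpace.norm_sq_eq, sum_coordinates]
  push_cast
  refine Finset.sum_congr rfl fun k _ => ?_
  simp only [zCoord_apply, zcCoord_apply, Real.norm_eq_abs, ← Complex.ofReal_pow, sq_abs]
  push_cast
  linear_combination (-(X (yIdx k) : ℂ) ^ 2) * Complex.I_sq

theorem zCoord_single_xIdx (k l : Fin (2 * p)) :
    zCoord k (EuclideanSpace.single (xIdx l) 1) = if k = l then 1 else 0 := by
  simp [zCoord_apply, (xIdx_ne_yIdx l k).symm, xIdx_injective.eq_iff, apply_ite Complex.ofReal]

theorem zCoord_single_yIdx (k l : Fin (2 * p)) :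
    zCoord k (EuclideanSpace.single (yIdx l) 1) = if k = l then Complex.I else 0 := by
  simp [zCoord_apply, xIdx_ne_yIdx k l, yIdx_injective.eq_iff, apply_ite Complex.ofReal]

theorem zcCoord_single_xIdx (k l : Fin (2 * p)) :
    zcCoord k (EuclideanSpace.single (xIdx l) 1) = if k = l then 1 else 0 := by
  rw [← conj_zCoord, zCoord_single_xIdx]
  split <;> simp

theorem zcCoord_single_yIdx (k l : Fin (2 * p)) :
    zcCoord k (EuclideanSpace.single (yIdx l) 1) = if k = l then -Complex.I else 0 := by
  rw [← conj_zCoord, zCoord_single_yIdx]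
  split <;> simp

end Coordinates

/-! ### The coframe of the complex coordinates -/

section Coframe

variable {p : ℕ}

theorem coframe_xIdx (k : Fin (2 * p)) : coframe (xIdx k) = zCoord k := by
  have h : (xIdx k).1 % 2 = 0 := by simp [xIdx]
  rw [coframe, if_pos h]
  congr 1
  ext
  simp [xIdx]

theorem coframe_yIdx (k : Fin (2 * p)) : coframe (yIdx k) = zcCoord k := by
  have h : ¬ (yIdx k).1 % 2 = 0 := by simp [yIdx]
  rw [coframe, if_neg h]
  congr 1
  ext
  simp only [yIdx]
  omega

/-- The matrix of the coframe `dz₁, dz₁ᶜ, …, dz₂ₚ, dz₂ₚᶜ` (columns) with respect to the standard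
basis (rows). -/
def coframeMatrix (p : ℕ) : Matrix (Fin (4 * p)) (Fin (4 * p)) ℂ :=
  Matrix.of fun i j => coframe j (EuclideanSpace.single i 1)

/-- The matrix of `dz, dzᶜ` (columns) in terms of `dx, dy` (rows). -/
def planarCoframeMatrix : Matrix (Fin 2) (Fin 2) ℂ :=
  !![1, 1; Complex.I, -Complex.I]

theorem det_planarCoframeMatrix : planarCoframeMatrix.det = -2 * Complex.I := by
  rw [planarCoframeMatrix, Matrix.det_fin_two_of]
  ring

theorem planarCoframeMatrix_mul_conjTranspose :
    planarCoframeMatrix * planarCoframeMatrix.conjTranspose = (2 : ℂ) • 1 := by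
  ext i j
  fin_cases i <;> fin_cases j <;>
    simp [planarCoframeMatrix, Matrix.mul_apply, Fin.sum_univ_two] <;> norm_num

theorem coframeMatrix_submatrix :
    (coframeMatrix p).submatrix (coordinateEquiv p) (coordinateEquiv p) =
      Matrix.blockDiagonal fun _ => planarCoframeMatrix := by
  ext ⟨i, k⟩ ⟨j, l⟩
  fin_cases i <;> fin_cases j <;>
    simp [Matrix.blockDiagonal_apply, coframeMatrix, planarCoframeMatrix, coordinateEquiv_zero,
      coordinateEquiv_one, coframe_xIdx, coframe_yIdx, zCoord_single_xIdx, zCoord_single_yIdx,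
      zcCoord_single_xIdx, zcCoord_single_yIdx, eq_comm (a := l)]

theorem det_coframeMatrix : (coframeMatrix p).det = (-2 * Complex.I) ^ (2 * p) := by
  rw [← Matrix.det_submatrix_equiv_self (coordinateEquiv p), coframeMatrix_submatrix,
    Matrix.det_blockDiagonal, Finset.prod_const, Finset.card_univ, Fintype.card_fin,
    det_planarCoframeMatrix]

theorem coframeMatrix_mul_conjTranspose :
    coframeMatrix p * (coframeMatrix p).conjTranspose = (2 : ℂ) • 1 := by
  refine (Matrix.reindex (coordinateEquiv p).symm (coordinateEquiv p).symm).injective ?_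
  simp only [Matrix.reindex_apply, Equiv.symm_symm]
  rw [← Matrix.submatrix_mul_equiv _ _ _ (coordinateEquiv p), ← Matrix.conjTranspose_submatrix,
    coframeMatrix_submatrix, Matrix.blockDiagonal_conjTranspose, ← Matrix.blockDiagonal_mul,
    planarCoframeMatrix_mul_conjTranspose]
  exact (Matrix.blockDiagonal_smul (2 : ℂ) 1).trans <| by
    rw [Matrix.blockDiagonal_one, Matrix.submatrix_smul, Pi.smul_apply, Pi.smul_apply,
      Matrix.submatrix_one_equiv]

theorem adjugate_coframeMatrix : (coframeMatrix p).adjugate =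
    (-2 * Complex.I) ^ (2 * p) • ((1 / 2 : ℂ) • (coframeMatrix p).conjTranspose) := by
  have hinv : coframeMatrix p * ((1 / 2 : ℂ) • (coframeMatrix p).conjTranspose) = 1 := by
    rw [Matrix.mul_smul, coframeMatrix_mul_conjTranspose, smul_smul]
    norm_num
  rw [← det_coframeMatrix, ← mul_one (coframeMatrix p).adjugate, ← hinv, ← mul_assoc,
    Matrix.adjugate_mul, Matrix.smul_mul, one_mul]

theorem adjugate_eq_det_submatrix {R : Type*} [CommRing R] {N : ℕ} (C : Matrix (Fin N) (Fin N) R)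
    (i j : Fin N) (r c : Fin (N - 1) → Fin N)
    (hr : ∀ a, (r a).1 = if a.1 < i.1 then a.1 else a.1 + 1)
    (hc : ∀ a, (c a).1 = if a.1 < j.1 then a.1 else a.1 + 1) :
    C.adjugate j i = (-1) ^ (i.1 + j.1) * (C.submatrix r c).det := by
  obtain ⟨n, rfl⟩ := Nat.exists_eq_succ_of_ne_zero (Fin.pos i).ne'
  have hr' : r = i.succAbove := by
    ext a
    simp [hr a, Fin.succAbove, Fin.lt_def, apply_ite Fin.val]
  have hc' : c = j.succAbove := by
    ext a
    simp [hc a, Fin.succAbove, Fin.lt_def, apply_ite Fin.val]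
  rw [Matrix.adjugate_fin_succ_eq_det_submatrix, hr', hc']

end Coframe

/-! ### Witt bases -/

section Witt

variable {p : ℕ}

instance : CompleteSpace (Cl p) := FiniteDimensional.complete ℂ (Cl p)

theorem polar_cliffordForm (u v : Fin (4 * p) → ℂ) :
    QuadraticMap.polar (cliffordForm p) u v = -2 * ∑ k, u k * v k := by
  simp only [QuadraticMap.polar, cliffordForm, QuadraticMap.weightedSumSquares_apply,
    ← Finset.sum_sub_distrib, Finset.mul_sum, Pi.add_apply, smul_eq_mul]
  exact Finset.sum_congr rfl fun k _ => by ring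

theorem eGen_anticomm (i j : Fin (4 * p)) :
    eGen i * eGen j + eGen j * eGen i = (if i = j then -2 else 0 : ℂ) • (1 : Cl p) := by
  have hpolar : QuadraticMap.polar (cliffordForm p) (Pi.single i 1) (Pi.single j 1) =
      if i = j then -2 else 0 := by
    simp [polar_cliffordForm, Pi.single_apply, eq_comm (a := j)]
  rw [← hpolar, ← Algebra.algebraMap_eq_smul_one]
  exact CliffordAlgebra.ι_mul_ι_add_swap _ _

theorem eGen_pair_anticomm (α β γ ε : ℂ) (k l : Fin (2 * p)) :
    (α • (eGen (xIdx k) + β • eGen (yIdx k))) * (γ • (eGen (xIdx l) + ε • eGen (yIdx l))) +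
        (γ • (eGen (xIdx l) + ε • eGen (yIdx l))) * (α • (eGen (xIdx k) + β • eGen (yIdx k))) =
      (if k = l then -2 * (α * γ) * (1 + β * ε) else 0 : ℂ) • (1 : Cl p) := by
  have expand (u v s t : Cl p) :
      (α • (u + β • v)) * (γ • (s + ε • t)) + (γ • (s + ε • t)) * (α • (u + β • v)) =
        (α * γ) • ((u * s + s * u) + ε • (u * t + t * u) + β • (v * s + s * v) +
          (β * ε) • (v * t + t * v)) := by
    simp only [smul_mul_assoc, mul_smul_comm, mul_add, add_mul]
    module
  rw [expand]
  simp only [eGen_anticomm, xIdx_injective.eq_iff, yIdx_injective.eq_iff, xIdx_ne_yIdx,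
    (xIdx_ne_yIdx _ _).symm, if_false]
  split <;> module

/-- Families `w`, `w'` satisfying the canonical anticommutation relations, such as `𝔣` and `𝔣†`,
or their quaternionic rotations. -/
structure IsWittBasis (w w' : Fin (2 * p) → Cl p) : Prop where
  anticomm_left : ∀ k l, w k * w l + w l * w k = 0
  anticomm_right : ∀ k l, w' k * w' l + w' l * w' k = 0
  anticomm_dual : ∀ k l, w k * w' l + w' l * w k = if k = l then 1 else 0

theorem isWittBasis_wittF : IsWittBasis (wittF (p := p)) wittFd := by
  have hF (k : Fin (2 * p)) :
      wittF k = (-(1 / 2) : ℂ) • (eGen (xIdx k) + (-Complex.I) • eGen (yIdx k)) := by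
    rw [wittF, neg_smul Complex.I, sub_eq_add_neg]
  refine ⟨fun k l => ?_, fun k l => ?_, fun k l => ?_⟩
  · rw [hF, hF, eGen_pair_anticomm]
    simp
  · rw [wittFd, wittFd, eGen_pair_anticomm]
    simp
  · rw [hF, wittFd, eGen_pair_anticomm, neg_mul Complex.I, Complex.I_mul_I, ite_smul]
    norm_num

/-- The quaternionic rotation `(w₁, w₂, …, w₂ₚ₋₁, w₂ₚ) ↦ (-w₂, w₁, …, -w₂ₚ, w₂ₚ₋₁)`. -/
def rotate (w : Fin (2 * p) → Cl p) (k : Fin (2 * p)) : Cl p :=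
  if h : k.1 % 2 = 0 then -w ⟨k.1 + 1, by omega⟩ else w ⟨k.1 - 1, by omega⟩

theorem rotate_fstIdx (w : Fin (2 * p) → Cl p) (j : Fin p) :
    rotate w (fstIdx j) = -w (sndIdx j) :=
  dif_pos (by simp [fstIdx])

theorem rotate_sndIdx (w : Fin (2 * p) → Cl p) (j : Fin p) :
    rotate w (sndIdx j) = w (fstIdx j) :=
  dif_neg (by simp [sndIdx])

theorem eq_fstIdx_or_eq_sndIdx (k : Fin (2 * p)) : ∃ j, k = fstIdx j ∨ k = sndIdx j := by
  refine ⟨⟨k.1 / 2, by omega⟩, ?_⟩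
  simp only [fstIdx, sndIdx, Fin.ext_iff]
  omega

theorem fstIdx_injective : Function.Injective (fstIdx (p := p)) := fun j j' h => by
  simp only [fstIdx, Fin.mk.injEq] at h
  omega

theorem sndIdx_injective : Function.Injective (sndIdx (p := p)) := fun j j' h => by
  simp only [sndIdx, Fin.mk.injEq] at h
  omega

theorem fstIdx_ne_sndIdx (j j' : Fin p) : fstIdx j ≠ sndIdx j' := fun h => by
  simp only [fstIdx, sndIdx, Fin.mk.injEq] at h
  omega

namespace IsWittBasis

variable {w w' : Fin (2 * p) → Cl p}

theorem symm (h : IsWittBasis w w') : IsWittBasis w' w where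
  anticomm_left := h.anticomm_right
  anticomm_right := h.anticomm_left
  anticomm_dual k l := by simp only [add_comm, h.anticomm_dual l k, eq_comm (a := k)]

theorem rotate (h : IsWittBasis w w') :
    IsWittBasis (OspMonogenic.rotate w) (OspMonogenic.rotate w') := by
  constructor
  all_goals
    intro k l
    obtain ⟨j, rfl | rfl⟩ := eq_fstIdx_or_eq_sndIdx k <;>
    obtain ⟨j', rfl | rfl⟩ := eq_fstIdx_or_eq_sndIdx l <;>
    simp only [rotate_fstIdx, rotate_sndIdx, neg_mul, mul_neg, neg_neg, ← neg_add,
      h.anticomm_left, h.anticomm_right, h.anticomm_dual, neg_zero, fstIdx_ne_sndIdx,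
      (fstIdx_ne_sndIdx _ _).symm, fstIdx_injective.eq_iff, sndIdx_injective.eq_iff, if_false]

end IsWittBasis

end Witt

/-! ### Vector variables and Dirac operators -/

section VectorVariables

variable {p : ℕ}

/-- The linear map `X ↦ ∑ ζₖ(X) wₖ`; all vector variables of the theorem are of this form, with
`ζ` either the coordinates `zₖ` or their conjugates. -/
def vectorVariable (ζ : Fin (2 * p) → Space p →ₗ[ℝ] ℂ) (w : Fin (2 * p) → Cl p) :
    Space p →L[ℝ] Cl p :=
  LinearMap.toContinuousLinearMap
    (∑ k, (LinearMap.toSpanSingleton ℂ (Cl p) (w k)).restrictScalars ℝ ∘ₗ ζ k)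

theorem vectorVariable_apply (ζ : Fin (2 * p) → Space p →ₗ[ℝ] ℂ) (w : Fin (2 * p) → Cl p)
    (X : Space p) : vectorVariable ζ w X = ∑ k, ζ k X • w k := by
  simp [vectorVariable]

theorem vecZ_eq (X : Space p) : vecZ X = vectorVariable zCoord wittF X :=
  (vectorVariable_apply _ _ _).symm

theorem vecZd_eq (X : Space p) : vecZd X = vectorVariable zcCoord wittFd X :=
  (vectorVariable_apply _ _ _).symm

theorem vecZJ_eq (X : Space p) : vecZJ X = vectorVariable zCoord (rotate wittFd) X := by
  rw [vectorVariable_apply, sum_quaternionic, vecZJ]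
  refine Finset.sum_congr rfl fun j _ => ?_
  rw [rotate_fstIdx, rotate_sndIdx, smul_neg]
  abel

theorem vecZdJ_eq (X : Space p) : vecZdJ X = vectorVariable zcCoord (rotate wittF) X := by
  rw [vectorVariable_apply, sum_quaternionic, vecZdJ]
  refine Finset.sum_congr rfl fun j _ => ?_
  rw [rotate_fstIdx, rotate_sndIdx, smul_neg]
  abel

theorem sum_smul_anticomm {ι R A : Type*} [Fintype ι] [CommRing R] [Ring A] [Algebra R A]
    (α β : ι → R) (w w' : ι → A) :
    (∑ k, α k • w k) * (∑ l, β l • w' l) + (∑ l, β l • w' l) * (∑ k, α k • w k) =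
      ∑ k, ∑ l, (α k * β l) • (w k * w' l + w' l * w k) := by
  rw [Finset.sum_mul_sum, Finset.sum_mul_sum,
    Finset.sum_comm (f := fun l k => β l • w' l * α k • w k)]
  simp only [← Finset.sum_add_distrib, smul_mul_smul_comm, smul_add, mul_comm (β _)]

theorem IsWittBasis.vectorVariable_anticomm {w w' : Fin (2 * p) → Cl p} (h : IsWittBasis w w')
    (X : Space p) :
    vectorVariable zCoord w X * vectorVariable zcCoord w' X +
      vectorVariable zcCoord w' X * vectorVariable zCoord w X = (‖X‖ ^ 2) • (1 : Cl p) := by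
  rw [vectorVariable_apply, vectorVariable_apply, sum_smul_anticomm]
  simp only [h.anticomm_dual, smul_ite, smul_zero, Finset.sum_ite_eq, Finset.mem_univ, if_true]
  rw [← Finset.sum_smul, sum_zCoord_mul_zcCoord]
  exact Complex.coe_smul _ _

theorem vectorVariable_mul_self {w : Fin (2 * p) → Cl p} (h : ∀ k l, w k * w l + w l * w k = 0)
    (ζ : Fin (2 * p) → Space p →ₗ[ℝ] ℂ) (X : Space p) :
    vectorVariable ζ w X * vectorVariable ζ w X = 0 := by
  have hself := sum_smul_anticomm (fun k => ζ k X) (fun k => ζ k X) w w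
  simp only [h, smul_zero, Finset.sum_const_zero, ← vectorVariable_apply] at hself
  rw [← two_smul ℂ] at hself
  exact (smul_eq_zero.1 hself).resolve_left two_ne_zero

theorem diracSymbol_vectorVariable_zcCoord (w : Fin (2 * p) → Cl p) (F : Space p → Cl p)
    (X : Space p) :
    diracSymbol (vectorVariable zcCoord w) (fderiv ℝ F X) = (2 : ℂ) • ∑ k, w k * dzOp k F X := by
  rw [diracSymbol, sum_coordinates, Finset.smul_sum]
  refine Finset.sum_congr rfl fun k _ => ?_
  simp only [vectorVariable_apply, zcCoord_single_xIdx, zcCoord_single_yIdx, ite_smul, zero_smul,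
    Finset.sum_ite_eq', Finset.mem_univ, if_true, dzOp, pd, mul_smul_comm, mul_sub,
    smul_mul_assoc]
  module

theorem diracSymbol_vectorVariable_zCoord (w : Fin (2 * p) → Cl p) (F : Space p → Cl p)
    (X : Space p) :
    diracSymbol (vectorVariable zCoord w) (fderiv ℝ F X) = (2 : ℂ) • ∑ k, w k * dzcOp k F X := by
  rw [diracSymbol, sum_coordinates, Finset.smul_sum]
  refine Finset.sum_congr rfl fun k _ => ?_
  simp only [vectorVariable_apply, zCoord_single_xIdx, zCoord_single_yIdx, ite_smul, zero_smul,
    Finset.sum_ite_eq', Finset.mem_univ, if_true, dzcOp, pd, mul_smul_comm, mul_add,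
    smul_mul_assoc]
  module

theorem diracZJ_eq (F : Space p → Cl p) (X : Space p) :
    diracZJ F X = ∑ k, rotate wittF k * dzOp k F X := by
  rw [sum_quaternionic, diracZJ]
  refine Finset.sum_congr rfl fun j _ => ?_
  rw [rotate_fstIdx, rotate_sndIdx, neg_mul]
  abel

theorem diracZdJ_eq (F : Space p → Cl p) (X : Space p) :
    diracZdJ F X = ∑ k, rotate wittFd k * dzcOp k F X := by
  rw [sum_quaternionic, diracZdJ]
  refine Finset.sum_congr rfl fun j _ => ?_
  rw [rotate_fstIdx, rotate_sndIdx, neg_mul]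
  abel

/-- The symbol of `∂_{zₖᶜ}`, a linear functional of the total derivative. -/
def dzcSymbol (k : Fin (2 * p)) : (Space p →L[ℝ] Cl p) →L[ℝ] Cl p :=
  (1 / 2 : ℂ) • (ContinuousLinearMap.apply ℝ (Cl p) (EuclideanSpace.single (xIdx k) 1) +
    Complex.I • ContinuousLinearMap.apply ℝ (Cl p) (EuclideanSpace.single (yIdx k) 1))

/-- The symbol at the point `X` of the operator `𝓔`, a linear functional of the total
derivative. -/
def eulerSymbol (X : Space p) : (Space p →L[ℝ] Cl p) →L[ℝ] Cl p :=
  ∑ j : Fin p, (zCoord (fstIdx j) X • dzcSymbol (sndIdx j) -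
    zCoord (sndIdx j) X • dzcSymbol (fstIdx j))

theorem euler_eq (F : Space p → Cl p) (X : Space p) :
    euler F X = eulerSymbol X (fderiv ℝ F X) := by
  simp [euler, eulerSymbol, dzcSymbol, dzcOp, pd, _root_.sum_apply]

theorem eulerSymbol_flip_mul_comp (X : Space p) (f : Space p →L[ℝ] Cl p) (t : Cl p) :
    eulerSymbol X ((ContinuousLinearMap.mul ℝ (Cl p)).flip t ∘L f) = eulerSymbol X f * t := by
  simp [eulerSymbol, dzcSymbol, _root_.sum_apply, Finset.sum_mul, sub_mul, add_mul]

end VectorVariables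

/-! ### Densities of the differential forms -/

section Densities

variable {p : ℕ}

theorem wedge_coframe_omitIdx_apply (i j : Fin (4 * p)) :
    wedge (fun a => coframe (omitIdx j a)) (fun a => EuclideanSpace.single (omitIdx i a) 1) =
      (-1) ^ (i.1 + j.1) * ((-2 * Complex.I) ^ (2 * p) / 2) *
        (starRingEnd ℂ) (coframe j (EuclideanSpace.single i 1)) := by
  have homit (i : Fin (4 * p)) (a) :
      (omitIdx i a).1 = if a.1 < i.1 then a.1 else a.1 + 1 := by
    rw [omitIdx]
    split <;> rfl
  have hminor : wedge (fun a => coframe (omitIdx j a))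
      (fun a => EuclideanSpace.single (omitIdx i a) 1) =
      (-1) ^ (i.1 + j.1) * (coframeMatrix p).adjugate j i := by
    rw [adjugate_eq_det_submatrix (coframeMatrix p) i j _ _ (homit i) (homit j), ← mul_assoc,
      ← mul_pow, neg_one_mul, neg_neg, one_pow, one_mul]
    rfl
  rw [hminor, adjugate_coframeMatrix]
  simp only [Matrix.smul_apply, Matrix.conjTranspose_apply, smul_eq_mul, coframeMatrix,
    Matrix.of_apply, RCLike.star_def]
  ring

theorem sum_smul_wedge_coframe_omitIdx (ν : Space p) (j : Fin (4 * p)) :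
    ∑ i : Fin (4 * p), ((-1 : ℝ) ^ i.1 * ν i) •
      wedge (fun a => coframe (omitIdx j a)) (fun a => EuclideanSpace.single (omitIdx i a) 1) =
      (-1) ^ j.1 * ((-2 * Complex.I) ^ (2 * p) / 2) * (starRingEnd ℂ) (coframe j ν) := by
  have hν : coframe j ν = ∑ i, (ν i : ℂ) * coframe j (EuclideanSpace.single i 1) := by
    conv_lhs => rw [← sum_smul_single ν]
    simp [_root_.map_sum]
  rw [hν, _root_.map_sum, Finset.mul_sum]
  refine Finset.sum_congr rfl fun i _ => ?_
  have hsign : ((-1 : ℂ) ^ i.1) * (-1) ^ i.1 = 1 := by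
    rw [← mul_pow, neg_one_mul, neg_neg, one_pow]
  rw [wedge_coframe_omitIdx_apply, map_mul, Complex.conj_ofReal, Complex.real_smul]
  push_cast
  rw [pow_add]
  linear_combination (ν i * (-1) ^ j.1 * ((-2 * Complex.I) ^ (2 * p) / 2) *
    (starRingEnd ℂ) (coframe j (EuclideanSpace.single i 1))) * hsign

theorem density_mulForm (a b : Cl p) (η : Form p (Cl p)) (ν : Space p) :
    density (mulForm a η b) ν = a * (density η ν * b) := by
  simp only [density, Finset.sum_mul, Finset.mul_sum, smul_mul_assoc, mul_smul_comm]
  rfl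

theorem density_sum {ι : Type*} (s : Finset ι) (η : ι → Form p (Cl p)) (ν : Space p) :
    density (∑ l ∈ s, η l) ν = ∑ l ∈ s, density (η l) ν := by
  have hadd (θ θ' : Form p (Cl p)) : density (θ + θ') ν = density θ ν + density θ' ν := by
    simp [density, Finset.sum_add_distrib]
  exact _root_.map_sum (AddMonoidHom.mk' (fun θ => density θ ν) hadd) _ _

theorem density_smul (c : ℂ) (η : Form p (Cl p)) (ν : Space p) :
    density (c • η) ν = c • density η ν := by
  simp only [density, Finset.smul_sum]
  refine Finset.sum_congr rfl fun i _ => ?_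
  rw [smul_comm]
  rfl

theorem density_clForm (c : Cl p) (η : Form p ℂ) (ν : Space p) :
    density (clForm c η) ν = (∑ i : Fin (4 * p), ((-1 : ℝ) ^ i.1 * ν i) •
      η fun a => EuclideanSpace.single (omitIdx i a) 1) • c := by
  simp only [density, Finset.sum_smul, smul_assoc]
  rfl

theorem density_sum_hatDz (w : Fin (2 * p) → Cl p) (ν : Space p) :
    density (∑ k, clForm (w k) (hatDz k)) ν =
      ((-2 * Complex.I) ^ (2 * p) / 2) • vectorVariable zcCoord w ν := by
  rw [density_sum, vectorVariable_apply, Finset.smul_sum]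
  refine Finset.sum_congr rfl fun k _ => ?_
  rw [density_clForm, hatDz, sum_smul_wedge_coframe_omitIdx, coframe_xIdx, conj_zCoord,
    smul_smul]
  simp [xIdx]

theorem density_neg_sum_hatDzc (w : Fin (2 * p) → Cl p) (ν : Space p) :
    density (-∑ k, clForm (w k) (hatDzc k)) ν =
      ((-2 * Complex.I) ^ (2 * p) / 2) • vectorVariable zCoord w ν := by
  rw [← neg_one_smul ℂ (∑ k, _), density_smul, density_sum, vectorVariable_apply,
    Finset.smul_sum, Finset.smul_sum]
  refine Finset.sum_congr rfl fun k _ => ?_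
  rw [density_clForm, hatDzc, sum_smul_wedge_coframe_omitIdx, coframe_yIdx, conj_zcCoord,
    smul_smul, smul_smul]
  simp [yIdx, pow_succ]

theorem density_dσ (ν : Space p) :
    density dσ ν = ((-2 * Complex.I) ^ (2 * p) / 2) • vectorVariable zcCoord wittFd ν :=
  density_sum_hatDz _ _

theorem density_dσd (ν : Space p) :
    density dσd ν = ((-2 * Complex.I) ^ (2 * p) / 2) • vectorVariable zCoord wittF ν :=
  density_neg_sum_hatDzc _ _

theorem clForm_neg (c : Cl p) (η : Form p ℂ) : clForm (-c) η = -clForm c η := by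
  ext v
  exact smul_neg (η v) c

theorem density_dσJ (ν : Space p) :
    density dσJ ν = ((-2 * Complex.I) ^ (2 * p) / 2) • vectorVariable zcCoord (rotate wittF) ν := by
  rw [← density_sum_hatDz, sum_quaternionic, dσJ]
  congr 1
  refine Finset.sum_congr rfl fun j _ => ?_
  rw [rotate_fstIdx, rotate_sndIdx, clForm_neg]
  abel

theorem density_dσdJ (ν : Space p) :
    density dσdJ ν =
      ((-2 * Complex.I) ^ (2 * p) / 2) • vectorVariable zCoord (rotate wittFd) ν := by
  rw [← density_neg_sum_hatDzc, sum_quaternionic, dσdJ]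
  congr 2
  refine Finset.sum_congr rfl fun j _ => ?_
  rw [rotate_fstIdx, rotate_sndIdx, clForm_neg]
  abel

end Densities

/-! ### Boundary integrals -/

section BoundaryIntegrals

variable {p : ℕ} {D Ω : Set (Space p)} {N : Space p → Space p}

theorem IsLocalDefiningFunction.isDefiningFunctionAt {x : Space p} {U : Set (Space p)}
    {ρ : Space p → ℝ} (h : IsLocalDefiningFunction D x U ρ) : IsDefiningFunctionAt D x U ρ :=
  ⟨h.isOpen, h.mem, contDiffOn_infty.1 h.contDiffOn 2, h.gradient_ne_zero, h.inter_eq⟩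

theorem IsSmoothBoundedDomain.isC2Domain (hD : IsSmoothBoundedDomain D) :
    IsC2Domain D (outwardNormal D) := by
  refine ⟨hD.isOpen, hD.isBounded, fun x hx => ?_, fun x hx U ρ h => ?_⟩
  · obtain ⟨U, ρ, h⟩ := hD.smooth_boundary x hx
    exact ⟨U, ρ, h.isDefiningFunctionAt⟩
  · obtain ⟨U₀, ρ₀, h₀⟩ := hD.smooth_boundary x hx
    have hex : ∃ ν, IsOutwardUnitNormal D x ν := ⟨_, U₀, ρ₀, h₀, rfl⟩
    obtain ⟨U₁, ρ₁, h₁, heq⟩ := hex.choose_spec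
    rw [outwardNormal, dif_pos hex, heq]
    exact h₁.isDefiningFunctionAt.normalize_gradient_eq h hD.isOpen hx

/-- `∫_{∂D} η = c`, the integral being absolutely convergent, for a boundary oriented by the normal
field `N`; `HasBoundaryIntegral D` is the case `N = outwardNormal D`. -/
def HasNormalIntegral (D : Set (Space p)) (N : Space p → Space p) (η : Space p → Form p (Cl p))
    (c : Cl p) : Prop :=
  IntegrableOn (fun Y => density (η Y) (N Y)) (frontier D) μHE[4 * p - 1] ∧
    ∫ Y in frontier D, density (η Y) (N Y) ∂μHE[4 * p - 1] = c

theorem HasNormalIntegral.const_smul {η : Space p → Form p (Cl p)} {v : Cl p}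
    (h : HasNormalIntegral D N η v) (c : ℂ) :
    HasNormalIntegral D N (fun Y => c • η Y) (c • v) := by
  simp only [HasNormalIntegral, density_smul]
  exact ⟨h.1.smul c, by rw [integral_smul, h.2]⟩

/-! ### The normalized kernels -/

/-- The kernel `(2 / a₄ₚ) b(X) / |X|⁴ᵖ`; the kernels of the theorem are the cases where `b` is one
of the four vector variables. -/
def normalizedKernel (b : Space p →L[ℝ] Cl p) : Space p → Cl p :=
  cauchyKernel (2 * p) 0 ((2 / sphereArea p) • b)

theorem normalizedKernel_apply (b : Space p →L[ℝ] Cl p) (X : Space p) :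
    normalizedKernel b X = (2 / sphereArea p / ‖X‖ ^ (4 * p)) • b X := by
  have hpow : (‖X‖ ^ 2) ^ (2 * p) = ‖X‖ ^ (4 * p) := by
    rw [← pow_mul, ← mul_assoc]; norm_num
  rw [normalizedKernel, cauchyKernel, radialFactor, add_zero, hpow, _root_.smul_apply, smul_smul,
    mul_comm, ← div_eq_mul_inv]

theorem kerE_eq : kerE (p := p) = normalizedKernel (vectorVariable zCoord wittF) := by
  funext X
  rw [normalizedKernel_apply, kerE, vecZ_eq]

theorem kerEd_eq : kerEd (p := p) = normalizedKernel (vectorVariable zcCoord wittFd) := by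
  funext X
  rw [normalizedKernel_apply, kerEd, vecZd_eq]

theorem kerEJ_eq : kerEJ (p := p) = normalizedKernel (vectorVariable zCoord (rotate wittFd)) := by
  funext X
  rw [normalizedKernel_apply, kerEJ, vecZJ_eq]

theorem kerEdJ_eq :
    kerEdJ (p := p) = normalizedKernel (vectorVariable zcCoord (rotate wittF)) := by
  funext X
  rw [normalizedKernel_apply, kerEdJ, vecZdJ_eq]

theorem two_div_sphereArea_mul_kernelMass (hp : 1 ≤ p) :
    2 / sphereArea p * kernelMass (4 * p) (2 * p) = 2 := by
  have harea : sphereArea p = kernelMass (4 * p) (2 * p) :=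
    measureReal_sphere_eq_kernelMass (by omega) (by omega)
  rw [harea]
  exact div_mul_cancel₀ _ (kernelMass_pos (by omega) (by omega)).ne'

section Formulae

variable {g : Space p → Cl p} {X : Space p} {ι : Type*} [Fintype ι] {κ : ℝ} {c : ℂ}
  {a b : ι → Space p →L[ℝ] Cl p} {η : ι → Form p (Cl p)}

theorem IsDiracFactorization.smul_left (hab : IsDiracFactorization κ a b) (r : ℝ) :
    IsDiracFactorization (r * κ) (fun l => r • a l) b := fun x => by
  simp only [_root_.smul_apply, smul_mul_assoc, ← Finset.smul_sum, hab x, smul_smul, mul_assoc]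

theorem hasNormalIntegral_normalizedKernel (hp : 1 ≤ p) (hD : IsC2Domain D N) (hΩ : IsOpen Ω)
    (hDΩ : closure D ⊆ Ω) (hab : IsDiracFactorization κ a b) (hg : IsMonogenicOn b g Ω)
    (hη : ∀ l ν, density (η l) ν = c • b l ν) (hX : X ∈ D) :
    HasNormalIntegral D N (fun Y => ∑ l, mulForm (normalizedKernel (a l) (Y - X)) (η l) (g Y))
      (c • (2 * κ) • g X) := by
  have hvalue := hD.cauchy_formula (q := 2 * p) (by omega) (by omega) hΩ hDΩ
    (hab.smul_left (2 / sphereArea p)) hg hX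
  rw [mul_right_comm, two_div_sphereArea_mul_kernelMass hp] at hvalue
  have hintegrable (l : ι) := integrableOn_cauchyKernel_mul (q := 2 * p) hD.isCompact_frontier
    le_rfl ((2 / sphereArea p) • a l) (hD.notMem_frontier hX)
    (hD.integrableOn_normal_mul (by omega) hΩ hDΩ hg l)
  simp only [HasNormalIntegral, density_sum, density_mulForm, hη, smul_mul_assoc, mul_smul_comm,
    ← Finset.smul_sum, normalizedKernel]
  exact ⟨(integrable_finsetSum _ fun l _ => hintegrable l).smul c, by rw [integral_smul, hvalue]⟩

theorem hasNormalIntegral_euler_normalizedKernel (hp : 1 ≤ p) (hD : IsC2Domain D N)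
    (hΩ : IsOpen Ω) (hDΩ : closure D ⊆ Ω) (hab : IsDiracFactorization κ a b)
    (hg : IsMonogenicOn b g Ω) (hη : ∀ l ν, density (η l) ν = c • b l ν) (hX : X ∈ D) :
    HasNormalIntegral D N
      (fun Y => ∑ l, mulForm (euler (fun X' => normalizedKernel (a l) (Y - X')) X) (η l) (g Y))
      (c • (2 * κ) • euler g X) := by
  have hvalue := hD.cauchy_formula_derivation (q := 2 * p) (by omega) (by omega) hΩ hDΩ
    (hab.smul_left (2 / sphereArea p)) hg hX (eulerSymbol_flip_mul_comp X)
  rw [mul_right_comm, two_div_sphereArea_mul_kernelMass hp] at hvalue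
  have hintegrable (l : ι) := integrableOn_apply_fderiv_cauchyKernel_mul (q := 2 * p)
    ((2 / sphereArea p) • a l) (eulerSymbol_flip_mul_comp X) hD.isCompact_frontier
    (hD.notMem_frontier hX) (hD.integrableOn_normal_mul (by omega) hΩ hDΩ hg l)
  simp only [HasNormalIntegral, density_sum, density_mulForm, hη, smul_mul_assoc, mul_smul_comm,
    ← Finset.smul_sum, normalizedKernel, euler_eq]
  exact ⟨(integrable_finsetSum _ fun l _ => hintegrable l).smul c, by rw [integral_smul, hvalue]⟩

theorem hasNormalIntegral_normalizedKernel_of_mul_self {b : Space p →L[ℝ] Cl p}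
    {η : Form p (Cl p)} (hp : 1 ≤ p) (hD : IsC2Domain D N) (hΩ : IsOpen Ω) (hDΩ : closure D ⊆ Ω)
    (hb : ∀ x, b x * b x = 0) (hg : IsMonogenicOn (fun _ : Unit => b) g Ω)
    (hη : ∀ ν, density η ν = c • b ν) (hX : X ∈ D) :
    HasNormalIntegral D N (fun Y => mulForm (normalizedKernel b (Y - X)) η (g Y)) 0 := by
  have hfactor : IsDiracFactorization 0 (fun _ : Unit => b) fun _ => b := fun x => by simp [hb]
  simpa using hasNormalIntegral_normalizedKernel hp hD hΩ hDΩ hfactor hg (fun _ => hη) hX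

end Formulae

namespace IsWittBasis

variable {w w' : Fin (2 * p) → Cl p} {g : Space p → Cl p} {X : Space p} {η η' : Form p (Cl p)}

theorem isDiracFactorization (hw : IsWittBasis w w') :
    IsDiracFactorization 1 ![vectorVariable zCoord w, vectorVariable zcCoord w']
      ![vectorVariable zcCoord w', vectorVariable zCoord w] := fun x => by
  simpa using hw.vectorVariable_anticomm x

theorem hasNormalIntegral (hw : IsWittBasis w w') (hp : 1 ≤ p) (hD : IsC2Domain D N)
    (hΩ : IsOpen Ω) (hDΩ : closure D ⊆ Ω)
    (hg : IsMonogenicOn ![vectorVariable zcCoord w', vectorVariable zCoord w] g Ω)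
    (hη : ∀ ν, density η ν = ((-2 * Complex.I) ^ (2 * p) / 2) • vectorVariable zcCoord w' ν)
    (hη' : ∀ ν, density η' ν = ((-2 * Complex.I) ^ (2 * p) / 2) • vectorVariable zCoord w ν)
    (hX : X ∈ D) :
    HasNormalIntegral D N (fun Y => (1 / (-2 * Complex.I) ^ (2 * p) : ℂ) •
      (mulForm (normalizedKernel (vectorVariable zCoord w) (Y - X)) η (g Y) +
        mulForm (normalizedKernel (vectorVariable zcCoord w') (Y - X)) η' (g Y))) (g X) := by
  have h := (hasNormalIntegral_normalizedKernel (η := ![η, η']) hp hD hΩ hDΩ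
    hw.isDiracFactorization hg (Fin.forall_fin_two.2 ⟨hη, hη'⟩) hX).const_smul
      (1 / (-2 * Complex.I) ^ (2 * p))
  simp only [Fin.sum_univ_two, Matrix.cons_val_zero, Matrix.cons_val_one] at h
  convert h using 1
  rw [← Complex.coe_smul, smul_smul, smul_smul]
  field_simp
  simp

theorem hasNormalIntegral_euler (hw : IsWittBasis w w') (hp : 1 ≤ p) (hD : IsC2Domain D N)
    (hΩ : IsOpen Ω) (hDΩ : closure D ⊆ Ω)
    (hg : IsMonogenicOn ![vectorVariable zcCoord w', vectorVariable zCoord w] g Ω)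
    (hη : ∀ ν, density η ν = ((-2 * Complex.I) ^ (2 * p) / 2) • vectorVariable zcCoord w' ν)
    (hη' : ∀ ν, density η' ν = ((-2 * Complex.I) ^ (2 * p) / 2) • vectorVariable zCoord w ν)
    (hX : X ∈ D) :
    HasNormalIntegral D N (fun Y =>
      mulForm (euler (fun X' => normalizedKernel (vectorVariable zCoord w) (Y - X')) X) η (g Y) +
        mulForm (euler (fun X' => normalizedKernel (vectorVariable zcCoord w') (Y - X')) X) η'
          (g Y))
      ((-2 * Complex.I) ^ (2 * p) • euler g X) := by
  have h := hasNormalIntegral_euler_normalizedKernel (η := ![η, η']) hp hD hΩ hDΩ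
    hw.isDiracFactorization hg (Fin.forall_fin_two.2 ⟨hη, hη'⟩) hX
  simp only [Fin.sum_univ_two, Matrix.cons_val_zero, Matrix.cons_val_one] at h
  convert h using 1
  rw [← Complex.coe_smul, smul_smul]
  norm_num

end IsWittBasis

/-- Differentiable null solutions of the four Dirac operators `∂_z`, `∂_z†`, `∂_z^J`, `∂_z^{†J}`,
called quaternionic monogenic functions; `osp(4|2)`-monogenicity adds the equations of `P` and
`𝓔`. -/
structure IsQuaternionicMonogenic (g : Space p → Cl p) (Ω : Set (Space p)) : Prop where
  differentiableAt : ∀ X ∈ Ω, DifferentiableAt ℝ g X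
  diracZ_eq_zero : ∀ X ∈ Ω, diracZ g X = 0
  diracZd_eq_zero : ∀ X ∈ Ω, diracZd g X = 0
  diracZJ_eq_zero : ∀ X ∈ Ω, diracZJ g X = 0
  diracZdJ_eq_zero : ∀ X ∈ Ω, diracZdJ g X = 0

theorem IsOspMonogenic.isQuaternionicMonogenic {g : Space p → Cl p} (hg : IsOspMonogenic g Ω)
    (hΩ : IsOpen Ω) : IsQuaternionicMonogenic g Ω where
  differentiableAt _ hX := hg.differentiableOn.differentiableAt (hΩ.mem_nhds hX)
  diracZ_eq_zero := hg.diracZ_eq_zero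
  diracZd_eq_zero := hg.diracZd_eq_zero
  diracZJ_eq_zero := hg.diracZJ_eq_zero
  diracZdJ_eq_zero := hg.diracZdJ_eq_zero

namespace IsQuaternionicMonogenic

variable {g : Space p → Cl p}

theorem isMonogenicOn (hg : IsQuaternionicMonogenic g Ω) :
    IsMonogenicOn ![vectorVariable zcCoord wittFd, vectorVariable zCoord wittF] g Ω where
  differentiableAt := hg.differentiableAt
  diracSymbol_eq_zero := Fin.forall_fin_two.2
    ⟨fun X hX => (diracSymbol_vectorVariable_zcCoord wittFd g X).trans <|
      smul_eq_zero_of_right _ (hg.diracZ_eq_zero X hX),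
    fun X hX => (diracSymbol_vectorVariable_zCoord wittF g X).trans <|
      smul_eq_zero_of_right _ (hg.diracZd_eq_zero X hX)⟩

theorem isMonogenicOn_rotate (hg : IsQuaternionicMonogenic g Ω) :
    IsMonogenicOn ![vectorVariable zcCoord (rotate wittF), vectorVariable zCoord (rotate wittFd)]
      g Ω where
  differentiableAt := hg.differentiableAt
  diracSymbol_eq_zero := Fin.forall_fin_two.2
    ⟨fun X hX => (diracSymbol_vectorVariable_zcCoord (rotate wittF) g X).trans <|
      smul_eq_zero_of_right _ ((diracZJ_eq g X).symm.trans (hg.diracZJ_eq_zero X hX)),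
    fun X hX => (diracSymbol_vectorVariable_zCoord (rotate wittFd) g X).trans <|
      smul_eq_zero_of_right _ ((diracZdJ_eq g X).symm.trans (hg.diracZdJ_eq_zero X hX))⟩

end IsQuaternionicMonogenic

end BoundaryIntegrals

end OspMonogenic

end

theorem mainTheorem1_general {p : ℕ} {D Ω : Set (Space p)} {N : Space p → Space p}
    {g : Space p → Cl p} {X : Space p} (hp : 1 ≤ p)
    (hD : IsC2Domain D N) (hΩ : IsOpen Ω) (hDΩ : closure D ⊆ Ω)
    (hg : IsQuaternionicMonogenic g Ω) (hX : X ∈ D) :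
    HasNormalIntegral D N
        (fun Y => (1 / (-2 * Complex.I) ^ (2 * p) : ℂ) •
          (mulForm (kerE (Y - X)) dσ (g Y) + mulForm (kerEd (Y - X)) dσd (g Y)))
        (g X) ∧
      HasNormalIntegral D N
        (fun Y => (1 / (-2 * Complex.I) ^ (2 * p) : ℂ) •
          (mulForm (kerEJ (Y - X)) dσJ (g Y) + mulForm (kerEdJ (Y - X)) dσdJ (g Y)))
        (g X) ∧
      HasNormalIntegral D N (fun Y => mulForm (kerEd (Y - X)) dσ (g Y)) 0 ∧
      HasNormalIntegral D N (fun Y => mulForm (kerEJ (Y - X)) dσdJ (g Y)) 0 ∧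
      HasNormalIntegral D N
        (fun Y => mulForm (euler (fun X' => kerE (Y - X')) X) dσ (g Y) +
          mulForm (euler (fun X' => kerEd (Y - X')) X) dσd (g Y))
        ((-2 * Complex.I) ^ (2 * p) • euler g X) ∧
      HasNormalIntegral D N
        (fun Y => mulForm (euler (fun X' => kerEJ (Y - X')) X) dσJ (g Y) +
          mulForm (euler (fun X' => kerEdJ (Y - X')) X) dσdJ (g Y))
        ((-2 * Complex.I) ^ (2 * p) • euler g X) := by
  have hw : IsWittBasis (wittF (p := p)) wittFd := isWittBasis_wittF
  have hwJ : IsWittBasis (rotate (wittFd (p := p))) (rotate wittF) := hw.symm.rotate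
  have hgw := hg.isMonogenicOn
  have hgJ := hg.isMonogenicOn_rotate
  rw [kerE_eq, kerEd_eq, kerEJ_eq, kerEdJ_eq]
  refine ⟨hw.hasNormalIntegral hp hD hΩ hDΩ hgw density_dσ density_dσd hX,
    hwJ.hasNormalIntegral hp hD hΩ hDΩ hgJ density_dσJ density_dσdJ hX, ?_, ?_,
    hw.hasNormalIntegral_euler hp hD hΩ hDΩ hgw density_dσ density_dσd hX,
    hwJ.hasNormalIntegral_euler hp hD hΩ hDΩ hgJ density_dσJ density_dσdJ hX⟩
  · exact hasNormalIntegral_normalizedKernel_of_mul_self hp hD hΩ hDΩ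
      (vectorVariable_mul_self hw.anticomm_right _) (hgw.comp fun _ => 0) density_dσ hX
  · exact hasNormalIntegral_normalizedKernel_of_mul_self hp hD hΩ hDΩ
      (vectorVariable_mul_self hwJ.anticomm_left _) (hgJ.comp fun _ => 1) density_dσdJ hX

theorem mainTheorem1 (p : ℕ) (hp : 1 ≤ p) (D Ω : Set (Space p)) (g : Space p → Cl p)
    (hD : IsSmoothBoundedDomain D) (hΩ : IsOpen Ω) (hDΩ : closure D ⊆ Ω)
    (hg : IsOspMonogenic g Ω) :
    ∀ X ∈ interior D,
      -- the two representation formulae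
      HasBoundaryIntegral D
        (fun Y => (1 / (-2 * Complex.I) ^ (2 * p) : ℂ) •
          (mulForm (kerE (Y - X)) dσ (g Y) + mulForm (kerEd (Y - X)) dσd (g Y)))
        (g X) ∧
      HasBoundaryIntegral D
        (fun Y => (1 / (-2 * Complex.I) ^ (2 * p) : ℂ) •
          (mulForm (kerEJ (Y - X)) dσJ (g Y) + mulForm (kerEdJ (Y - X)) dσdJ (g Y)))
        (g X) ∧
      -- the two single-term identities
      HasBoundaryIntegral D (fun Y => mulForm (kerEd (Y - X)) dσ (g Y)) 0 ∧
      HasBoundaryIntegral D (fun Y => mulForm (kerEJ (Y - X)) dσdJ (g Y)) 0 ∧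
      -- the two identities with the Euler operator, acting on the kernels in the variable `X`
      HasBoundaryIntegral D
        (fun Y => mulForm (euler (fun X' => kerE (Y - X')) X) dσ (g Y) +
          mulForm (euler (fun X' => kerEd (Y - X')) X) dσd (g Y)) 0 ∧
      HasBoundaryIntegral D
        (fun Y => mulForm (euler (fun X' => kerEJ (Y - X')) X) dσJ (g Y) +
          mulForm (euler (fun X' => kerEdJ (Y - X')) X) dσdJ (g Y)) 0 := by
  intro X hX
  have hXD := interior_subset hX
  have hformulae := mainTheorem1_general hp hD.isC2Domain hΩ hDΩ (hg.isQuaternionicMonogenic hΩ) hXD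
  rwa [hg.euler_eq_zero X (hDΩ (subset_closure hXD)), smul_zero] at hformulae
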